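/- **Definitions.** A *Jordan disk* is an open simply connected subset of $\mathbb C$ whose boundary is a Jordan curve. The *modulus* of an annulus conformally equivalent to $\{1<|z|<R\}$ is $\frac1{2\pi}\log R$. A *complex box mapping* is a holomorphic map $F\colon\mathcal U\to\mathcal V$ between open sets $\mathcal U\subset\mathcal V\subset\mathbb C$ such that: (1) the set $\mathrm{Crit}(F)$ of critical points of $F$ is finite; (2) $\mathcal V$ is a union of finitely many open Jordan disks with pairwise disjoint closures; (3) every component $V$ of $\mathcal V$ is either a component of $\mathcal U$, or $V\cap\mathcal U$ is a (finite or infinite, possibly empty) union of Jordan disks with pairwise disjoint closures, each compactly contained in $V$; (4) for every component $U$ of $\mathcal U$, the image $F(U)$ is a component of $\mathcal V$ and $F\colon U\to F(U)$ is proper. For $x\in\mathcal U$ let $\mathcal U_x$, $\mathcal V_x$ be the components of $\mathcal U$, $\mathcal V$ containing $x$. The *critical return domains* $\mathcal V^i$ are defined inductively by $\mathcal V^0=\mathcal V$, $\mathcal U^0=\mathcal U$; $\mathcal V^{i+1}$ is the union of the components of $\mathcal U^i$ containing critical points of $F$, and $\mathcal U^{i+1}$ is the domain of the first return map of $F$ to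 $\mathcal V^{i+1}$. **Theorem.** Let $F\colon\mathcal U\to\mathcal V$ be a complex box mapping such that: * there is $\delta>0$ such that for each $x\in\mathcal U$ either $\mathcal U_x=\mathcal V_x$, or $\mathcal V_x\setminus\overline{\mathcal U_x}$ is an annulus of modulus at least $\delta$; * $F$ does not permute components of $\mathcal U$ without critical points: for each component $U$ of $\mathcal U$ there is $n\ge0$ such that $F^n(U)\setminus\mathcal U\ne\emptyset$ or $F^n(U)$ contains a critical point of $F$. Let $\nu\ge1$ and $\kappa>0$, and let $B\subset\mathbb C$ be an open set containing all critical points of $F$ that do not lie in $\mathcal V^\nu$ (if $\mathrm{Crit}(F)\subset\mathcal V^\nu$, in particular if $\nu=1$, one may take $B=\emptyset$). Then there exist $\lambda>1$ and $C>0$ such that $$|DF^k(x)|\ge C\lambda^k$$ for all $k\ge0$ and all $x$ such that $x,\dots,F^{k-1}(x)\in\mathcal U\setminus(\mathcal V^\nu\cup B)$ and $d(F^k(x),\partial\mathcal V)\ge\kappa$. -/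

import Mathlib

open Set

/-- `W` is a connected component of the set `S`. -/
def IsComponentOf (W S : Set ℂ) : Prop :=
  ∃ x ∈ S, W = connectedComponentIn S x

/-- A (Jordan) disk: an open simply connected subset of the plane whose topological boundary is a
Jordan curve, i.e. the image of the circle under a continuous injection. (Such a set is
automatically bounded; this is recorded for convenience.) -/
def IsJordanDisk (D : Set ℂ) : Prop :=
  IsOpen D ∧ SimplyConnectedSpace D ∧ Bornology.IsBounded D ∧
    ∃ γ : Circle → ℂ, Continuous γ ∧ Function.Injective γ ∧ frontier D = range γ

/-- The round annulus `{z : 1 < |z| < R}`. -/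
def roundAnnulus (R : ℝ) : Set ℂ := {z | 1 < ‖z‖ ∧ ‖z‖ < R}

/-- `A` is an annulus of conformal modulus `m`: there is a biholomorphism of a round annulus
`{1 < |z| < R}` onto `A`, where `m = (1 / 2π) log R`. -/
def HasModulus (A : Set ℂ) (m : ℝ) : Prop :=
  ∃ R : ℝ, 1 < R ∧ m = Real.log R / (2 * Real.pi) ∧
    ∃ φ : ℂ → ℂ, DifferentiableOn ℂ φ (roundAnnulus R) ∧ BijOn φ (roundAnnulus R) A

/-- The critical points of the holomorphic map `F : U → V`. Throughout, `F` is a total function of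
which only the restriction to `U` matters. -/
def critSet (F : ℂ → ℂ) (U : Set ℂ) : Set ℂ := {x ∈ U | deriv F x = 0}

/-- `F : U → V` is a complex box mapping. -/
structure IsComplexBoxMapping (F : ℂ → ℂ) (U V : Set ℂ) : Prop where
  isOpen_dom : IsOpen U
  isOpen_range : IsOpen V
  dom_subset : U ⊆ V
  mapsTo : MapsTo F U V
  holomorphic : DifferentiableOn ℂ F U
  /-- finitely many critical points -/
  finite_crit : (critSet F U).Finite
  /-- `V` is a finite union of open Jordan disks with pairwise disjoint closures -/
  finite_range : {W | IsComponentOf W V}.Finite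
  jordan_range : ∀ W, IsComponentOf W V → IsJordanDisk W
  disjoint_range : {W | IsComponentOf W V}.PairwiseDisjoint closure
  /-- every component of `V` is a component of `U`, or meets `U` in a (possibly infinite, possibly
  empty) union of Jordan disks with pairwise disjoint closures, each compactly contained in it -/
  component_range : ∀ W, IsComponentOf W V → IsComponentOf W U ∨
    ((∀ D, IsComponentOf D U → D ⊆ W → IsJordanDisk D ∧ closure D ⊆ W) ∧
      {D | IsComponentOf D U ∧ D ⊆ W}.PairwiseDisjoint closure)
  /-- every component of `U` is mapped onto a component of `V` -/
  image_component : ∀ D, IsComponentOf D U → IsComponentOf (F '' D) V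
  /-- ... and properly so -/
  proper_component : ∀ D, IsComponentOf D U → IsProperMap ((mapsTo_image F D).restrict F D (F '' D))

/-- The domain of the first return map to `A` under the partial map `F : U → V`: the points of `A`
some forward iterate of which (of positive time, along an orbit that stays in the domain `U` of `F`
up to that time) lies in `A`. -/
def returnDomain (F : ℂ → ℂ) (U A : Set ℂ) : Set ℂ :=
  {x ∈ A | ∃ n ≥ 1, (∀ j < n, F^[j] x ∈ U) ∧ F^[n] x ∈ A}

/-- The union of the components of `S` that contain critical points of `F`. -/
def criticalPart (F : ℂ → ℂ) (U S : Set ℂ) : Set ℂ :=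
  {x ∈ S | (connectedComponentIn S x ∩ critSet F U).Nonempty}

/-- The critical return domains of `F : U → V`: `V⁰ = V`, and `Vⁱ⁺¹` is the union of the components
of `Uⁱ` containing critical points, where `Uⁱ` is the domain of the first return map to `Vⁱ`
(for `i = 0` this is `U` itself, see `returnDomain_self`). -/
def criticalReturn (F : ℂ → ℂ) (U V : Set ℂ) : ℕ → Set ℂ
  | 0 => V
  | i + 1 => criticalPart F U (returnDomain F U (criticalReturn F U V i))

theorem returnDomain_self {F : ℂ → ℂ} {U V : Set ℂ} (h : IsComplexBoxMapping F U V) :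
    returnDomain F U V = U := by
  ext x
  constructor
  · rintro ⟨-, n, hn, hU, -⟩
    exact hU 0 hn
  · intro hx
    refine ⟨h.dom_subset hx, 1, le_rfl, ?_, by simpa using h.mapsTo hx⟩
    intro j hj
    obtain rfl : j = 0 := by omega
    simpa using hx

/-- Every component of `U` either equals the component of `V` containing it, or is `δ`-well-inside
it: the difference `V_x \ closure U_x` is an annulus of modulus at least `δ`. -/
def WellInsideOrEqual (U V : Set ℂ) (δ : ℝ) : Prop :=
  ∀ x ∈ U, connectedComponentIn U x = connectedComponentIn V x ∨
    ∃ m ≥ δ, HasModulus (connectedComponentIn V x \ closure (connectedComponentIn U x)) m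

/-- No cycle of components of `U` without critical points is permuted by `F`: the successive images
of each component of `U` leave `U`, unless one of them contains a critical point. -/
def NoNoncriticalPermutation (F : ℂ → ℂ) (U : Set ℂ) : Prop :=
  ∀ D, IsComponentOf D U →
    ∃ n : ℕ, (F^[n] '' D \ U).Nonempty ∨ (F^[n] '' D ∩ critSet F U).Nonempty

/-! The inverse branch of `F^[k]` that sends `F^[k] x` to `x` is univalent on a disk of definite
radius, and its image lies in the puzzle piece of depth `k` about `x`, whose diameter is
exponentially small in `k`. Schwarz's estimate for the inverse branch turns this into exponential
growth of the derivative.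

Shrinking (`exists_dist_le`). Along an orbit that avoids `V^ν`, the pullbacks meet each critical
point boundedly often (`exists_card_encounters_le`), so the iterates on pieces have bounded degree.
Among any `b` consecutive times there is one at which the component of `U` is strictly inside that
of `V` (`exists_component_ne`): otherwise a cycle of components would be permuted, would carry a
critical point, and would lie in `V^ν`. At such a time the annulus of modulus at least `δ` yields
Harnack's inequality (`HasModulus.exists_harnackOn`), and bounded degree transfers it to two
consecutive nested pieces (`HarnackOn.exists_transfer`). Harnack's inequality contracts the
oscillation of real parts by a fixed factor; applied to `z` and `-iz` it shrinks diameters.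
Harnack's constant thus plays the role of the modulus.

Univalence. The `r`-ball about each critical point lies in `V^ν ∪ B`, which the orbit avoids. If the
pullback of a small disk met a critical point at time `i`, it would be too small to keep `F^[i] x`
out of that ball: for deep pullbacks by the shrinking, for shallow ones because only finitely many
critical points and iterates occur (`exists_forall_subset_ball`).

Topology. Covering maps and Blaschke products require pieces without holes. This is expressed by
`ChainFull`, which passes to components of preimages by the maximum principle and supplies the
square roots needed for the Riemann mapping theorem. -/

open Complex Metric ComplexConjugate

/-! ### Plane sets without holes, described by chains in the complement. -/

/-- One step of an `ε`-chain in the complement of `Q`. -/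
def ChainStep (Q : Set ℂ) (ε : ℝ) (a b : ℂ) : Prop := b ∉ Q ∧ dist a b < ε

/-- Every point of the complement of `Q` is joined to infinity by `ε`-chains in the complement,
for every `ε > 0`: for a bounded open set, this says that the complement has no bounded
component. -/
def ChainFull (Q : Set ℂ) : Prop :=
  ∀ ε > 0, ∀ R : ℝ, ∀ α ∉ Q, ∃ β ∉ Q, R < ‖β‖ ∧ Relation.ReflTransGen (ChainStep Q ε) α β

theorem notMem_of_reflTransGen_chainStep {Q : Set ℂ} {ε : ℝ} {a b : ℂ} (ha : a ∉ Q)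
    (h : Relation.ReflTransGen (ChainStep Q ε) a b) : b ∉ Q := by
  induction h with
  | refl => exact ha
  | tail _ hbc _ => exact hbc.1

/-- If chains starting at a point of the complement stay bounded, they sweep out a compact subset
of the complement which is isolated in it. -/
theorem exists_isolated_of_not_chainFull {Q : Set ℂ} (hQ : IsOpen Q) (h : ¬ ChainFull Q) :
    ∃ ε > 0, ∃ α : ℂ, ∃ E : Set ℂ, α ∈ E ∧ IsCompact E ∧ Disjoint E Q ∧
      ∀ e ∈ E, ∀ z ∉ Q, dist e z < ε → z ∈ E := by
  simp only [ChainFull, not_forall, not_exists, not_and] at h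
  obtain ⟨ε, hε, R, α, hα, hR⟩ := h
  have hstep : ∀ e ∈ {β | Relation.ReflTransGen (ChainStep Q ε) α β}, ∀ z ∉ Q, dist e z < ε →
      z ∈ {β | Relation.ReflTransGen (ChainStep Q ε) α β} :=
    fun e he z hz hd => Relation.ReflTransGen.tail he ⟨hz, hd⟩
  have hEQ : ∀ e ∈ {β | Relation.ReflTransGen (ChainStep Q ε) α β}, e ∉ Q :=
    fun e he => notMem_of_reflTransGen_chainStep hα he
  refine ⟨ε, hε, α, {β | Relation.ReflTransGen (ChainStep Q ε) α β}, Relation.ReflTransGen.refl,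
    ?_, disjoint_left.2 hEQ, hstep⟩
  refine Metric.isCompact_of_isClosed_isBounded (isClosed_of_closure_subset fun z hz => ?_) ?_
  · have hzQ : z ∉ Q := by
      have : closure {β | Relation.ReflTransGen (ChainStep Q ε) α β} ⊆ Qᶜ :=
        closure_minimal hEQ hQ.isClosed_compl
      exact this hz
    obtain ⟨e, he, hd⟩ := Metric.mem_closure_iff.1 hz ε hε
    exact hstep e he z hzQ (by rwa [dist_comm])
  · refine (Metric.isBounded_closedBall (x := (0 : ℂ)) (r := R)).subset fun β hβ => ?_
    rw [mem_closedBall_zero_iff]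
    by_contra hlt
    exact hR β (hEQ β hβ) (not_le.1 hlt) hβ

/-- A compact set that is open is empty. -/
theorem IsCompact.eq_empty_of_isOpen_complex {E : Set ℂ} (hE : IsCompact E) (ho : IsOpen E) :
    E = ∅ := by
  rcases isClopen_iff.1 ⟨hE.isClosed, ho⟩ with h | h
  · exact h
  · exact absurd (h ▸ hE) (noncompact_univ ℂ)

theorem frontier_infDist_lt_subset {E : Set ℂ} {r : ℝ} :
    frontier {z | Metric.infDist z E < r} ⊆ {z | Metric.infDist z E = r} :=
  frontier_lt_subset_eq (Metric.continuous_infDist_pt E) continuous_const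

theorem closure_infDist_lt_subset {E : Set ℂ} {r : ℝ} :
    closure {z | Metric.infDist z E < r} ⊆ {z | Metric.infDist z E ≤ r} :=
  closure_lt_subset_le (Metric.continuous_infDist_pt E) continuous_const

theorem isBounded_infDist_lt {E : Set ℂ} (hE : IsCompact E) (hne : E.Nonempty) (r : ℝ) :
    Bornology.IsBounded {z | Metric.infDist z E < r} := by
  obtain ⟨R, hR⟩ := hE.isBounded.subset_closedBall 0
  refine (Metric.isBounded_closedBall (x := (0 : ℂ)) (r := R + r)).subset fun z hz => ?_
  obtain ⟨e, he, hd⟩ := (Metric.infDist_lt_iff hne).1 hz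
  have := hR he
  rw [mem_closedBall_zero_iff] at this ⊢
  have h2 := norm_le_norm_add_norm_sub' z e
  rw [dist_eq_norm] at hd
  linarith

/-- Components of the preimage of a chain-full set under a holomorphic map defined on a chain-full
set are chain-full. -/
theorem ChainFull.connectedComponentIn_preimage {D P' : Set ℂ} {F : ℂ → ℂ} (hD : IsOpen D)
    (hDf : ChainFull D) (hF : DifferentiableOn ℂ F D) (hP : IsOpen P') (hPf : ChainFull P')
    (z₀ : ℂ) : ChainFull (connectedComponentIn (D ∩ F ⁻¹' P') z₀) := by
  set S := D ∩ F ⁻¹' P' with hS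
  have hSo : IsOpen S := hF.continuousOn.isOpen_inter_preimage hD hP
  set P := connectedComponentIn S z₀ with hPdef
  have hPo : IsOpen P := hSo.connectedComponentIn
  by_contra hcon
  obtain ⟨ε, hε, α, E, hα, hE, hEP, hiso⟩ := exists_isolated_of_not_chainFull hPo hcon
  have hPS : P ⊆ S := connectedComponentIn_subset S z₀
  have hne : E.Nonempty := ⟨α, hα⟩
  -- points of the complement near `E` belong to `E`
  have hnear : ∀ z, Metric.infDist z E < ε → z ∉ P → z ∈ E := by
    intro z hz hzP
    obtain ⟨e, he, hd⟩ := (Metric.infDist_lt_iff hne).1 hz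
    exact hiso e he z hzP (by rwa [dist_comm])
  -- An `ε`-chain outside `D` also avoids `P`, so one that starts in `E` never leaves `E`; but such
  -- chains are unbounded.
  have hED : E ⊆ D := by
    intro e he
    by_contra heD
    obtain ⟨R, hR⟩ := hE.isBounded.subset_closedBall 0
    obtain ⟨β, -, hβR, hβ⟩ := hDf ε hε R e heD
    have : β ∈ E := by
      clear hβR
      induction hβ with
      | refl => exact he
      | tail _ hbc ih => exact hiso _ ih _ (fun h => hbc.1 (hPS h).1) hbc.2
    have := hR this
    rw [mem_closedBall_zero_iff] at this
    linarith
  set N := {z | Metric.infDist z E < ε / 2} with hN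
  have hNo : IsOpen N := isOpen_lt (Metric.continuous_infDist_pt E) continuous_const
  have hNb : Bornology.IsBounded N := isBounded_infDist_lt hE hne _
  have hclN : closure N ⊆ D := by
    intro z hz
    have h1 : Metric.infDist z E ≤ ε / 2 := closure_infDist_lt_subset hz
    by_cases hzP : z ∈ P
    · exact (hPS hzP).1
    · exact hED (hnear z (by linarith) hzP)
  have hfrP : frontier N ⊆ P := by
    intro z hz
    have h1 : Metric.infDist z E = ε / 2 := frontier_infDist_lt_subset hz
    by_contra hzP
    have := hnear z (by linarith) hzP
    rw [Metric.infDist_zero_of_mem this] at h1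
    linarith
  have hclK : IsCompact (closure N) := hNb.isCompact_closure
  have hfrK : IsCompact (frontier N) := hclK.of_isClosed_subset isClosed_frontier
    frontier_subset_closure
  -- If `F z` missed `P'`, the chains of step `η` from `F z` in the complement of `P'` would be
  -- trapped in the bounded set `F '' N`. Here `η` bounds below the distance from `F '' frontier N`
  -- to that complement.
  have hNP' : ∀ z ∈ N, F z ∈ P' := by
    have hFfr : IsCompact (F '' frontier N) :=
      hfrK.image_of_continuousOn (hF.continuousOn.mono (frontier_subset_closure.trans hclN))
    have hsub : F '' frontier N ⊆ P' := by
      rintro _ ⟨z, hz, rfl⟩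
      exact (hPS (hfrP hz)).2
    obtain ⟨η, hη, hthick⟩ := hFfr.exists_thickening_subset_open hP hsub
    have hfar : ∀ p ∉ P', ∀ z ∈ frontier N, η ≤ dist (F z) p := by
      intro p hp z hz
      by_contra hlt
      exact hp (hthick (Metric.mem_thickening_iff.2 ⟨F z, mem_image_of_mem _ hz, by
        rw [dist_comm]; exact not_le.1 hlt⟩))
    intro z hz
    by_contra hzP'
    obtain ⟨R, hR⟩ := (hclK.image_of_continuousOn (hF.continuousOn.mono hclN)).isBounded
      |>.subset_closedBall 0
    obtain ⟨β, -, hβR, hβ⟩ := hPf η hη R (F z) hzP'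
    have : β ∈ F '' N := by
      clear hβR
      induction hβ with
      | refl => exact mem_image_of_mem _ hz
      | @tail b c hab hbc ih =>
        by_contra hc
        obtain ⟨w, hw, rfl⟩ := ih
        have hcl : ∀ y ∈ closure N, F y - c ≠ 0 := by
          intro y hy h0
          rw [sub_eq_zero] at h0
          rw [closure_eq_self_union_frontier] at hy
          rcases hy with hy | hy
          · exact hc ⟨y, hy, h0⟩
          · have := hfar c hbc.1 y hy
            rw [h0, dist_self] at this
            linarith
        -- Maximum principle for `1 / (F - c)`: being at distance at least `η` from `F '' frontier
        -- N`, an omitted value `c` is that far from `F w` too, against the length of the step.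
        have hd : DiffContOnCl ℂ (fun y => (F y - c)⁻¹) N := by
          refine ⟨((hF.mono (subset_closure.trans hclN)).sub_const c).inv
            fun y hy => hcl y (subset_closure hy), ?_⟩
          exact ((hF.continuousOn.mono hclN).sub continuousOn_const).inv₀ hcl
        have hb := Complex.norm_le_of_forall_mem_frontier_norm_le hNb hd (C := η⁻¹)
          (fun y hy => by
            rw [norm_inv]
            have := hfar c hbc.1 y hy
            rw [dist_eq_norm] at this
            exact inv_anti₀ hη this) (subset_closure hw)
        rw [norm_inv] at hb
        have hpos : 0 < ‖F w - c‖ := norm_pos_iff.2 (hcl w (subset_closure hw))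
        have := (inv_le_inv₀ hpos hη).1 hb
        have h3 := hbc.2
        rw [dist_eq_norm] at h3
        linarith
    obtain ⟨y, hy, rfl⟩ := this
    have := hR (mem_image_of_mem F (subset_closure hy))
    rw [mem_closedBall_zero_iff] at this
    linarith
  -- A small ball about a point `e` of `E` lies in `S`; if it met the component `P`, then `e` would
  -- belong to `P`.
  have hEo : IsOpen E := by
    rw [Metric.isOpen_iff]
    intro e he
    refine ⟨ε / 2, by positivity, ?_⟩
    have hball : Metric.ball e (ε / 2) ⊆ N := fun z hz =>
      (Metric.infDist_le_dist_of_mem he).trans_lt hz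
    have hbS : Metric.ball e (ε / 2) ⊆ S := fun z hz =>
      ⟨hclN (subset_closure (hball hz)), hNP' z (hball hz)⟩
    intro z hz
    refine hnear z (lt_trans (hball hz) (by linarith)) fun hzP => ?_
    refine disjoint_left.1 hEP he ?_
    have h1 : connectedComponentIn S z = P := (connectedComponentIn_eq hzP).symm
    rw [← h1]
    exact (convex_ball e (ε / 2)).isPreconnected.subset_connectedComponentIn hz hbS
      (Metric.mem_ball_self (by positivity))
  rw [hE.eq_empty_of_isOpen_complex hEo] at hα
  exact hα

/-- An isolated compact part of the complement has a point of largest norm; moving it radially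
outwards by `ε / 2` stays in the complement and within `ε`, hence in the same part, a contradiction.
-/
theorem chainFull_ball (R : ℝ) : ChainFull (Metric.ball 0 R) := by
  by_contra hcon
  obtain ⟨ε, hε, α, E, hα, hE, hEP, hiso⟩ :=
    exists_isolated_of_not_chainFull Metric.isOpen_ball hcon
  obtain ⟨e, he, hmax⟩ := hE.exists_isMaxOn ⟨α, hα⟩ continuous_norm.continuousOn
  have heR : R ≤ ‖e‖ := by
    have := disjoint_left.1 hEP he
    rwa [mem_ball_zero_iff, not_lt] at this
  obtain ⟨u, hu, hue⟩ : ∃ u : ℂ, ‖u‖ = 1 ∧ (‖e‖ : ℂ) * u = e := by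
    by_cases h0 : e = 0
    · exact ⟨1, by simp, by simp [h0]⟩
    · refine ⟨e / ‖e‖, by simp [h0], ?_⟩
      have : (‖e‖ : ℂ) ≠ 0 := by simpa using h0
      field_simp
  have hnorm : ‖e + (ε / 2 : ℝ) * u‖ = ‖e‖ + ε / 2 := by
    nth_rewrite 1 [← hue]
    rw [← add_mul, norm_mul, hu, mul_one, ← Complex.ofReal_add, Complex.norm_real,
      Real.norm_of_nonneg (by positivity)]
  have h1 : e + (ε / 2 : ℝ) * u ∈ E := by
    refine hiso e he _ ?_ ?_
    · rw [mem_ball_zero_iff, hnorm]; linarith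
    · rw [dist_eq_norm]
      have : e - (e + (ε / 2 : ℝ) * u) = -((ε / 2 : ℝ) * u) := by ring
      rw [this, norm_neg, norm_mul, hu, Complex.norm_real, Real.norm_of_nonneg (by positivity)]
      linarith
  have := hmax h1
  simp only [mem_ofPred_eq, hnorm] at this
  linarith

/-- There is no continuous logarithm of `z - α` along a circle around `α`. -/
theorem not_exists_log_on_circle (α : ℂ) (r : ℝ) (H : ℂ → ℂ) (hH : Continuous H)
    (hexp : ∀ θ : ℝ, Complex.exp (H (α + r * Complex.exp (θ * Complex.I))) =
      r * Complex.exp (θ * Complex.I)) : False := by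
  -- Subtracting the angle makes `exp ∘ g` constant, so `g` has values in a discrete set and is
  -- constant; but the first term is `2π`-periodic and the angle is not.
  set g : ℝ → ℂ := fun θ => H (α + r * Complex.exp (θ * Complex.I)) - θ * Complex.I with hg
  have hgc : Continuous g := by fun_prop
  have hgexp : ∀ θ, Complex.exp (g θ) = r := by
    intro θ
    rw [hg]
    simp only
    rw [Complex.exp_sub, hexp, mul_div_assoc, div_self (Complex.exp_ne_zero _), mul_one]
  have hdisc : ∀ θ, ∃ n : ℤ, g θ = g 0 + n * (2 * Real.pi * Complex.I) := fun θ =>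
    Complex.exp_eq_exp_iff_exists_int.1 ((hgexp θ).trans (hgexp 0).symm)
  choose n hn using hdisc
  have hpi : (2 * Real.pi * Complex.I) ≠ 0 := by simp [Real.pi_ne_zero]
  have hncont : Continuous fun θ => ((n θ : ℤ) : ℝ) := by
    have : (fun θ => ((n θ : ℤ) : ℝ)) = fun θ => ((g θ - g 0) / (2 * Real.pi * Complex.I)).re := by
      funext θ
      rw [hn θ, add_sub_cancel_left, mul_div_cancel_right₀ _ hpi]
      simp
    rw [this]
    fun_prop
  have hnc : Continuous n := Int.isClosedEmbedding_coe_real.isEmbedding.continuous_iff.2 hncont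
  have hconst : n (2 * Real.pi) = n 0 := PreconnectedSpace.constant inferInstance hnc
  have h1 : g (2 * Real.pi) = g 0 := by
    rw [hn (2 * Real.pi), hconst, ← hn 0]
  simp only [hg] at h1
  have h2 : Complex.exp ((2 * Real.pi : ℝ) * Complex.I) = Complex.exp ((0 : ℝ) * Complex.I) := by
    simp
  rw [h2] at h1
  have h3 : ((2 * Real.pi : ℝ) : ℂ) * Complex.I = ((0 : ℝ) : ℂ) * Complex.I := by
    linear_combination -h1
  simp [Real.pi_ne_zero] at h3

/-- A simply connected open set is chain-full. -/
theorem chainFull_of_simplyConnectedSpace {D : Set ℂ} (hD : IsOpen D)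
    (hs : SimplyConnectedSpace D) : ChainFull D := by
  by_contra hcon
  obtain ⟨ε, hε, α, E, hα, hE, hED, hiso⟩ := exists_isolated_of_not_chainFull hD hcon
  have hne : E.Nonempty := ⟨α, hα⟩
  have hαD : α ∉ D := disjoint_left.1 hED hα
  obtain ⟨f, hfc, hf⟩ := Complex.exists_continuousOn_eqOn_exp_comp
    (U := D) hs hD
    (g := fun z => z - α) (by fun_prop) (by
      rintro ⟨z, hz, h0⟩
      exact hαD (by rwa [← sub_eq_zero.1 h0]))
  have hdc : Continuous fun z => Metric.infDist z E := Metric.continuous_infDist_pt E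
  have hnear : ∀ z, 0 < Metric.infDist z E → Metric.infDist z E < ε → z ∈ D := by
    intro z h0 hz
    by_contra hzP
    obtain ⟨e, he, hd⟩ := (Metric.infDist_lt_iff hne).1 hz
    have := hiso e he z hzP (by rwa [dist_comm])
    rw [Metric.infDist_zero_of_mem this] at h0
    exact lt_irrefl _ h0
  -- A cutoff: 0 within `ε / 8` of `E`, 1 beyond `ε / 4`.
  set χ : ℂ → ℝ := fun z => min 1 (max 0 (8 * Metric.infDist z E / ε - 1)) with hχ
  have hχc : Continuous χ := by fun_prop
  classical
  -- A continuous zero-free function on the whole plane that equals `z - α` away from `E`: on the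
  -- collar, `exp (χ f)` interpolates between 1 and `z - α`. The values of `f` on `E` do not matter,
  -- since `χ` vanishes there.
  set h : ℂ → ℂ := fun z => if Metric.infDist z E < ε / 2 then Complex.exp (χ z * f z) else z - α
    with hh
  have hsmall : ∀ z, Metric.infDist z E < ε / 8 → h z = 1 := by
    intro z hz
    have : χ z = 0 := by
      have : 8 * Metric.infDist z E / ε - 1 ≤ 0 := by
        rw [sub_nonpos, div_le_one hε]; linarith
      simp [hχ, max_eq_left this]
    rw [hh]
    simp only
    rw [if_pos (by linarith), this]
    simp
  have hbig : ∀ z, ε / 4 < Metric.infDist z E → h z = z - α := by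
    intro z hz
    rw [hh]
    simp only
    split_ifs with h1
    · have : χ z = 1 := by
        have h2 : 1 ≤ 8 * Metric.infDist z E / ε - 1 := by
          rw [le_sub_iff_add_le, le_div_iff₀ hε]; linarith
        simp [hχ, h2]
      rw [this]
      have := hf (hnear z (by linarith) (by linarith))
      simpa using this
    · rfl
  have hhc : Continuous h := by
    rw [continuous_iff_continuousAt]
    intro z
    rcases lt_or_ge (Metric.infDist z E) (ε / 8) with h1 | h1
    · refine continuousAt_const.congr (f := fun _ => (1 : ℂ)) ?_
      filter_upwards [(isOpen_lt hdc continuous_const).mem_nhds h1] with w hw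
      exact (hsmall w hw).symm
    · rcases lt_or_ge (ε / 4) (Metric.infDist z E) with h2 | h2
      · refine ContinuousAt.congr (f := fun w => w - α) (by fun_prop) ?_
        filter_upwards [(isOpen_lt continuous_const hdc).mem_nhds h2] with w hw
        exact (hbig w hw).symm
      · have hzD : z ∈ D := hnear z (by linarith) (by linarith)
        refine ContinuousAt.congr (f := fun w => Complex.exp (χ w * f w)) ?_ ?_
        · have := hfc.continuousAt (hD.mem_nhds hzD)
          have h3 := hχc.continuousAt (x := z)
          fun_prop
        · have h3 : Metric.infDist z E < ε / 2 := by linarith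
          filter_upwards [(isOpen_lt hdc continuous_const).mem_nhds h3] with w hw
          rw [hh]
          simp only
          rw [if_pos hw]
  have hh0 : ∀ z, h z ≠ 0 := by
    intro z
    rw [hh]
    simp only
    split_ifs with h1
    · exact Complex.exp_ne_zero _
    · intro h0
      rw [sub_eq_zero.1 h0, Metric.infDist_zero_of_mem hα] at h1
      linarith
  have huniv : IsSimplyConnected (univ : Set ℂ) := by
    unfold IsSimplyConnected
    have := (Homeomorph.Set.univ ℂ).contractibleSpace_iff.2 inferInstance
    exact SimplyConnectedSpace.ofContractible _
  obtain ⟨H, hHc, hH⟩ := Complex.exists_continuousOn_eqOn_exp_comp huniv isOpen_univ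
    hhc.continuousOn (by rintro ⟨z, -, hz⟩; exact hh0 z hz)
  -- The circle of radius `|R| + ε` about `α` stays at distance at least `ε` from `E`, so the global
  -- logarithm of `h` is a logarithm of `z - α` along it.
  obtain ⟨R, hR⟩ := hE.isBounded.subset_ball α
  refine not_exists_log_on_circle α (|R| + ε) H (continuousOn_univ.1 hHc) fun θ => ?_
  have h1 := hH (mem_univ (α + ((|R| + ε : ℝ) : ℂ) * Complex.exp (θ * Complex.I)))
  simp only [Function.comp_apply] at h1
  push_cast at h1 ⊢
  rw [h1, hbig, add_sub_cancel_left]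
  refine lt_of_lt_of_le (by linarith : ε / 4 < ε) ?_
  refine (Metric.le_infDist hne).2 fun e he => ?_
  have h2 := hR he
  rw [Metric.mem_ball] at h2
  have h3 : dist (α + ((|R| : ℝ) + (ε : ℝ) : ℂ) * Complex.exp (θ * Complex.I)) α = |R| + ε := by
    rw [dist_eq_norm, add_sub_cancel_left, norm_mul, Complex.norm_exp_ofReal_mul_I, mul_one,
      ← Complex.ofReal_add, Complex.norm_real, Real.norm_of_nonneg (by positivity)]
  have h4 := dist_triangle (α + ((|R| : ℝ) + (ε : ℝ) : ℂ) * Complex.exp (θ * Complex.I)) e α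
  have := le_abs_self R
  linarith

/-! ### Square roots on sets without holes. -/

/-- On the part of a bounded chain-full set at distance more than `ε` from the complement,
`z - α` has a continuous square root, for each point `α` of the complement. -/
theorem ChainFull.exists_sqrt_of_infDist {Q : Set ℂ} (hb : Bornology.IsBounded Q)
    (hQ : ChainFull Q) {ε : ℝ} (hε : 0 < ε) {α : ℂ} (hα : α ∉ Q) :
    ∃ s : ℂ → ℂ, ContinuousOn s {z ∈ Q | ε < Metric.infDist z Qᶜ} ∧
      ∀ z ∈ {z ∈ Q | ε < Metric.infDist z Qᶜ}, s z ^ 2 = z - α := by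
  obtain ⟨R, hR⟩ := hb.subset_ball 0
  obtain ⟨β, hβ, hRβ, hchain⟩ := hQ ε hε (max R 0) α hα
  have hfar : ∀ p ∉ Q, ∀ z ∈ {z ∈ Q | ε < Metric.infDist z Qᶜ}, ε < ‖z - p‖ := by
    intro p hp z hz
    rw [← dist_eq_norm]
    exact hz.2.trans_le (Metric.infDist_le_dist_of_mem hp)
  have hsqrt : ∀ w : ℂ, ‖w‖ < 1 → Complex.exp (Complex.log (1 + w) / 2) ^ 2 = 1 + w := by
    intro w hw
    rw [← Complex.exp_nat_mul]
    push_cast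
    rw [mul_div_cancel₀ _ (two_ne_zero), Complex.exp_log]
    exact Complex.slitPlane_ne_zero (Complex.mem_slitPlane_of_norm_lt_one hw)
  clear hα
  -- Transport the root along the chain from its far end. At `β` the principal branch works because
  -- `|z| < |β|` on `Q`; a step from `b` back to `a` multiplies by a principal root of `(z - a) / (z
  -- - b)`, which is within 1 of 1 because the step is shorter than `|z - b|`.
  induction hchain using Relation.ReflTransGen.head_induction_on with
  | refl =>
    have hβ0 : 0 < ‖β‖ := (le_max_right _ _).trans_lt hRβ
    have hβ1 : β ≠ 0 := norm_pos_iff.1 hβ0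
    have hz1 : ∀ z ∈ Q, ‖-z / β‖ < 1 := by
      intro z hz
      have := hR hz
      rw [mem_ball_zero_iff] at this
      rw [norm_div, norm_neg, div_lt_one hβ0]
      exact this.trans ((le_max_left _ _).trans_lt hRβ)
    obtain ⟨c, hc⟩ := IsAlgClosed.exists_pow_nat_eq (-β) two_pos
    refine ⟨fun z => c * Complex.exp (Complex.log (1 + -z / β) / 2), ?_, fun z hz => ?_⟩
    · refine continuousOn_const.mul (Complex.continuous_exp.comp_continuousOn
        (ContinuousOn.div_const (ContinuousOn.clog (by fun_prop) fun z hz => ?_) _))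
      exact Complex.mem_slitPlane_of_norm_lt_one (hz1 z hz.1)
    · rw [mul_pow, hsqrt _ (hz1 z hz.1), hc]
      field_simp
      ring
  | @head a b hab _ ih =>
    obtain ⟨s, hs, hs2⟩ := ih
    have hzb : ∀ z ∈ {z ∈ Q | ε < Metric.infDist z Qᶜ}, z - b ≠ 0 := fun z hz =>
      norm_pos_iff.1 (hε.trans (hfar b hab.1 z hz))
    have hz1 : ∀ z ∈ {z ∈ Q | ε < Metric.infDist z Qᶜ}, ‖(b - a) / (z - b)‖ < 1 := by
      intro z hz
      have h1 := hfar b hab.1 z hz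
      have h2 := hab.2
      rw [dist_comm, dist_eq_norm] at h2
      rw [norm_div, div_lt_one (hε.trans h1)]
      exact h2.trans h1
    refine ⟨fun z => s z * Complex.exp (Complex.log (1 + (b - a) / (z - b)) / 2), ?_,
      fun z hz => ?_⟩
    · refine hs.mul (Complex.continuous_exp.comp_continuousOn
        (ContinuousOn.div_const (ContinuousOn.clog ?_ fun z hz => ?_) _))
      · exact continuousOn_const.add (continuousOn_const.div (by fun_prop) hzb)
      · exact Complex.mem_slitPlane_of_norm_lt_one (hz1 z hz)
    · have := hzb z hz
      rw [mul_pow, hsqrt _ (hz1 z hz), hs2 z hz]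
      field_simp
      ring

/-- A point of an open connected plane set lies together with any other one in a component of the
set of points at distance more than `1 / (n + 1)` from the complement. -/
theorem exists_mem_connectedComponentIn_infDist {Q : Set ℂ} (hQo : IsOpen Q)
    (hQc : IsPreconnected Q) (hQu : (Qᶜ : Set ℂ).Nonempty) {z₀ z : ℂ} (hz₀ : z₀ ∈ Q) (hz : z ∈ Q) :
    ∃ n : ℕ, z ∈ connectedComponentIn {w ∈ Q | 1 / ((n : ℝ) + 1) < Metric.infDist w Qᶜ} z₀ := by
  have hpc : IsPathConnected Q := hQo.isConnected_iff_isPathConnected.1 ⟨⟨z₀, hz₀⟩, hQc⟩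
  obtain ⟨γ, hγ⟩ := hpc.joinedIn z₀ hz₀ z hz
  have hK : IsCompact (range γ) := isCompact_range γ.continuous
  have hpos : ∀ w ∈ range γ, 0 < Metric.infDist w Qᶜ := by
    rintro _ ⟨t, rfl⟩
    exact (hQo.isClosed_compl.notMem_iff_infDist_pos hQu).1 (by simpa using hγ t)
  obtain ⟨w, hw, hmin⟩ := hK.exists_isMinOn (range_nonempty γ)
    (Metric.continuous_infDist_pt Qᶜ).continuousOn
  obtain ⟨n, hn⟩ := exists_nat_one_div_lt (hpos w hw)
  refine ⟨n, (isPreconnected_range γ.continuous).subset_connectedComponentIn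
    ⟨0, γ.source⟩ ?_ ⟨1, γ.target⟩⟩
  rintro _ ⟨t, rfl⟩
  exact ⟨hγ t, hn.trans_le (hmin (mem_range_self t))⟩

/-- On a bounded connected chain-full open set that does not contain `α`, there is a continuous
square root of `z - α`. -/
theorem ChainFull.exists_sqrt {Q : Set ℂ} (hQo : IsOpen Q) (hQc : IsConnected Q)
    (hb : Bornology.IsBounded Q) (hQ : ChainFull Q) {α : ℂ} (hα : α ∉ Q) :
    ∃ s : ℂ → ℂ, ContinuousOn s Q ∧ ∀ z ∈ Q, s z ^ 2 = z - α := by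
  obtain ⟨z₀, hz₀⟩ := hQc.nonempty
  set T : ℕ → Set ℂ := fun n => {w ∈ Q | 1 / ((n : ℝ) + 1) < Metric.infDist w Qᶜ} with hT
  have hTo : ∀ n, IsOpen (T n) := fun n =>
    hQo.inter (isOpen_lt continuous_const (Metric.continuous_infDist_pt _))
  set C : ℕ → Set ℂ := fun n => connectedComponentIn (T n) z₀ with hC
  have hCo : ∀ n, IsOpen (C n) := fun n => (hTo n).connectedComponentIn
  have hCT : ∀ n, C n ⊆ T n := fun n => connectedComponentIn_subset _ _
  have hTm : Monotone T := by
    intro m n hmn w hw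
    refine ⟨hw.1, lt_of_le_of_lt ?_ hw.2⟩
    exact one_div_le_one_div_of_le (by positivity) (by exact_mod_cast Nat.succ_le_succ hmn)
  have hCm : Monotone C := fun m n hmn => connectedComponentIn_mono z₀ (hTm hmn)
  obtain ⟨c, hc⟩ := IsAlgClosed.exists_pow_nat_eq (z₀ - α) two_pos
  -- Prescribing the value `c` at `z₀` removes the sign ambiguity, so the roots for different `n`
  -- agree on the connected sets `C m` and can be glued.
  have hex : ∀ n, ∃ s : ℂ → ℂ, ContinuousOn s (T n) ∧ (∀ z ∈ T n, s z ^ 2 = z - α) ∧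
      (z₀ ∈ T n → s z₀ = c) := by
    intro n
    obtain ⟨s, hs, hs2⟩ := hQ.exists_sqrt_of_infDist hb (ε := 1 / ((n : ℝ) + 1))
      (by positivity) hα
    by_cases h0 : z₀ ∈ T n
    · have : s z₀ ^ 2 = c ^ 2 := (hs2 z₀ h0).trans hc.symm
      rcases sq_eq_sq_iff_eq_or_eq_neg.1 this with h | h
      · exact ⟨s, hs, hs2, fun _ => h⟩
      · exact ⟨fun z => -s z, hs.neg, fun z hz => by rw [neg_sq]; exact hs2 z hz,
          fun _ => by simp [h]⟩
    · exact ⟨s, hs, hs2, fun h => absurd h h0⟩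
  choose s hs hs2 hs0 using hex
  have hagree : ∀ m n, m ≤ n → EqOn (s m) (s n) (C m) := by
    intro m n hmn
    by_cases h0 : z₀ ∈ T m
    · refine isPreconnected_connectedComponentIn.eq_of_sq_eq ((hs m).mono (hCT m))
        ((hs n).mono ((hCT m).trans (hTm hmn))) ?_ ?_ (mem_connectedComponentIn h0)
        ((hs0 m h0).trans (hs0 n (hTm hmn h0)).symm)
      · intro z hz
        simp only [Pi.pow_apply]
        rw [hs2 m z (hCT m hz), hs2 n z (hTm hmn (hCT m hz))]
      · intro z hz h
        have h1 := hs2 n z (hTm hmn (hCT m hz))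
        rw [h, zero_pow two_ne_zero] at h1
        exact hα (by rw [← sub_eq_zero.1 h1.symm]; exact (hCT m hz).1)
    · simp only [hC]
      rw [connectedComponentIn_eq_empty h0]
      exact eqOn_empty _ _
  have hcover : ∀ z ∈ Q, ∃ n, z ∈ C n := by
    intro z hz
    exact exists_mem_connectedComponentIn_infDist hQo hQc.isPreconnected ⟨α, hα⟩ hz₀ hz
  classical
  choose! ν hν using hcover
  have heq : ∀ n, EqOn (fun z => s (ν z) z) (s n) (C n) := by
    intro n z hz
    have hzQ : z ∈ Q := (hCT n hz).1
    rcases le_total n (ν z) with h | h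
    · exact (hagree _ _ h hz).symm
    · exact hagree _ _ h (hν z hzQ)
  refine ⟨fun z => s (ν z) z, fun z hz => ?_, fun z hz => hs2 _ _ (hCT _ (hν z hz))⟩
  have h1 : ContinuousAt (s (ν z)) z :=
    (hs _).continuousAt ((hTo _).mem_nhds (hCT _ (hν z hz)))
  refine (h1.congr ?_).continuousWithinAt
  filter_upwards [(hCo (ν z)).mem_nhds (hν z hz)] with w hw
  exact (heq _ hw).symm

/-! ### Automorphisms of the unit disk. -/

/-- The involutive automorphism of the unit disk exchanging `0` and `a`. -/
noncomputable def discAut (a z : ℂ) : ℂ := (a - z) / (1 - (starRingEnd ℂ) a * z)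


theorem one_sub_conj_mul_ne_zero {a z : ℂ} (ha : ‖a‖ < 1) (hz : ‖z‖ < 1) :
    1 - conj a * z ≠ 0 := by
  intro h
  have h1 : ‖conj a * z‖ = 1 := by rw [← sub_eq_zero.1 h, norm_one]
  rw [norm_mul, Complex.norm_conj] at h1
  nlinarith [norm_nonneg a, norm_nonneg z]

/-- The right side is positive for two points of the disk; this is why `discAut a` preserves the
disk. -/
theorem normSq_one_sub_conj_mul_sub (a z : ℂ) :
    normSq (1 - conj a * z) - normSq (a - z) = (1 - normSq a) * (1 - normSq z) := by
  simp only [normSq_apply, sub_re, sub_im, mul_re, mul_im, conj_re, conj_im, one_re, one_im]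
  ring

theorem norm_discAut_lt_one {a z : ℂ} (ha : ‖a‖ < 1) (hz : ‖z‖ < 1) : ‖discAut a z‖ < 1 := by
  have h0 := norm_pos_iff.2 (one_sub_conj_mul_ne_zero ha hz)
  rw [discAut, norm_div, div_lt_one h0]
  have h := normSq_one_sub_conj_mul_sub a z
  simp only [normSq_eq_norm_sq] at h
  have h1 : 0 < (1 - ‖a‖ ^ 2) * (1 - ‖z‖ ^ 2) := by
    apply mul_pos <;> nlinarith [norm_nonneg a, norm_nonneg z]
  exact lt_of_pow_lt_pow_left₀ 2 h0.le (by linarith)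

theorem discAut_mapsTo {a : ℂ} (ha : a ∈ ball (0 : ℂ) 1) :
    MapsTo (discAut a) (ball 0 1) (ball 0 1) := by
  intro z hz
  rw [mem_ball_zero_iff] at *
  exact norm_discAut_lt_one ha hz

theorem discAut_discAut {a z : ℂ} (ha : ‖a‖ < 1) (hz : ‖z‖ < 1) :
    discAut a (discAut a z) = z := by
  have h0 := one_sub_conj_mul_ne_zero ha hz
  have h1 := one_sub_conj_mul_ne_zero ha (norm_discAut_lt_one ha hz)
  rw [discAut, div_eq_iff h1, discAut]
  set d := 1 - conj a * z with hd
  field_simp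
  rw [hd]
  ring

theorem discAut_self (a : ℂ) : discAut a a = 0 := by simp [discAut]

theorem discAut_zero (a : ℂ) : discAut a 0 = a := by simp [discAut]

theorem discAut_eq_zero_iff {a z : ℂ} (ha : ‖a‖ < 1) (hz : ‖z‖ < 1) :
    discAut a z = 0 ↔ z = a := by
  rw [discAut, div_eq_zero_iff, or_iff_left (one_sub_conj_mul_ne_zero ha hz), sub_eq_zero, eq_comm]

theorem hasDerivAt_discAut {a z : ℂ} (ha : ‖a‖ < 1) (hz : ‖z‖ < 1) :
    HasDerivAt (discAut a) ((conj a * a - 1) / (1 - conj a * z) ^ 2) z := by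
  have h1 : HasDerivAt (fun z => a - z) (-1) z := by simpa using (hasDerivAt_id z).const_sub a
  have h2 : HasDerivAt (fun z => 1 - conj a * z) (-conj a) z := by
    simpa using ((hasDerivAt_id z).const_mul (conj a)).const_sub 1
  refine (h1.div h2 (one_sub_conj_mul_ne_zero ha hz)).congr_deriv ?_
  congr 1
  ring

theorem differentiableOn_discAut {a : ℂ} (ha : a ∈ ball (0 : ℂ) 1) :
    DifferentiableOn ℂ (discAut a) (ball 0 1) := fun _ hz =>
  (hasDerivAt_discAut (mem_ball_zero_iff.1 ha) (mem_ball_zero_iff.1 hz)).differentiableAt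
    |>.differentiableWithinAt

/-! ### Normal families and the Riemann mapping theorem. -/

/-- **Montel's theorem**, along an ultrafilter. -/
theorem exists_tendstoLocallyUniformlyOn_of_bounded (l : Ultrafilter ℕ) {U : Set ℂ}
    (hU : IsOpen U) {f : ℕ → ℂ → ℂ} (hf : ∀ n, DifferentiableOn ℂ (f n) U) {M : ℝ}
    (hM : ∀ n, ∀ z ∈ U, ‖f n z‖ ≤ M) :
    ∃ g : ℂ → ℂ, TendstoLocallyUniformlyOn f g l U ∧ ∀ z ∈ U, ‖g z‖ ≤ M := by
  -- Along an ultrafilter, bounded sequences converge pointwise by compactness alone, so no diagonal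
  -- subsequence is needed.
  have hlim : ∀ z ∈ U, ∃ x : ℂ, ‖x‖ ≤ M ∧ Filter.Tendsto (fun n => f n z) l (nhds x) := by
    intro z hz
    obtain ⟨x, hx, hlx⟩ := (isCompact_closedBall (0 : ℂ) M).ultrafilter_le_nhds'
      (l.map fun n => f n z) (Ultrafilter.mem_map.2 (Filter.univ_mem' fun n => by
        simpa using hM n z hz))
    exact ⟨x, by simpa using hx, hlx⟩
  choose! g hgM hg using hlim
  refine ⟨g, ?_, hgM⟩
  rw [Metric.tendstoLocallyUniformlyOn_iff]
  intro ε hε z hz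
  obtain ⟨r, hr, hrU⟩ := Metric.isOpen_iff.1 hU z hz
  have hM0 : 0 ≤ M := (norm_nonneg _).trans (hM 0 z hz)
  -- A Lipschitz constant common to all `n`, from Schwarz's lemma on the ball of radius `r`; the `+
  -- 1` keeps it positive when `M = 0`.
  set L := (2 * M + 1) / r with hL
  have hL0 : 0 < L := by positivity
  have hLip : ∀ n, ∀ y ∈ ball z r, dist (f n y) (f n z) ≤ L * dist y z := by
    intro n y hy
    refine Complex.dist_le_div_mul_dist_of_mapsTo_ball ((hf n).mono hrU) (fun w hw => ?_) hy
    rw [mem_closedBall, dist_eq_norm]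
    have := norm_sub_le (f n w) (f n z)
    linarith [hM n w (hrU hw), hM n z hz]
  set δ := min r (ε / (4 * L)) with hδ
  have hδ0 : 0 < δ := by positivity
  refine ⟨ball z δ, mem_nhdsWithin_of_mem_nhds (ball_mem_nhds z hδ0), ?_⟩
  filter_upwards [Metric.tendsto_nhds.1 (hg z hz) (ε / 4) (by positivity)] with n hn y hy
  have hyr : y ∈ ball z r := ball_subset_ball (min_le_left _ _) hy
  have hLy : L * dist y z ≤ ε / 4 := by
    have h1 : dist y z ≤ ε / (4 * L) := (mem_ball.1 hy).le.trans (min_le_right _ _)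
    calc L * dist y z ≤ L * (ε / (4 * L)) := by gcongr
      _ = ε / 4 := by field_simp
  have h2 : dist (g y) (g z) ≤ ε / 4 := by
    refine le_of_tendsto ((hg y (hrU hyr)).dist (hg z hz)) (Filter.Eventually.of_forall fun m => ?_)
    exact (hLip m y hyr).trans hLy
  have h3 := (hLip n y hyr).trans hLy
  have h4 := dist_triangle4 (g y) (g z) (f n z) (f n y)
  rw [dist_comm (g z) (f n z), dist_comm (f n z) (f n y)] at h4
  linarith

/-- If `h` maps `P` into the unit disk and has a holomorphic left inverse `g` defined on the disk,
then the image of `h` is a component of `g⁻¹(P)`. -/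
theorem image_eq_connectedComponentIn_of_leftInverse {P : Set ℂ} (hPo : IsOpen P)
    (hPc : IsPreconnected P) {h g : ℂ → ℂ} (hh : DifferentiableOn ℂ h P)
    (hm : MapsTo h P (ball 0 1)) (hg : DifferentiableOn ℂ g (ball 0 1))
    (hgh : ∀ z ∈ P, g (h z) = z) {z₀ : ℂ} (hz₀ : z₀ ∈ P) :
    h '' P = connectedComponentIn (ball 0 1 ∩ g ⁻¹' P) (h z₀) := by
  have hsub : h '' P ⊆ ball 0 1 ∩ g ⁻¹' P := by
    rintro _ ⟨z, hz, rfl⟩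
    exact ⟨hm hz, by rwa [mem_preimage, hgh z hz]⟩
  refine Subset.antisymm ((hPc.image h hh.continuousOn).subset_connectedComponentIn
    (mem_image_of_mem h hz₀) hsub) ?_
  set S := ball 0 1 ∩ g ⁻¹' P with hS
  have hSo : IsOpen S := hg.continuousOn.isOpen_inter_preimage isOpen_ball hPo
  have hCo : IsOpen (connectedComponentIn S (h z₀)) := hSo.connectedComponentIn
  have hCS := connectedComponentIn_subset S (h z₀)
  have h1 : AnalyticOnNhd ℂ (fun ζ => h (g ζ)) (connectedComponentIn S (h z₀)) := by
    refine DifferentiableOn.analyticOnNhd ?_ hCo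
    exact hh.comp (hg.mono (hCS.trans inter_subset_left)) fun ζ hζ => (hCS hζ).2
  have h2 : AnalyticOnNhd ℂ (fun ζ : ℂ => ζ) (connectedComponentIn S (h z₀)) :=
    differentiableOn_id.analyticOnNhd hCo
  have hmem : h z₀ ∈ connectedComponentIn S (h z₀) :=
    mem_connectedComponentIn (hsub (mem_image_of_mem h hz₀))
  have htend : Filter.Tendsto h (nhdsWithin z₀ {z₀}ᶜ) (nhdsWithin (h z₀) {h z₀}ᶜ) := by
    refine tendsto_nhdsWithin_iff.2 ⟨((hh.continuousOn.continuousAt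
      (hPo.mem_nhds hz₀)).tendsto).mono_left nhdsWithin_le_nhds, ?_⟩
    filter_upwards [self_mem_nhdsWithin, mem_nhdsWithin_of_mem_nhds (hPo.mem_nhds hz₀)] with z hz hzP
    intro heq
    apply hz
    rw [mem_singleton_iff] at *
    rw [← hgh z hzP, heq, hgh z₀ hz₀]
  -- `h ∘ g` fixes the points `h z`, which accumulate at `h z₀` by injectivity of `h`; the identity
  -- theorem then covers the whole component.
  have hfreq : ∃ᶠ ζ in nhdsWithin (h z₀) {h z₀}ᶜ, h (g ζ) = ζ := by
    refine htend.frequently (Filter.Eventually.frequently ?_)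
    filter_upwards [mem_nhdsWithin_of_mem_nhds (hPo.mem_nhds hz₀)] with z hzP
    rw [hgh z hzP]
  have heq := h1.eqOn_of_preconnected_of_frequently_eq h2 isPreconnected_connectedComponentIn
    hmem hfreq
  intro ζ hζ
  exact ⟨g ζ, (hCS hζ).2, heq hζ⟩

/-- The holomorphic maps from `P` to the unit disk which vanish at `z₀` and have a holomorphic left
inverse defined on the whole disk and bounded by `M`. -/
def koebeFamily (P : Set ℂ) (z₀ : ℂ) (M : ℝ) : Set (ℂ → ℂ) :=
  {f | DifferentiableOn ℂ f P ∧ MapsTo f P (ball 0 1) ∧ f z₀ = 0 ∧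
    ∃ g : ℂ → ℂ, DifferentiableOn ℂ g (ball 0 1) ∧ (∀ ζ ∈ ball (0 : ℂ) 1, ‖g ζ‖ ≤ M) ∧
      ∀ z ∈ P, g (f z) = z}

/-- Differentiate `g ∘ f = id`. -/
theorem deriv_ne_zero_of_mem_koebeFamily {P : Set ℂ} (hPo : IsOpen P) {z₀ : ℂ} {M : ℝ} {f : ℂ → ℂ}
    (hf : f ∈ koebeFamily P z₀ M) {z : ℂ} (hz : z ∈ P) : deriv f z ≠ 0 := by
  obtain ⟨hfd, hfm, -, g, hg, -, hgf⟩ := hf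
  have h1 := (hfd.differentiableAt (hPo.mem_nhds hz)).hasDerivAt
  have h2 := (hg.differentiableAt (isOpen_ball.mem_nhds (hfm hz))).hasDerivAt
  have h3 : HasDerivAt (fun w => w) (deriv g (f z) * deriv f z) z := by
    refine (h2.comp z h1).congr_of_eventuallyEq ?_
    filter_upwards [hPo.mem_nhds hz] with w hw
    exact (hgf w hw).symm
  intro h0
  have := h3.unique (hasDerivAt_id' z)
  simp [h0] at this

/-- The product is the derivative at 0 of the disk map `ζ ↦ discAut (β ^ 2) (discAut β ζ ^ 2)`; its
modulus is `2|β| / (1 + |β|²)`. -/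
theorem norm_deriv_koebe_lt_one {β : ℂ} (hβ : ‖β‖ < 1) :
    ‖((conj (β ^ 2) * β ^ 2 - 1) / (1 - conj (β ^ 2) * β ^ 2) ^ 2) *
      (2 * β * ((conj β * β - 1) / (1 - conj β * 0) ^ 2))‖ < 1 := by
  have h1 : ∀ a : ℂ, conj a * a = ((‖a‖ ^ 2 : ℝ) : ℂ) := by
    intro a
    rw [mul_comm, mul_conj, normSq_eq_norm_sq]
  rw [h1, h1, norm_pow, mul_zero, sub_zero, one_pow, div_one, norm_mul, norm_div, norm_mul,
    norm_mul, norm_pow, ← ofReal_one, ← ofReal_sub, ← ofReal_sub, ← ofReal_sub, norm_real,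
    norm_real, norm_real, norm_ofNat]
  have hb0 : 0 ≤ ‖β‖ := norm_nonneg β
  generalize ‖β‖ = b at *
  have hb2 : b ^ 2 < 1 := pow_lt_one₀ hb0 hβ two_ne_zero
  have hb4 : (b ^ 2) ^ 2 < 1 := pow_lt_one₀ (by positivity) hb2 two_ne_zero
  rw [Real.norm_of_nonpos (by linarith), Real.norm_of_nonneg (by linarith),
    Real.norm_of_nonpos (by linarith)]
  have : -((b ^ 2) ^ 2 - 1) / (1 - (b ^ 2) ^ 2) ^ 2 * (2 * b * -(b ^ 2 - 1)) =
      2 * b / (1 + b ^ 2) := by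
    have h3 : 1 + b ^ 2 ≠ 0 := by positivity
    have h4 : 1 - b ^ 2 ≠ 0 := by linarith
    have h5 : 1 - (b ^ 2) ^ 2 = (1 - b ^ 2) * (1 + b ^ 2) := by ring
    have h6 : -((b ^ 2) ^ 2 - 1) = (1 - b ^ 2) * (1 + b ^ 2) := by ring
    have h7 : -(b ^ 2 - 1) = 1 - b ^ 2 := by ring
    rw [h5, h6, h7]
    generalize 1 - b ^ 2 = x at h4
    field_simp
  rw [this, div_lt_one (by positivity)]
  nlinarith [mul_pos (sub_pos.2 hβ) (sub_pos.2 hβ)]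

/-- The Koebe step: if a member of the family is not surjective, there is another one with
larger derivative at the base point. -/
theorem exists_koebeFamily_lt_deriv {P : Set ℂ} (hPo : IsOpen P) (hPc : IsConnected P)
    (hP : ChainFull P) {z₀ : ℂ} (hz₀ : z₀ ∈ P) {M : ℝ} {f : ℂ → ℂ}
    (hf : f ∈ koebeFamily P z₀ M) {α : ℂ} (hα : α ∈ ball (0 : ℂ) 1) (hαf : α ∉ f '' P) :
    ∃ f' ∈ koebeFamily P z₀ M, ‖deriv f z₀‖ < ‖deriv f' z₀‖ := by
  have hfder := deriv_ne_zero_of_mem_koebeFamily hPo hf hz₀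
  obtain ⟨hfd, hfm, hf0, g, hg, hgM, hgf⟩ := hf
  have hα1 : ‖α‖ < 1 := mem_ball_zero_iff.1 hα
  set h : ℂ → ℂ := fun z => discAut α (f z) with hh
  set g₁ : ℂ → ℂ := fun ζ => g (discAut α ζ) with hg₁
  have hhd : DifferentiableOn ℂ h P := (differentiableOn_discAut hα).comp hfd hfm
  have hhm : MapsTo h P (ball 0 1) := (discAut_mapsTo hα).comp hfm
  have hg₁d : DifferentiableOn ℂ g₁ (ball 0 1) :=
    hg.comp (differentiableOn_discAut hα) (discAut_mapsTo hα)
  have hg₁h : ∀ z ∈ P, g₁ (h z) = z := by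
    intro z hz
    simp only [hg₁, hh]
    rw [discAut_discAut hα1 (mem_ball_zero_iff.1 (hfm hz)), hgf z hz]
  have hQ := image_eq_connectedComponentIn_of_leftInverse hPo hPc.isPreconnected hhd hhm hg₁d
    hg₁h hz₀
  -- The image is a component of `g₁⁻¹(P)`, hence again without holes; this is what supplies the
  -- square root.
  have hQfull : ChainFull (h '' P) := by
    rw [hQ]
    exact (chainFull_ball 1).connectedComponentIn_preimage isOpen_ball hg₁d hPo hP _
  have hQo : IsOpen (h '' P) := by
    rw [hQ]
    exact (hg₁d.continuousOn.isOpen_inter_preimage isOpen_ball hPo).connectedComponentIn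
  have hQ0 : (0 : ℂ) ∉ h '' P := by
    rintro ⟨z, hz, h0⟩
    exact hαf ⟨z, hz, (discAut_eq_zero_iff hα1 (mem_ball_zero_iff.1 (hfm hz))).1 h0⟩
  obtain ⟨s, hsc, hs⟩ := hQfull.exists_sqrt hQo (hPc.image h hhd.continuousOn)
    (isBounded_ball.subset hhm.image_subset) hQ0
  simp only [sub_zero] at hs
  have hs0 : ∀ ζ ∈ h '' P, s ζ ≠ 0 := by
    intro ζ hζ h0
    have := hs ζ hζ
    rw [h0, zero_pow two_ne_zero] at this
    exact hQ0 (this ▸ hζ)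
  have hsd : DifferentiableOn ℂ s (h '' P) := by
    intro ζ hζ
    -- A continuous root is a local inverse of squaring, hence holomorphic where it does not vanish.
    have : HasStrictDerivAt s (2 * s ζ)⁻¹ ζ := by
      refine HasStrictDerivAt.of_local_left_inverse (f := fun w => w ^ 2)
        (hsc.continuousAt (hQo.mem_nhds hζ)) ?_ (by simpa using hs0 ζ hζ) ?_
      · simpa using hasStrictDerivAt_pow 2 (s ζ)
      · filter_upwards [hQo.mem_nhds hζ] with w hw
        exact hs w hw
    exact this.hasDerivAt.differentiableAt.differentiableWithinAt
  set k : ℂ → ℂ := fun z => s (h z) with hk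
  have hkd : DifferentiableOn ℂ k P := hsd.comp hhd (mapsTo_image h P)
  have hk2 : ∀ z ∈ P, k z ^ 2 = h z := fun z hz => hs _ (mem_image_of_mem h hz)
  have hkm : MapsTo k P (ball 0 1) := by
    intro z hz
    have := hhm hz
    rw [← hk2 z hz, mem_ball_zero_iff, norm_pow] at this
    rw [mem_ball_zero_iff]
    exact (pow_lt_one_iff_of_nonneg (norm_nonneg _) two_ne_zero).1 this
  set β := k z₀ with hβ
  have hβb : β ∈ ball (0 : ℂ) 1 := hkm hz₀
  have hβ1 : ‖β‖ < 1 := mem_ball_zero_iff.1 hβb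
  have hβα : β ^ 2 = α := by
    rw [hβ, hk2 z₀ hz₀, hh]
    simp only
    rw [hf0, discAut_zero]
  set f' : ℂ → ℂ := fun z => discAut β (k z) with hf'
  have hf'd : DifferentiableOn ℂ f' P := (differentiableOn_discAut hβb).comp hkd hkm
  have hf'm : MapsTo f' P (ball 0 1) := (discAut_mapsTo hβb).comp hkm
  -- `Ψ` undoes the construction: `Ψ ∘ f' = f`. So `g ∘ Ψ` is a left inverse of `f'` with the same
  -- bound `M`, and `|Ψ'(0)| < 1` makes the derivative of `f'` the larger one.
  set Ψ : ℂ → ℂ := fun ζ => discAut α ((discAut β ζ) ^ 2) with hΨ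
  have hsqm : MapsTo (fun ζ : ℂ => ζ ^ 2) (ball 0 1) (ball 0 1) := by
    intro ζ hζ
    rw [mem_ball_zero_iff] at *
    rw [norm_pow]
    exact pow_lt_one₀ (norm_nonneg _) hζ two_ne_zero
  have hΨd : DifferentiableOn ℂ Ψ (ball 0 1) :=
    (differentiableOn_discAut hα).comp ((differentiableOn_discAut hβb).pow 2)
      (hsqm.comp (discAut_mapsTo hβb))
  have hΨm : MapsTo Ψ (ball 0 1) (ball 0 1) :=
    (discAut_mapsTo hα).comp (hsqm.comp (discAut_mapsTo hβb))
  have hΨf : ∀ z ∈ P, Ψ (f' z) = f z := by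
    intro z hz
    simp only [hΨ, hf']
    rw [discAut_discAut hβ1 (mem_ball_zero_iff.1 (hkm hz)), hk2 z hz]
    exact discAut_discAut hα1 (mem_ball_zero_iff.1 (hfm hz))
  have hf'0 : f' z₀ = 0 := discAut_self _
  refine ⟨f', ⟨hf'd, hf'm, hf'0, fun ζ => g (Ψ ζ), hg.comp hΨd hΨm,
    fun ζ hζ => hgM _ (hΨm hζ), fun z hz => by
      simp only
      rw [hΨf z hz, hgf z hz]⟩, ?_⟩
  have hΨder : HasDerivAt Ψ (((conj α * α - 1) / (1 - conj α * α) ^ 2) *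
      (2 * β * ((conj β * β - 1) / (1 - conj β * 0) ^ 2))) 0 := by
    have h1 := hasDerivAt_discAut hβ1 (z := 0) (by simp)
    have h2 : HasDerivAt (fun ζ => (discAut β ζ) ^ 2)
        (2 * β * ((conj β * β - 1) / (1 - conj β * 0) ^ 2)) 0 := by
      simpa [discAut_zero] using h1.fun_pow 2
    have h3 : HasDerivAt (discAut α) ((conj α * α - 1) / (1 - conj α * α) ^ 2)
        ((discAut β 0) ^ 2) := by
      rw [discAut_zero, hβα]
      exact hasDerivAt_discAut hα1 hα1
    exact h3.comp (0 : ℂ) h2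
  have hchain : deriv f z₀ = (((conj α * α - 1) / (1 - conj α * α) ^ 2) *
      (2 * β * ((conj β * β - 1) / (1 - conj β * 0) ^ 2))) * deriv f' z₀ := by
    have h1 := (hf'd.differentiableAt (hPo.mem_nhds hz₀)).hasDerivAt
    refine HasDerivAt.deriv (HasDerivAt.congr_of_eventuallyEq
      (HasDerivAt.comp_of_eq z₀ hΨder h1 hf'0.symm) ?_)
    filter_upwards [hPo.mem_nhds hz₀] with z hz
    exact (hΨf z hz).symm
  have hf'der : 0 < ‖deriv f' z₀‖ := by
    rw [norm_pos_iff]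
    intro h0
    rw [h0, mul_zero] at hchain
    exact hfder hchain
  have hnorm := norm_deriv_koebe_lt_one hβ1
  rw [hβα] at hnorm
  rw [hchain, norm_mul]
  exact mul_lt_of_lt_one_left hf'der hnorm

/-- **Riemann mapping theorem** for bounded connected open sets whose complement has no bounded
component. -/
theorem exists_riemann_map {P : Set ℂ} (hPo : IsOpen P) (hPc : IsConnected P)
    (hPb : Bornology.IsBounded P) (hP : ChainFull P) {z₀ : ℂ} (hz₀ : z₀ ∈ P) :
    ∃ f g : ℂ → ℂ, DifferentiableOn ℂ f P ∧ DifferentiableOn ℂ g (ball 0 1) ∧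
      MapsTo f P (ball 0 1) ∧ MapsTo g (ball 0 1) P ∧ (∀ z ∈ P, g (f z) = z) ∧
      (∀ ζ ∈ ball (0 : ℂ) 1, f (g ζ) = ζ) ∧ f z₀ = 0 := by
  obtain ⟨R₀, hR₀⟩ := hPb.subset_ball 0
  obtain ⟨R, hR0, hR⟩ : ∃ R : ℝ, 0 < R ∧ P ⊆ ball 0 R := by
    refine ⟨max R₀ 1, by positivity, hR₀.trans (ball_subset_ball (le_max_left _ _))⟩
  have hnz₀ : ‖z₀‖ < R := mem_ball_zero_iff.1 (hR hz₀)
  have hRC : (R : ℂ) ≠ 0 := by simpa using hR0.ne'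
  -- The family contains `z ↦ (z - z₀) / (2R)`, whose inverse `ζ ↦ 2Rζ + z₀` is bounded by `3R` on
  -- the disk. A common bound lets the left inverses converge too.
  set M := 3 * R with hM
  have hne : (koebeFamily P z₀ M).Nonempty := by
    refine ⟨fun z => (z - z₀) / (2 * R), by fun_prop, ?_, by simp, fun ζ => 2 * R * ζ + z₀,
      by fun_prop, ?_, ?_⟩
    · intro z hz
      have h1 := mem_ball_zero_iff.1 (hR hz)
      have h2 := norm_sub_le z z₀
      rw [mem_ball_zero_iff, norm_div, norm_mul, norm_ofNat, norm_real,
        Real.norm_of_nonneg hR0.le, div_lt_one (by positivity)]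
      linarith
    · intro ζ hζ
      have h1 := mem_ball_zero_iff.1 hζ
      have h2 := norm_add_le (2 * R * ζ) z₀
      rw [norm_mul, norm_mul, norm_ofNat, norm_real, Real.norm_of_nonneg hR0.le] at h2
      nlinarith
    · intro z _
      field_simp
      ring
  obtain ⟨r, hr, hrP⟩ := Metric.isOpen_iff.1 hPo z₀ hz₀
  have hbdd : BddAbove ((fun f : ℂ → ℂ => ‖deriv f z₀‖) '' koebeFamily P z₀ M) := by
    refine ⟨1 / r, ?_⟩
    rintro _ ⟨f, ⟨hfd, hfm, hf0, -⟩, rfl⟩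
    refine Complex.norm_deriv_le_div_of_mapsTo_ball (hfd.mono hrP) ?_ hr
    rw [hf0]
    exact (hfm.mono_left hrP).mono_right ball_subset_closedBall
  set σ := sSup ((fun f : ℂ → ℂ => ‖deriv f z₀‖) '' koebeFamily P z₀ M) with hσ
  have hle : ∀ f ∈ koebeFamily P z₀ M, ‖deriv f z₀‖ ≤ σ := fun f hf =>
    le_csSup hbdd (mem_image_of_mem _ hf)
  have hσ0 : 0 < σ := by
    obtain ⟨f, hf⟩ := hne
    exact (norm_pos_iff.2 (deriv_ne_zero_of_mem_koebeFamily hPo hf hz₀)).trans_le (hle f hf)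
  obtain ⟨u, -, hu, huS⟩ := exists_seq_tendsto_sSup (hne.image _) hbdd
  choose F hF hFu using huS
  choose hFd hFm hF0 G hG hGM hGF using hF
  set l : Ultrafilter ℕ := Filter.hyperfilter ℕ with hl
  have hlt : (l : Filter ℕ) ≤ Filter.atTop := Nat.cofinite_eq_atTop ▸ Filter.hyperfilter_le_cofinite
  obtain ⟨f, hf, hf1⟩ := exists_tendstoLocallyUniformlyOn_of_bounded l hPo hFd (M := 1)
    fun n z hz => (mem_ball_zero_iff.1 (hFm n hz)).le
  obtain ⟨g, hg, hgM⟩ := exists_tendstoLocallyUniformlyOn_of_bounded l isOpen_ball hG (M := M) hGM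
  have hfd : DifferentiableOn ℂ f P :=
    hf.differentiableOn (Filter.Eventually.of_forall hFd) hPo
  have hgd : DifferentiableOn ℂ g (ball 0 1) :=
    hg.differentiableOn (Filter.Eventually.of_forall hG) isOpen_ball
  have hf0 : f z₀ = 0 := by
    refine tendsto_nhds_unique (hf.tendsto_at hz₀) ?_
    simp only [hF0]
    exact tendsto_const_nhds
  have hfσ : ‖deriv f z₀‖ = σ := by
    have h1 := ((hf.deriv (Filter.Eventually.of_forall hFd) hPo).tendsto_at hz₀).norm
    refine tendsto_nhds_unique h1 ((hu.mono_left hlt).congr fun n => ?_)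
    rw [← hFu n]
    rfl
  -- If the limit touched the unit circle, `|f|` would be constantly 1 by the maximum principle,
  -- against `f z₀ = 0`.
  have hfm : MapsTo f P (ball 0 1) := by
    intro z hz
    rw [mem_ball_zero_iff]
    refine lt_of_le_of_ne (hf1 z hz) fun h1 => ?_
    have hmax : IsMaxOn (norm ∘ f) P z := fun w hw => by
      simp only [Function.comp_apply, mem_ofPred_eq, h1]
      exact hf1 w hw
    have := Complex.norm_eqOn_of_isPreconnected_of_isMaxOn hPc.isPreconnected hPo hfd hz hmax hz₀
    simp [hf0, h1] at this
  -- The left inverses pass to the limit, which makes `f` injective without Hurwitz's theorem.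
  have hgf : ∀ z ∈ P, g (f z) = z := by
    intro z hz
    have hfz := hfm hz
    have h1 : Filter.Tendsto (fun n => G n (F n z)) l (nhds (g (f z))) := by
      refine hg.tendsto_comp ((hgd.continuousOn) _ hfz) hfz ?_
      exact tendsto_nhdsWithin_iff.2 ⟨hf.tendsto_at hz, Filter.Eventually.of_forall fun n => hFm n hz⟩
    refine tendsto_nhds_unique h1 ?_
    simp only [hGF _ z hz]
    exact tendsto_const_nhds
  have hmem : f ∈ koebeFamily P z₀ M := ⟨hfd, hfm, hf0, g, hgd, hgM, hgf⟩
  -- `f` has the largest derivative in the family, so by the Koebe step it omits no point.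
  have hsurj : ∀ ζ ∈ ball (0 : ℂ) 1, ∃ z ∈ P, f z = ζ := by
    intro ζ hζ
    by_contra hcon
    obtain ⟨f', hf', hlt'⟩ := exists_koebeFamily_lt_deriv hPo hPc hP hz₀ hmem hζ
      (by simpa using hcon)
    exact absurd (hle f' hf') (by linarith)
  refine ⟨f, g, hfd, hgd, hfm, ?_, hgf, ?_, hf0⟩
  · intro ζ hζ
    obtain ⟨z, hz, rfl⟩ := hsurj ζ hζ
    rwa [hgf z hz]
  · intro ζ hζ
    obtain ⟨z, hz, rfl⟩ := hsurj ζ hζ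
    rw [hgf z hz]

/-! ### Proper maps and their inverses. -/

/-- `F` maps `P` properly into `P'`. -/
def ProperOn (F : ℂ → ℂ) (P P' : Set ℂ) : Prop :=
  MapsTo F P P' ∧ ∀ K ⊆ P', IsCompact K → IsCompact (P ∩ F ⁻¹' K)

theorem ProperOn.comp {F G : ℂ → ℂ} {P P' P'' : Set ℂ} (hG : ProperOn G P' P'')
    (hF : ProperOn F P P') : ProperOn (G ∘ F) P P'' := by
  refine ⟨hG.1.comp hF.1, fun K hK hKc => ?_⟩
  have h := hF.2 _ inter_subset_left (hG.2 K hK hKc)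
  convert h using 1
  ext z
  constructor
  · rintro ⟨h1, h2⟩
    exact ⟨h1, hF.1 h1, h2⟩
  · rintro ⟨h1, -, h2⟩
    exact ⟨h1, h2⟩

theorem properOn_id (P : Set ℂ) : ProperOn id P P :=
  ⟨mapsTo_id P, fun K hK hKc => by rwa [preimage_id, inter_eq_right.2 hK]⟩

/-- A map with a continuous inverse is proper. -/
theorem properOn_of_inverse {F G : ℂ → ℂ} {P P' : Set ℂ} (hF : MapsTo F P P')
    (hG : MapsTo G P' P) (hGc : ContinuousOn G P') (hGF : ∀ z ∈ P, G (F z) = z)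
    (hFG : ∀ w ∈ P', F (G w) = w) : ProperOn F P P' := by
  refine ⟨hF, fun K hK hKc => ?_⟩
  have : P ∩ F ⁻¹' K = G '' K := by
    ext z
    constructor
    · rintro ⟨h1, h2⟩
      exact ⟨F z, h2, hGF z h1⟩
    · rintro ⟨w, hw, rfl⟩
      exact ⟨hG (hK hw), by rw [mem_preimage, hFG w (hK hw)]; exact hw⟩
  rw [this]
  exact hKc.image_of_continuousOn (hGc.mono hK)

/-- A proper map restricts to a proper map from a component of a preimage. -/
theorem ProperOn.restrict_component {F : ℂ → ℂ} {D V P' : Set ℂ} (hF : ProperOn F D V)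
    (hP : P' ⊆ V) (z₀ : ℂ) :
    ProperOn F (connectedComponentIn (D ∩ F ⁻¹' P') z₀) P' := by
  have hsub := connectedComponentIn_subset (D ∩ F ⁻¹' P') z₀
  refine ⟨fun z hz => (hsub hz).2, fun K hK hKc => ?_⟩
  have hDK := hF.2 K (hK.trans hP) hKc
  have hDKS : D ∩ F ⁻¹' K ⊆ D ∩ F ⁻¹' P' := inter_subset_inter_right _ (preimage_mono hK)
  by_cases hz₀ : z₀ ∈ D ∩ F ⁻¹' P'
  -- A component is relatively closed, so the preimage of `K` in it is a closed part of a compact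
  -- set.
  · have : connectedComponentIn (D ∩ F ⁻¹' P') z₀ ∩ F ⁻¹' K =
        (D ∩ F ⁻¹' K) ∩ closure (connectedComponentIn (D ∩ F ⁻¹' P') z₀) := by
      ext z
      constructor
      · rintro ⟨h1, h2⟩
        exact ⟨⟨(hsub h1).1, h2⟩, subset_closure h1⟩
      · rintro ⟨h1, h2⟩
        refine ⟨?_, h1.2⟩
        have hpre : IsPreconnected
            (insert z (connectedComponentIn (D ∩ F ⁻¹' P') z₀)) :=
          isPreconnected_connectedComponentIn.subset_closure (subset_insert _ _)
            (insert_subset h2 subset_closure)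
        exact hpre.subset_connectedComponentIn
          (mem_insert_of_mem _ (mem_connectedComponentIn hz₀))
          (insert_subset (hDKS h1) hsub) (mem_insert _ _)
    rw [this]
    exact hDK.inter_right isClosed_closure
  · rw [connectedComponentIn_eq_empty hz₀, empty_inter]
    exact isCompact_empty

/-- The Riemann map is a homeomorphism onto the contractible disk. -/
theorem simplyConnectedSpace_of_chainFull {P : Set ℂ} (hPo : IsOpen P) (hPc : IsConnected P)
    (hPb : Bornology.IsBounded P) (hP : ChainFull P) : SimplyConnectedSpace P := by
  obtain ⟨z₀, hz₀⟩ := hPc.nonempty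
  obtain ⟨f, g, hf, hg, hfm, hgm, hgf, hfg, -⟩ := exists_riemann_map hPo hPc hPb hP hz₀
  let e : P ≃ₜ ball (0 : ℂ) 1 :=
    { toFun := hfm.restrict f _ _
      invFun := hgm.restrict g _ _
      left_inv := fun z => Subtype.ext (hgf z z.2)
      right_inv := fun z => Subtype.ext (hfg z z.2)
      continuous_toFun := hf.continuousOn.mapsToRestrict hfm
      continuous_invFun := hg.continuousOn.mapsToRestrict hgm }
  have : ContractibleSpace (ball (0 : ℂ) 1) :=
    (convex_ball (0 : ℂ) 1).contractibleSpace ⟨0, mem_ball_self one_pos⟩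
  have := e.contractibleSpace
  exact SimplyConnectedSpace.ofContractible _

/-- A proper holomorphic map without critical points onto a simply connected set has a continuous
inverse. -/
theorem ProperOn.exists_inverse {F : ℂ → ℂ} {P P' : Set ℂ} (hF : ProperOn F P P')
    (hPo : IsOpen P) (hPc : IsConnected P) (hFd : DifferentiableOn ℂ F P)
    (hF' : ∀ z ∈ P, deriv F z ≠ 0) (hP'o : IsOpen P') (hP' : SimplyConnectedSpace P') :
    ∃ G : ℂ → ℂ, ContinuousOn G P' ∧ MapsTo G P' P ∧ (∀ w ∈ P', F (G w) = w) ∧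
      ∀ z ∈ P, G (F z) = z := by
  classical
  set p : P → P' := hF.1.restrict F P P' with hp
  have hpc : Continuous p := hFd.continuousOn.mapsToRestrict hF.1
  have hlocF : IsLocalHomeomorphOn F P := by
    intro z hz
    have h1 : HasStrictDerivAt F (deriv F z) z :=
      (hFd.analyticAt (hPo.mem_nhds hz)).hasStrictDerivAt
    exact ⟨(h1.hasStrictFDerivAt_equiv (hF' z hz)).toOpenPartialHomeomorph F,
      (h1.hasStrictFDerivAt_equiv (hF' z hz)).mem_toOpenPartialHomeomorph_source, rfl⟩
  have hloc : IsLocalHomeomorph p := by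
    have h1 : IsLocalHomeomorph ((↑) : P → ℂ) := hPo.isOpenEmbedding_subtypeVal.isLocalHomeomorph
    have h2 : IsLocalHomeomorph ((↑) : P' → ℂ) := hP'o.isOpenEmbedding_subtypeVal.isLocalHomeomorph
    have h3 : IsLocalHomeomorph (((↑) : P' → ℂ) ∘ p) := by
      rw [isLocalHomeomorph_iff_isLocalHomeomorphOn_univ] at h1 ⊢
      exact IsLocalHomeomorphOn.comp (g := F) (t := P) hlocF h1 fun z _ => z.2
    exact h3.of_comp h2 hpc
  have hcomp : ∀ K : Set P', IsCompact K → IsCompact (p ⁻¹' K) := by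
    intro K hK
    rw [Subtype.isCompact_iff]
    have h1 := hF.2 (Subtype.val '' K) (by rintro _ ⟨w, -, rfl⟩; exact w.2)
      (hK.image continuous_subtype_val)
    convert h1 using 1
    ext z
    constructor
    · rintro ⟨w, hw, rfl⟩
      exact ⟨w.2, p w, hw, rfl⟩
    · rintro ⟨hz, w, hw, hwz⟩
      refine ⟨⟨z, hz⟩, ?_, rfl⟩
      have : p ⟨z, hz⟩ = w := Subtype.ext hwz.symm
      rw [mem_preimage, this]
      exact hw
  have := hP'o.locallyCompactSpace
  have hclosed : IsClosedMap p := (isProperMap_iff_isCompact_preimage.2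
    ⟨hpc, fun K hK => hcomp K hK⟩).isClosedMap
  -- A proper local homeomorphism is a covering.
  have hcov : IsCoveringMap p := by
    rw [isCoveringMap_iff_isCoveringMapOn_univ]
    refine hclosed.isCoveringMapOn_of_isLocalHomeomorphOn (fun w _ => ?_) ?_
    · refine (hcomp {w} isCompact_singleton).finite (.of_openPartialHomeomorph p subset_rfl ?_)
      intro e _
      obtain ⟨φ, hφ, h⟩ := hloc e
      exact ⟨φ, hφ, h.symm⟩
    · rw [preimage_univ]
      exact isLocalHomeomorph_iff_isLocalHomeomorphOn_univ.1 hloc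
  have := hP'o.locallyPathConnectedSpace
  obtain ⟨z₀, hz₀⟩ := hPc.nonempty
  -- The identity of the simply connected base lifts to a section `s`. Both `s ∘ p` and the identity
  -- lift `p` and agree at `z₀`, so they coincide on the connected `P`.
  obtain ⟨s, ⟨hs0, hs⟩, -⟩ := hcov.existsUnique_continuousMap_lifts (ContinuousMap.id P')
    (p ⟨z₀, hz₀⟩) ⟨z₀, hz₀⟩ rfl
  have := isPreconnected_iff_preconnectedSpace.1 hPc.isPreconnected
  have hsp : s ∘ p = id := by
    refine hcov.eq_of_comp_eq (s.continuous.comp hpc) continuous_id ?_ ⟨z₀, hz₀⟩ hs0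
    rw [← Function.comp_assoc, hs]
    rfl
  refine ⟨fun w => if h : w ∈ P' then s ⟨w, h⟩ else 0, ?_, ?_, ?_, ?_⟩
  · rw [continuousOn_iff_continuous_domRestrict]
    convert continuous_subtype_val.comp s.continuous using 1
    ext w
    simp
  · intro w hw
    simp only [hw, dif_pos]
    exact (s ⟨w, hw⟩).2
  · intro w hw
    simp only [hw, dif_pos]
    exact congrArg Subtype.val (congrFun hs ⟨w, hw⟩)
  · intro z hz
    simp only [hF.1 hz, dif_pos]
    exact congrArg Subtype.val (congrFun hsp ⟨z, hz⟩)

/-! ### Finite Blaschke products. -/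

/-- Schwarz's lemma for `G ∘ discAut a`, which vanishes at 0. -/
theorem norm_le_norm_discAut {G : ℂ → ℂ} (hG : DifferentiableOn ℂ G (ball 0 1))
    (hG1 : ∀ z ∈ ball (0 : ℂ) 1, ‖G z‖ ≤ 1) {a : ℂ} (ha : a ∈ ball (0 : ℂ) 1) (hGa : G a = 0)
    {z : ℂ} (hz : z ∈ ball (0 : ℂ) 1) : ‖G z‖ ≤ ‖discAut a z‖ := by
  have h1 : DifferentiableOn ℂ (fun w => G (discAut a w)) (ball 0 1) :=
    hG.comp (differentiableOn_discAut ha) (discAut_mapsTo ha)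
  have h2 : MapsTo (fun w => G (discAut a w)) (ball 0 1) (closedBall 0 1) := fun w hw => by
    rw [mem_closedBall_zero_iff]
    exact hG1 _ (discAut_mapsTo ha hw)
  have h3 := Complex.norm_le_norm_of_mapsTo_ball h1 h2 (by rw [discAut_zero, hGa])
    (mem_ball_zero_iff.1 (discAut_mapsTo ha hz))
  rwa [discAut_discAut (mem_ball_zero_iff.1 ha) (mem_ball_zero_iff.1 hz)] at h3

/-- A zero of a bounded holomorphic function on the disk can be divided out. -/
theorem exists_eq_discAut_mul {G : ℂ → ℂ} (hG : DifferentiableOn ℂ G (ball 0 1))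
    (hG1 : ∀ z ∈ ball (0 : ℂ) 1, ‖G z‖ ≤ 1) {a : ℂ} (ha : a ∈ ball (0 : ℂ) 1) (hGa : G a = 0) :
    ∃ H : ℂ → ℂ, DifferentiableOn ℂ H (ball 0 1) ∧ (∀ z ∈ ball (0 : ℂ) 1, ‖H z‖ ≤ 1) ∧
      ∀ z ∈ ball (0 : ℂ) 1, G z = discAut a z * H z := by
  have ha1 := mem_ball_zero_iff.1 ha
  set H : ℂ → ℂ := fun z => -(1 - conj a * z) * dslope G a z with hH
  have hHd : DifferentiableOn ℂ H (ball 0 1) := by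
    have := (Complex.differentiableOn_dslope (isOpen_ball.mem_nhds ha)).2 hG
    exact DifferentiableOn.mul (by fun_prop) this
  have hGH : ∀ z ∈ ball (0 : ℂ) 1, G z = discAut a z * H z := by
    intro z hz
    have h0 := one_sub_conj_mul_ne_zero ha1 (mem_ball_zero_iff.1 hz)
    have h1 : (z - a) * dslope G a z = G z := by
      have := sub_smul_dslope G a z
      rwa [hGa, sub_zero, smul_eq_mul] at this
    simp only [hH, discAut]
    rw [← h1, div_mul_eq_mul_div, eq_div_iff h0]
    ring
  refine ⟨H, hHd, ?_, hGH⟩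
  have hne : ∀ z ∈ ball (0 : ℂ) 1, z ≠ a → ‖H z‖ ≤ 1 := by
    intro z hz hza
    have h1 : 0 < ‖discAut a z‖ := by
      rw [norm_pos_iff]
      exact fun h => hza ((discAut_eq_zero_iff ha1 (mem_ball_zero_iff.1 hz)).1 h)
    have h2 := norm_le_norm_discAut hG hG1 ha hGa hz
    rw [hGH z hz, norm_mul] at h2
    exact le_of_mul_le_mul_left (by linarith) h1
  intro z hz
  by_cases hza : z = a
  · subst hza
    have hc : Filter.Tendsto (fun w => ‖H w‖) (nhdsWithin z {z}ᶜ) (nhds ‖H z‖) :=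
      ((hHd.continuousOn.continuousAt (isOpen_ball.mem_nhds hz)).norm.tendsto).mono_left
        nhdsWithin_le_nhds
    refine le_of_tendsto hc ?_
    filter_upwards [self_mem_nhdsWithin, mem_nhdsWithin_of_mem_nhds (isOpen_ball.mem_nhds hz)]
      with w hw hwb
    exact hne w hwb hw
  · exact hne z hz hza

theorem exists_lt_one_subset_closedBall {K : Set ℂ} (hK : IsCompact K) (hKb : K ⊆ ball 0 1) :
    ∃ ρ : ℝ, 0 < ρ ∧ ρ < 1 ∧ K ⊆ closedBall 0 ρ := by
  rcases K.eq_empty_or_nonempty with rfl | hne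
  · exact ⟨1 / 2, by norm_num, by norm_num, empty_subset _⟩
  · obtain ⟨e, he, hmax⟩ := hK.exists_isMaxOn hne continuous_norm.continuousOn
    have he1 := mem_ball_zero_iff.1 (hKb he)
    refine ⟨max ‖e‖ (1 / 2), by positivity, by simp [he1]; norm_num, fun z hz => ?_⟩
    rw [mem_closedBall_zero_iff]
    exact le_max_of_le_left (hmax hz)

/-- The preimage of a closed disk of radius `r` is compact, hence stays away from the unit circle.
-/
theorem ProperOn.exists_norm_gt {B : ℂ → ℂ} (hB : ProperOn B (ball 0 1) (ball 0 1)) {r : ℝ}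
    (hr : r < 1) : ∃ ρ : ℝ, 0 < ρ ∧ ρ < 1 ∧ ∀ z ∈ ball (0 : ℂ) 1, ρ < ‖z‖ → r < ‖B z‖ := by
  obtain ⟨ρ, h0, h1, hρ⟩ := exists_lt_one_subset_closedBall
    (hB.2 (closedBall 0 r) (closedBall_subset_ball hr) (isCompact_closedBall _ _))
    inter_subset_left
  refine ⟨ρ, h0, h1, fun z hz hlt => ?_⟩
  by_contra hcon
  have := hρ ⟨hz, mem_closedBall_zero_iff.2 (not_lt.1 hcon)⟩
  rw [mem_closedBall_zero_iff] at this
  linarith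

/-- A proper holomorphic self-map of the disk is a finite Blaschke product. -/
theorem ProperOn.exists_eq_blaschke {B : ℂ → ℂ} (hB : ProperOn B (ball 0 1) (ball 0 1))
    (hBd : DifferentiableOn ℂ B (ball 0 1)) :
    ∃ l : List ℂ, (∀ a ∈ l, a ∈ ball (0 : ℂ) 1) ∧ ∃ u : ℂ, ‖u‖ = 1 ∧
      ∀ z ∈ ball (0 : ℂ) 1, B z = u * (l.map fun a => discAut a z).prod := by
  -- A list is good if its Blaschke factors divide `B` with a quotient still bounded by 1; a longest
  -- good list exhausts the zeros with multiplicity.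
  set Good : List ℂ → Prop := fun l => (∀ a ∈ l, a ∈ ball (0 : ℂ) 1) ∧ ∃ G : ℂ → ℂ,
    DifferentiableOn ℂ G (ball 0 1) ∧ (∀ z ∈ ball (0 : ℂ) 1, ‖G z‖ ≤ 1) ∧
    ∀ z ∈ ball (0 : ℂ) 1, B z = G z * (l.map fun a => discAut a z).prod with hGood
  have hnil : Good [] := ⟨by simp, B, hBd, fun z hz => (mem_ball_zero_iff.1 (hB.1 hz)).le, by simp⟩
  have hprod_le : ∀ l : List ℂ, ∀ z : ℂ, ∀ q : ℝ, (∀ a ∈ l, ‖discAut a z‖ ≤ q) →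
      ‖(l.map fun a => discAut a z).prod‖ ≤ q ^ l.length := by
    intro l z q
    induction l with
    | nil => simp
    | cons a l ih =>
      intro h
      rw [List.map_cons, List.prod_cons, norm_mul, List.length_cons, pow_succ']
      have h1 := h a (by simp)
      exact mul_le_mul h1 (ih fun b hb => h b (by simp [hb])) (norm_nonneg _)
        ((norm_nonneg _).trans h1)
  -- a point where `B` does not vanish
  obtain ⟨ρ, hρ0, hρ1, hρ⟩ := hB.exists_norm_gt (r := 0) one_pos
  set z₁ : ℂ := (((ρ + 1) / 2 : ℝ) : ℂ) with hz₁
  have hz₁n : ‖z₁‖ = (ρ + 1) / 2 := by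
    rw [hz₁, norm_real, Real.norm_of_nonneg (by linarith)]
  have hz₁b : z₁ ∈ ball (0 : ℂ) 1 := by rw [mem_ball_zero_iff, hz₁n]; linarith
  have hBz₁ : 0 < ‖B z₁‖ := hρ z₁ hz₁b (by rw [hz₁n]; linarith)
  -- the zeros stay in a compact set
  have hK : IsCompact (ball 0 1 ∩ B ⁻¹' {0}) :=
    hB.2 {0} (by simp) isCompact_singleton
  have hgoodK : ∀ l, Good l → ∀ a ∈ l, a ∈ ball 0 1 ∩ B ⁻¹' {0} := by
    rintro l ⟨hl, G, -, -, hGB⟩ a ha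
    refine ⟨hl a ha, ?_⟩
    rw [mem_preimage, mem_singleton_iff, hGB a (hl a ha)]
    refine mul_eq_zero_of_right _ (List.prod_eq_zero ?_)
    rw [List.mem_map]
    exact ⟨a, ha, discAut_self a⟩
  obtain ⟨q, hq0, hq1, hq⟩ : ∃ q : ℝ, 0 ≤ q ∧ q < 1 ∧
      ∀ a ∈ ball 0 1 ∩ B ⁻¹' {0}, ‖discAut a z₁‖ ≤ q := by
    rcases (ball 0 1 ∩ B ⁻¹' {0}).eq_empty_or_nonempty with he | hne
    · exact ⟨0, le_rfl, one_pos, by simp [he]⟩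
    · have hc : ContinuousOn (fun a => ‖discAut a z₁‖) (ball 0 1 ∩ B ⁻¹' {0}) := by
        refine ContinuousOn.norm (ContinuousOn.div (by fun_prop) ?_ fun a ha => ?_)
        · exact continuousOn_const.sub (Complex.continuous_conj.continuousOn.mul continuousOn_const)
        · exact one_sub_conj_mul_ne_zero (mem_ball_zero_iff.1 ha.1) (mem_ball_zero_iff.1 hz₁b)
      obtain ⟨a, ha, hmax⟩ := hK.exists_isMaxOn hne hc
      exact ⟨_, norm_nonneg _, norm_discAut_lt_one (mem_ball_zero_iff.1 ha.1)
        (mem_ball_zero_iff.1 hz₁b), fun b hb => hmax hb⟩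
  -- Each factor is at most `q` at `z₁`, so a good list of length `n` gives `0 < |B z₁| ≤ q ^ n`,
  -- which bounds `n`.
  obtain ⟨n₀, hn₀⟩ := exists_pow_lt_of_lt_one hBz₁ hq1
  have hlen : ∀ l, Good l → l.length ≤ n₀ := by
    intro l hl
    by_contra hcon
    have h1 := hprod_le l z₁ q fun a ha => hq a (hgoodK l hl a ha)
    obtain ⟨-, G, -, hG1, hGB⟩ := hl
    have h2 : ‖B z₁‖ ≤ q ^ l.length := by
      rw [hGB z₁ hz₁b, norm_mul]
      exact (mul_le_of_le_one_left (norm_nonneg _) (hG1 z₁ hz₁b)).trans h1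
    have h3 : q ^ l.length ≤ q ^ n₀ := pow_le_pow_of_le_one hq0 hq1.le (by omega)
    linarith
  obtain ⟨l, hl, hmax⟩ : ∃ l, Good l ∧ ∀ l', Good l' → l'.length ≤ l.length := by
    have hS : (List.length '' {l | Good l}).Nonempty := ⟨_, mem_image_of_mem _ hnil⟩
    have hSb : BddAbove (List.length '' {l | Good l}) :=
      ⟨n₀, by rintro _ ⟨l, hl, rfl⟩; exact hlen l hl⟩
    obtain ⟨l, hl, hle⟩ := Nat.sSup_mem hS hSb
    exact ⟨l, hl, fun l' hl' => hle ▸ le_csSup hSb (mem_image_of_mem _ hl')⟩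
  obtain ⟨hlb, G, hG, hG1, hGB⟩ := hl
  have hG0 : ∀ z ∈ ball (0 : ℂ) 1, G z ≠ 0 := by
    intro a ha h0
    obtain ⟨H, hH, hH1, hGH⟩ := exists_eq_discAut_mul hG hG1 ha h0
    have : Good (a :: l) := by
      refine ⟨by simpa using ⟨mem_ball_zero_iff.1 ha, fun b hb => mem_ball_zero_iff.1 (hlb b hb)⟩,
        H, hH, hH1, fun z hz => ?_⟩
      rw [hGB z hz, hGH z hz, List.map_cons, List.prod_cons]
      ring
    have := hmax _ this
    simp at this
  -- Near the circle `|G| ≥ |B| > r`; the maximum principle for the reciprocal of the zero-free `G`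
  -- extends `|G| ≥ r` inwards, for every `r < 1`.
  have hGnorm : ∀ z ∈ ball (0 : ℂ) 1, ‖G z‖ = 1 := by
    intro z hz
    refine le_antisymm (hG1 z hz) (le_of_forall_lt_imp_le_of_dense fun r hr => ?_)
    rcases le_or_gt r 0 with hr0 | hr0
    · exact hr0.trans (norm_nonneg _)
    obtain ⟨ρ, hρ0, hρ1, hρ⟩ := hB.exists_norm_gt hr
    obtain ⟨ρ', h1, h2⟩ := exists_between (max_lt hρ1 (mem_ball_zero_iff.1 hz))
    have hcl : closure (ball (0 : ℂ) ρ') ⊆ ball 0 1 := by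
      rw [closure_ball _ (by linarith [le_max_left ρ ‖z‖])]
      exact closedBall_subset_ball h2
    have hd : DiffContOnCl ℂ (fun w => (G w)⁻¹) (ball 0 ρ') :=
      DifferentiableOn.diffContOnCl ((hG.mono hcl).inv fun w hw => hG0 w (hcl hw))
    have h3 := Complex.norm_le_of_forall_mem_frontier_norm_le isBounded_ball hd (C := r⁻¹)
      (fun w hw => by
        have hwb := hcl (frontier_subset_closure hw)
        rw [frontier_ball _ (by linarith [le_max_left ρ ‖z‖]), mem_sphere_zero_iff_norm] at hw
        have h4 := hρ w hwb (by rw [hw]; exact (le_max_left _ _).trans_lt h1)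
        have h5 : ‖B w‖ ≤ ‖G w‖ := by
          rw [hGB w hwb, norm_mul]
          refine mul_le_of_le_one_right (norm_nonneg _) ?_
          have := hprod_le l w 1 fun a ha => (norm_discAut_lt_one
            (mem_ball_zero_iff.1 (hlb a ha)) (mem_ball_zero_iff.1 hwb)).le
          simpa using this
        rw [norm_inv]
        exact inv_anti₀ hr0 (by linarith))
      (subset_closure (mem_ball_zero_iff.2 ((le_max_right _ _).trans_lt h1)))
    rw [norm_inv] at h3
    exact (inv_le_inv₀ (norm_pos_iff.2 (hG0 z hz)) hr0).1 h3
  have h0b : (0 : ℂ) ∈ ball (0 : ℂ) 1 := mem_ball_self one_pos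
  have hconst : EqOn G (Function.const ℂ (G 0)) (ball 0 1) := by
    refine Complex.eqOn_of_isPreconnected_of_isMaxOn_norm (convex_ball _ _).isPreconnected
      isOpen_ball hG h0b fun z hz => ?_
    simp [hGnorm z hz, hGnorm 0 h0b]
  refine ⟨l, hlb, G 0, hGnorm 0 h0b, fun z hz => ?_⟩
  rw [hGB z hz, hconst hz]
  rfl

open Polynomial in
/-- A finite Blaschke product of degree `n` takes each value at most `n` times. -/
theorem ProperOn.exists_ncard_fiber_le {B : ℂ → ℂ} (hB : ProperOn B (ball 0 1) (ball 0 1))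
    (hBd : DifferentiableOn ℂ B (ball 0 1)) :
    ∃ N : ℕ, ∀ w ∈ ball (0 : ℂ) 1, (ball 0 1 ∩ B ⁻¹' {w}).Finite ∧
      (ball 0 1 ∩ B ⁻¹' {w}).ncard ≤ N := by
  obtain ⟨l, hl, u, hu, hBl⟩ := hB.exists_eq_blaschke hBd
  refine ⟨l.length, fun w hw => ?_⟩
  -- The equation `B z = w` with denominators cleared. It is not trivial, since the fibre is compact
  -- and the disk is not.
  set p : ℂ[X] := C u * (l.map fun a => C a - X).prod - C w * (l.map fun a => 1 - C (conj a) * X).prod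
    with hp
  have heval : ∀ z ∈ ball (0 : ℂ) 1, p.eval z = (B z - w) * (l.map fun a => 1 - conj a * z).prod := by
    intro z hz
    rw [hBl z hz]
    have h1 : (l.map fun a => discAut a z).prod * (l.map fun a => 1 - conj a * z).prod =
        (l.map fun a => a - z).prod := by
      rw [← List.prod_map_mul]
      congr 1
      refine List.map_congr_left fun a ha => ?_
      rw [discAut, div_mul_cancel₀]
      exact one_sub_conj_mul_ne_zero (mem_ball_zero_iff.1 (hl a ha)) (mem_ball_zero_iff.1 hz)
    rw [sub_mul, mul_assoc, h1, hp]
    simp [eval_list_prod, Function.comp_def]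
  have hprod0 : ∀ z ∈ ball (0 : ℂ) 1, (l.map fun a => 1 - conj a * z).prod ≠ 0 := by
    intro z hz h0
    rw [List.prod_eq_zero_iff, List.mem_map] at h0
    obtain ⟨a, ha, h0⟩ := h0
    exact one_sub_conj_mul_ne_zero (mem_ball_zero_iff.1 (hl a ha)) (mem_ball_zero_iff.1 hz) h0
  have hp0 : p ≠ 0 := by
    intro h0
    have : ball 0 1 ∩ B ⁻¹' {w} = ball (0 : ℂ) 1 := by
      refine inter_eq_left.2 fun z hz => ?_
      have h1 := heval z hz
      rw [h0, eval_zero] at h1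
      rcases mul_eq_zero.1 h1.symm with h | h
      · exact sub_eq_zero.1 h
      · exact absurd h (hprod0 z hz)
    have hc := hB.2 {w} (by simpa using hw) isCompact_singleton
    rw [this] at hc
    exact (nonempty_ball.2 one_pos).ne_empty (hc.eq_empty_of_isOpen_complex isOpen_ball)
  have hsub : ball 0 1 ∩ B ⁻¹' {w} ⊆ (p.roots.toFinset : Set ℂ) := by
    rintro z ⟨hz, hzw⟩
    rw [mem_preimage, mem_singleton_iff] at hzw
    simp only [Finset.mem_coe, Multiset.mem_toFinset, mem_roots hp0, IsRoot.def]
    rw [heval z hz, hzw, sub_self, zero_mul]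
  have hdeg : ∀ g : ℂ → ℂ[X], (∀ a, (g a).natDegree ≤ 1) →
      (l.map g).prod.natDegree ≤ l.length := by
    intro g hg
    clear * - hg
    induction l with
    | nil => simp
    | cons a l ih =>
      rw [List.map_cons, List.prod_cons, List.length_cons]
      refine natDegree_mul_le.trans ?_
      have := hg a
      omega
  refine ⟨(Finset.finite_toSet _).subset hsub, ?_⟩
  calc (ball 0 1 ∩ B ⁻¹' {w}).ncard ≤ (p.roots.toFinset : Set ℂ).ncard :=
        ncard_le_ncard hsub (Finset.finite_toSet _)
    _ = p.roots.toFinset.card := ncard_coe_finset _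
    _ ≤ Multiset.card p.roots := Multiset.toFinset_card_le _
    _ ≤ p.natDegree := card_roots' p
    _ ≤ l.length := by
        refine (natDegree_sub_le _ _).trans (max_le ?_ ?_)
        · refine (natDegree_C_mul_le _ _).trans (hdeg _ fun a => ?_)
          exact (natDegree_sub_le _ _).trans (by simp)
        · refine (natDegree_C_mul_le _ _).trans (hdeg _ fun a => ?_)
          refine (natDegree_sub_le _ _).trans ?_
          simp only [natDegree_one, Nat.zero_le, sup_of_le_right]
          exact (natDegree_C_mul_le _ _).trans natDegree_X_le

/-! ### Harnack's inequality and its transfer by proper maps. -/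

/-- Harnack's inequality with constant `A` on the subset `S` of `P`, for the real parts of
holomorphic functions on `P` with positive real part. -/
def HarnackOn (P S : Set ℂ) (A : ℝ) : Prop :=
  ∀ h : ℂ → ℂ, DifferentiableOn ℂ h P → (∀ z ∈ P, 0 < (h z).re) →
    ∀ z ∈ S, ∀ w ∈ S, (h z).re ≤ A * (h w).re

/-- The Cayley transform `(h - h 0) / (h + conj (h 0))` maps into the closed disk and vanishes at 0.
Schwarz's lemma bounds it by `q` at `z`; solving for the real part gives the constant. -/
theorem harnack_center {h : ℂ → ℂ} (hh : DifferentiableOn ℂ h (ball 0 1))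
    (hpos : ∀ z ∈ ball (0 : ℂ) 1, 0 < (h z).re) {q : ℝ} (hq : q < 1) {z : ℂ} (hz : ‖z‖ ≤ q) :
    (h z).re ≤ (1 + q) / (1 - q) * (h 0).re := by
  have hzb : z ∈ ball (0 : ℂ) 1 := mem_ball_zero_iff.2 (hz.trans_lt hq)
  have h0b : (0 : ℂ) ∈ ball (0 : ℂ) 1 := mem_ball_self one_pos
  have h0 := hpos 0 h0b
  have hq0 : 0 ≤ q := (norm_nonneg z).trans hz
  have hden : ∀ w ∈ ball (0 : ℂ) 1, h w + conj (h 0) ≠ 0 := by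
    intro w hw h1
    have := congrArg Complex.re h1
    simp only [add_re, conj_re, zero_re] at this
    linarith [hpos w hw]
  set C : ℂ → ℂ := fun w => (h w - h 0) / (h w + conj (h 0)) with hC
  have hCd : DifferentiableOn ℂ C (ball 0 1) :=
    (hh.sub_const _).div (hh.add_const _) hden
  have hCm : MapsTo C (ball 0 1) (closedBall 0 1) := by
    intro w hw
    rw [mem_closedBall_zero_iff, hC]
    simp only
    rw [norm_div, div_le_one (norm_pos_iff.2 (hden w hw))]
    refine le_of_sq_le_sq ?_ (norm_nonneg _)
    rw [← normSq_eq_norm_sq, ← normSq_eq_norm_sq, normSq_apply, normSq_apply]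
    simp only [sub_re, sub_im, add_re, add_im, conj_re, conj_im]
    nlinarith [mul_pos (hpos w hw) h0]
  have h1 := Complex.norm_le_norm_of_mapsTo_ball hCd hCm (by simp [hC]) (mem_ball_zero_iff.1 hzb)
  have h2 : ‖h z - h 0‖ ≤ q * ‖h z + conj (h 0)‖ := by
    have := h1.trans hz
    rw [hC] at this
    simp only at this
    rwa [norm_div, div_le_iff₀ (norm_pos_iff.2 (hden z hzb))] at this
  have h3 : ‖h z - h 0‖ ^ 2 ≤ q ^ 2 * ‖h z + conj (h 0)‖ ^ 2 := by
    rw [← mul_pow]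
    exact pow_le_pow_left₀ (norm_nonneg _) h2 2
  rw [← normSq_eq_norm_sq, ← normSq_eq_norm_sq, normSq_apply, normSq_apply] at h3
  simp only [sub_re, sub_im, add_re, add_im, conj_re, conj_im] at h3
  have h4 : (h z).re - (h 0).re ≤ q * ((h z).re + (h 0).re) := by
    refine le_of_sq_le_sq ?_ (mul_nonneg hq0 (by linarith [hpos z hzb]))
    have : q ^ 2 ≤ 1 := pow_le_one₀ hq0 hq.le
    nlinarith [sq_nonneg ((h z).im - (h 0).im)]
  rw [div_mul_eq_mul_div, le_div_iff₀ (by linarith)]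
  linarith

/-- The pseudohyperbolic distance is symmetric, which allows Harnack's inequality to be used in both
directions. -/
theorem norm_discAut_comm (a z : ℂ) : ‖discAut a z‖ = ‖discAut z a‖ := by
  rw [discAut, discAut, norm_div, norm_div, norm_sub_rev a z]
  congr 1
  rw [← Complex.norm_conj (1 - conj a * z)]
  simp [mul_comm]

theorem harnack_discAut {h : ℂ → ℂ} (hh : DifferentiableOn ℂ h (ball 0 1))
    (hpos : ∀ z ∈ ball (0 : ℂ) 1, 0 < (h z).re) {q : ℝ} (hq : q < 1) {a z : ℂ}
    (ha : a ∈ ball (0 : ℂ) 1) (hz : z ∈ ball (0 : ℂ) 1) (haz : ‖discAut a z‖ ≤ q) :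
    (h z).re ≤ (1 + q) / (1 - q) * (h a).re := by
  have h1 := harnack_center (h := fun w => h (discAut a w))
    (hh.comp (differentiableOn_discAut ha) (discAut_mapsTo ha))
    (fun w hw => hpos _ (discAut_mapsTo ha hw)) hq haz
  simpa only [discAut_discAut (mem_ball_zero_iff.1 ha) (mem_ball_zero_iff.1 hz), discAut_zero]
    using h1

/-- An interval covered by `N` intervals of length `2L` has length at most `2LN`. -/
theorem sub_le_of_Icc_subset_biUnion {x y L : ℝ} (hL : 0 ≤ L) {s : Finset ℂ} {c : ℂ → ℝ}
    (h : Icc x y ⊆ ⋃ a ∈ s, Icc (c a - L) (c a + L)) : y - x ≤ s.card * (2 * L) := by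
  have h1 := MeasureTheory.measure_mono (μ := MeasureTheory.volume) h
  have h2 := h1.trans (MeasureTheory.measure_biUnion_finset_le s _)
  have h3 : ∀ a, MeasureTheory.volume (Icc (c a - L) (c a + L)) = ENNReal.ofReal (2 * L) := by
    intro a
    rw [Real.volume_Icc]
    congr 1
    ring
  simp only [h3, Real.volume_Icc, Finset.sum_const, nsmul_eq_mul] at h2
  rw [← ENNReal.ofReal_natCast, ← ENNReal.ofReal_mul (by positivity)] at h2
  exact (ENNReal.ofReal_le_ofReal_iff (by positivity)).1 h2

/-- If the values of a positive function `u` on a preconnected set stay within a factor `e^L` of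
finitely many numbers, any two of them are comparable. -/
theorem le_exp_mul_of_finset_cover {S : Set ℂ} (hS : IsPreconnected S) {u : ℂ → ℝ}
    (hu : ContinuousOn u S) (hpos : ∀ z ∈ S, 0 < u z) {L : ℝ} (hL : 0 ≤ L) {s : Finset ℂ}
    {v : ℂ → ℝ} (hv : ∀ a ∈ s, 0 < v a)
    (hcov : ∀ z ∈ S, ∃ a ∈ s, u z ≤ Real.exp L * v a ∧ v a ≤ Real.exp L * u z) {z w : ℂ}
    (hz : z ∈ S) (hw : w ∈ S) : u z ≤ Real.exp (s.card * (2 * L)) * u w := by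
  have hlogc : ContinuousOn (fun z => Real.log (u z)) S := hu.log fun z hz => (hpos z hz).ne'
  have himg := hS.image _ hlogc
  -- After taking logarithms, connectedness makes the image an interval, and comparability covers it
  -- by `s.card` intervals of length `2L`.
  have hsub : Icc (Real.log (u w)) (Real.log (u z)) ⊆
      ⋃ a ∈ s, Icc (Real.log (v a) - L) (Real.log (v a) + L) := by
    refine (himg.ordConnected.out (mem_image_of_mem _ hw) (mem_image_of_mem _ hz)).trans ?_
    rintro _ ⟨y, hy, rfl⟩
    obtain ⟨a, ha, h1, h2⟩ := hcov y hy
    refine mem_biUnion ha ⟨?_, ?_⟩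
    · have := Real.log_le_log (hv a ha) h2
      rw [Real.log_mul (Real.exp_ne_zero _) (hpos y hy).ne', Real.log_exp] at this
      simp only
      linarith
    · have := Real.log_le_log (hpos y hy) h1
      rw [Real.log_mul (Real.exp_ne_zero _) (hv a ha).ne', Real.log_exp] at this
      simp only
      linarith
  have h1 := sub_le_of_Icc_subset_biUnion hL hsub
  rw [← Real.exp_log (hpos z hz), ← Real.exp_log (hpos w hw), ← Real.exp_add]
  exact Real.exp_le_exp.2 (by linarith)

/-- Near-zero values of a proper self-map of the disk with simple zeros are attained near its
zeros. -/
theorem ProperOn.exists_norm_discAut_lt {B : ℂ → ℂ} (hB : ProperOn B (ball 0 1) (ball 0 1))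
    (hBd : DifferentiableOn ℂ B (ball 0 1)) {N : ℕ}
    (hfin : (ball 0 1 ∩ B ⁻¹' {0}).Finite) (hN : (ball 0 1 ∩ B ⁻¹' {0}).ncard ≤ N)
    (hsimple : ∀ a ∈ ball (0 : ℂ) 1, B a = 0 → deriv B a ≠ 0) {q : ℝ} (hq0 : 0 ≤ q) (hq1 : q ≤ 1)
    {z : ℂ} (hz : z ∈ ball (0 : ℂ) 1) (hBz : ‖B z‖ < q ^ N) :
    ∃ a ∈ ball 0 1 ∩ B ⁻¹' {0}, ‖discAut a z‖ < q := by
  obtain ⟨l, hl, u, hu, hBl⟩ := hB.exists_eq_blaschke hBd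
  have hdiff : ∀ l : List ℂ, (∀ a ∈ l, a ∈ ball (0 : ℂ) 1) → ∀ w ∈ ball (0 : ℂ) 1,
      DifferentiableAt ℂ (fun z => (l.map fun a => discAut a z).prod) w := by
    intro l hl w hw
    induction l with
    | nil => simp
    | cons a l ih =>
      simp only [List.map_cons, List.prod_cons]
      exact ((hasDerivAt_discAut (mem_ball_zero_iff.1 (hl a (by simp)))
        (mem_ball_zero_iff.1 hw)).differentiableAt).mul (ih fun b hb => hl b (by simp [hb]))
  have hzero : ∀ a ∈ l, a ∈ ball 0 1 ∩ B ⁻¹' {0} := by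
    intro a ha
    refine ⟨hl a ha, ?_⟩
    rw [mem_preimage, mem_singleton_iff, hBl a (hl a ha)]
    refine mul_eq_zero_of_right _ (List.prod_eq_zero ?_)
    rw [List.mem_map]
    exact ⟨a, ha, discAut_self a⟩
  -- A repeated factor would be a double zero. Hence there are at most `N` factors, and if all were
  -- at least `q` at `z`, then `|B z| ≥ q ^ N`.
  have hnodup : l.Nodup := by
    rw [List.nodup_iff_sublist]
    intro a hsub
    obtain ⟨l', hl'⟩ := hsub.exists_perm_append
    have hal : a ∈ l := hsub.subset (by simp)
    have hl'b : ∀ b ∈ l', b ∈ ball (0 : ℂ) 1 := fun b hb =>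
      hl b (hl'.symm.subset (by simp [hb]))
    have hab := hl a hal
    refine hsimple a hab (hzero a hal).2 ?_
    set H : ℂ → ℂ := fun z => discAut a z * (l'.map fun a => discAut a z).prod with hH
    have hHd : HasDerivAt H (deriv H a) a :=
      (((hasDerivAt_discAut (mem_ball_zero_iff.1 hab)
        (mem_ball_zero_iff.1 hab)).differentiableAt).mul (hdiff l' hl'b a hab)).hasDerivAt
    have hφ := hasDerivAt_discAut (mem_ball_zero_iff.1 hab) (mem_ball_zero_iff.1 hab)
    have h1 := (hφ.mul hHd).const_mul u
    have h2 : HasDerivAt B _ a := h1.congr_of_eventuallyEq (by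
      filter_upwards [isOpen_ball.mem_nhds hab] with z hz
      rw [hBl z hz, (hl'.map fun a => discAut a z).prod_eq]
      simp [hH])
    rw [h2.deriv, discAut_self, hH]
    simp [discAut_self]
  by_contra! hcon
  have hlen : l.length ≤ N := by
    classical
    calc l.length = l.toFinset.card := (List.toFinset_card_of_nodup hnodup).symm
      _ = (l.toFinset : Set ℂ).ncard := (ncard_coe_finset _).symm
      _ ≤ (ball 0 1 ∩ B ⁻¹' {0}).ncard := ncard_le_ncard (fun a ha => hzero a (by simpa using ha)) hfin
      _ ≤ N := hN
  have hprod : ∀ l : List ℂ, (∀ a ∈ l, q ≤ ‖discAut a z‖) →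
      q ^ l.length ≤ ‖(l.map fun a => discAut a z).prod‖ := by
    intro l hl
    induction l with
    | nil => simp
    | cons a l ih =>
      rw [List.map_cons, List.prod_cons, norm_mul, List.length_cons, pow_succ']
      exact mul_le_mul (hl a (by simp)) (ih fun b hb => hl b (by simp [hb])) (by positivity)
        (norm_nonneg _)
  have h1 := hprod l fun a ha => hcon a (hzero a ha)
  rw [hBl z hz, norm_mul, hu, one_mul] at hBz
  have h2 : q ^ N ≤ q ^ l.length := pow_le_pow_of_le_one hq0 hq1 hlen
  linarith

/-- A proper map of a nonempty open set is not constant. -/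
theorem ProperOn.deriv_not_eqOn_zero {F : ℂ → ℂ} {P P' : Set ℂ} (hF : ProperOn F P P')
    (hPo : IsOpen P) (hPc : IsConnected P) (hFd : DifferentiableOn ℂ F P) :
    ¬ EqOn (deriv F) 0 P := by
  intro h0
  obtain ⟨z₀, hz₀⟩ := hPc.nonempty
  have hconst : ∀ z ∈ P, F z = F z₀ := fun z hz =>
    hPo.is_const_of_deriv_eq_zero hPc.isPreconnected hFd h0 hz hz₀
  have hc := hF.2 {F z₀} (by simpa using hF.1 hz₀) isCompact_singleton
  have h : P ∩ F ⁻¹' {F z₀} = P := inter_eq_left.2 fun z hz => hconst z hz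
  rw [h] at hc
  exact hPc.nonempty.ne_empty (hc.eq_empty_of_isOpen_complex hPo)

theorem AnalyticOnNhd.finite_zeros_inter_compact {f : ℂ → ℂ} {P K : Set ℂ}
    (hf : AnalyticOnNhd ℂ f P) (hPc : IsPreconnected P) (h0 : ¬ EqOn f 0 P) (hK : IsCompact K)
    (hKP : K ⊆ P) : (K ∩ f ⁻¹' {0}).Finite := by
  by_contra hinf
  obtain ⟨z, hz, hacc⟩ := Set.Infinite.exists_accPt_of_subset_isCompact hinf hK inter_subset_left
  refine h0 (hf.eqOn_zero_of_preconnected_of_frequently_eq_zero hPc (hKP hz) ?_)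
  exact (accPt_iff_frequently_nhdsNE.1 hacc).mono fun w hw => hw.2

/-- By properness only finitely many critical points lie over a small closed disk, and the disk is
infinite. A regular value serves to make the zeros of a Blaschke product simple. -/
theorem ProperOn.exists_regular_value {F : ℂ → ℂ} {P P' O : Set ℂ} (hF : ProperOn F P P')
    (hPo : IsOpen P) (hPc : IsConnected P) (hFd : DifferentiableOn ℂ F P) (hO : IsOpen O)
    (hOn : O.Nonempty) (hOP : O ⊆ P') : ∃ w ∈ O, ∀ z ∈ P, F z = w → deriv F z ≠ 0 := by
  obtain ⟨w₁, hw₁⟩ := hOn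
  obtain ⟨r, hr, hrO⟩ := Metric.nhds_basis_closedBall.mem_iff.1 (hO.mem_nhds hw₁)
  have hK := hF.2 (closedBall w₁ r) (hrO.trans hOP) (isCompact_closedBall _ _)
  have hfin := ((hFd.analyticOnNhd hPo).deriv).finite_zeros_inter_compact hPc.isPreconnected
    (hF.deriv_not_eqOn_zero hPo hPc hFd) hK inter_subset_left
  have hinf : (closedBall w₁ r).Infinite :=
    infinite_of_mem_nhds w₁ (closedBall_mem_nhds w₁ hr)
  obtain ⟨w, hw, hwn⟩ := (hinf.sdiff (hfin.image F)).nonempty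
  exact ⟨w, hrO hw, fun z hz hzw h0 => hwn ⟨z, ⟨⟨hz, by rwa [mem_preimage, hzw]⟩, h0⟩, hzw⟩⟩

theorem deriv_ne_zero_of_leftInverse {f g : ℂ → ℂ} {P Q : Set ℂ} (hPo : IsOpen P) (hQo : IsOpen Q)
    (hf : DifferentiableOn ℂ f P) (hg : DifferentiableOn ℂ g Q) (hfm : MapsTo f P Q)
    (hgf : ∀ z ∈ P, g (f z) = z) {z : ℂ} (hz : z ∈ P) : deriv f z ≠ 0 := by
  have h1 := (hf.differentiableAt (hPo.mem_nhds hz)).hasDerivAt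
  have h2 := (hg.differentiableAt (hQo.mem_nhds (hfm hz))).hasDerivAt
  have h3 : HasDerivAt (fun w => w) (deriv g (f z) * deriv f z) z := by
    refine (h2.comp z h1).congr_of_eventuallyEq ?_
    filter_upwards [hPo.mem_nhds hz] with w hw
    exact (hgf w hw).symm
  intro h0
  have := h3.unique (hasDerivAt_id' z)
  simp [h0] at this

/-- In the coordinate of the disk vanishing at a point of `S`, a set satisfying Harnack's inequality
lies in a disk of definite radius. -/
theorem HarnackOn.norm_le {P S : Set ℂ} {A : ℝ} (hA : 1 ≤ A) (hS : HarnackOn P S A) {f : ℂ → ℂ}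
    (hf : DifferentiableOn ℂ f P) (hfm : MapsTo f P (ball 0 1)) {w₀ w : ℂ} (hw₀ : w₀ ∈ S)
    (hw : w ∈ S) (hSP : S ⊆ P) (hf0 : f w₀ = 0) : ‖f w‖ ≤ (A - 1) / (A + 1) := by
  obtain ⟨c, hc, hcw⟩ : ∃ c : ℂ, ‖c‖ = 1 ∧ c * f w = (‖f w‖ : ℂ) := by
    by_cases h0 : f w = 0
    · exact ⟨1, by simp, by simp [h0]⟩
    · have h1 : (‖f w‖ : ℂ) ≠ 0 := by simpa using h0
      refine ⟨‖f w‖ / f w, by simp [h0], by field_simp⟩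
  have hlt : ∀ z ∈ P, ‖c * f z‖ < 1 := by
    intro z hz
    rw [norm_mul, hc, one_mul]
    exact mem_ball_zero_iff.1 (hfm hz)
  have hne : ∀ z ∈ P, 1 - c * f z ≠ 0 := by
    intro z hz h
    have := hlt z hz
    rw [← sub_eq_zero.1 h, norm_one] at this
    exact lt_irrefl _ this
  -- The real part of `(1 + c f) / (1 - c f)` is 1 at `w₀` and, by the choice of the rotation `c`,
  -- equals `(1 + t) / (1 - t)` at `w`, with `t = |f w|`.
  have key := hS (fun z => (1 + c * f z) / (1 - c * f z))
    (((hf.const_mul c).const_add 1).div ((hf.const_mul c).const_sub 1) hne) (fun z hz => by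
      have h1 := hlt z hz
      have h2 : 0 < normSq (1 - c * f z) := normSq_pos.2 (hne z hz)
      have h3 : ‖c * f z‖ ^ 2 < 1 := pow_lt_one₀ (norm_nonneg _) h1 two_ne_zero
      rw [← normSq_eq_norm_sq, normSq_apply] at h3
      rw [div_re, ← add_div]
      refine div_pos ?_ h2
      simp only [add_re, sub_re, one_re, add_im, sub_im, one_im]
      nlinarith) w hw w₀ hw₀
  have ht : ‖f w‖ < 1 := mem_ball_zero_iff.1 (hfm (hSP hw))
  simp only [hf0, mul_zero, add_zero, sub_zero, div_one, one_re, mul_one, hcw] at key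
  have h4 : ((1 + (‖f w‖ : ℂ)) / (1 - (‖f w‖ : ℂ))).re = (1 + ‖f w‖) / (1 - ‖f w‖) := by
    have : (1 + (‖f w‖ : ℂ)) / (1 - (‖f w‖ : ℂ)) = (((1 + ‖f w‖) / (1 - ‖f w‖) : ℝ) : ℂ) := by
      push_cast
      ring
    rw [this, ofReal_re]
  rw [h4, div_le_iff₀ (by linarith)] at key
  rw [le_div_iff₀ (by linarith)]
  linarith

/-- Harnack's inequality passes to preimages under proper maps of bounded degree. -/
theorem HarnackOn.exists_transfer (A : ℝ) (hA : 1 ≤ A) (N : ℕ) : ∃ A' : ℝ, 1 ≤ A' ∧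
    ∀ (F : ℂ → ℂ) (P P' O S : Set ℂ), IsOpen P → IsConnected P → Bornology.IsBounded P →
      ChainFull P → IsOpen P' → IsConnected P' → Bornology.IsBounded P' → ChainFull P' →
      DifferentiableOn ℂ F P → ProperOn F P P' →
      (∀ w ∈ P', (P ∩ F ⁻¹' {w}).Finite ∧ (P ∩ F ⁻¹' {w}).ncard ≤ N) →
      IsOpen O → O.Nonempty → O ⊆ P' → HarnackOn P' O A → IsPreconnected S → S ⊆ P →
      MapsTo F S O → HarnackOn P S A' := by
  set q₀ := (A - 1) / (A + 1) with hq₀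
  have hq₀0 : 0 ≤ q₀ := div_nonneg (by linarith) (by linarith)
  have hq₀1 : q₀ < 1 := by rw [hq₀, div_lt_one (by linarith)]; linarith
  -- By Bernoulli, `(1 - η) ^ N ≥ 1 - N η = q₀ + 2 η`, so values of modulus at most `q₀` stay below
  -- `q ^ N`.
  set η := (1 - q₀) / (N + 2) with hη
  have hη0 : 0 < η := div_pos (by linarith) (by positivity)
  have hηN : (N + 2) * η = 1 - q₀ := by rw [hη]; field_simp
  have hη1 : η ≤ 1 := by nlinarith [(Nat.cast_nonneg N : (0 : ℝ) ≤ N)]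
  set q := 1 - η with hq
  have hq0 : 0 ≤ q := by linarith
  have hq1 : q < 1 := by linarith
  have hqN : q₀ < q ^ N := by
    have := one_add_mul_le_pow (a := -η) (by linarith) N
    rw [← sub_eq_add_neg, ← hq] at this
    nlinarith
  set L := Real.log ((1 + q) / (1 - q)) with hL
  have hq2 : 1 ≤ (1 + q) / (1 - q) := by rw [le_div_iff₀ (by linarith)]; linarith
  have hL0 : 0 ≤ L := Real.log_nonneg hq2
  have hLexp : Real.exp L = (1 + q) / (1 - q) := Real.exp_log (by linarith)
  refine ⟨Real.exp (N * (2 * L)), Real.one_le_exp (by positivity), ?_⟩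
  intro F P P' O S hPo hPc hPb hP hP'o hP'c hP'b hP' hFd hF hfib hOo hOn hOP hH hSc hSP hSO
  obtain ⟨w₀, hw₀, hreg⟩ := hF.exists_regular_value hPo hPc hFd hOo hOn hOP
  obtain ⟨z₀, hz₀⟩ := hPc.nonempty
  obtain ⟨f, g, hf, hg, hfm, hgm, hgf, hfg, -⟩ := exists_riemann_map hPo hPc hPb hP hz₀
  obtain ⟨f', g', hf', hg', hfm', hgm', hgf', hfg', hf'0⟩ :=
    exists_riemann_map hP'o hP'c hP'b hP' (hOP hw₀)
  have hgP : ProperOn g (ball 0 1) P := properOn_of_inverse hgm hfm hf.continuousOn hfg hgf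
  have hfP : ProperOn f' P' (ball 0 1) := properOn_of_inverse hfm' hgm' hg'.continuousOn hgf' hfg'
  set B : ℂ → ℂ := f' ∘ F ∘ g with hB
  have hBP : ProperOn B (ball 0 1) (ball 0 1) := hfP.comp (hF.comp hgP)
  have hBd : DifferentiableOn ℂ B (ball 0 1) :=
    hf'.comp (hFd.comp hg hgm) (hF.1.comp hgm)
  have hB0 : ∀ ζ ∈ ball (0 : ℂ) 1, B ζ = 0 ↔ F (g ζ) = w₀ := by
    intro ζ hζ
    constructor
    · intro h
      rw [← hgf' _ (hF.1 (hgm hζ)), ← hgf' w₀ (hOP hw₀), hf'0]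
      exact congrArg g' h
    · intro h
      simp only [hB, Function.comp_apply, h, hf'0]
  have hzeros : ball 0 1 ∩ B ⁻¹' {0} = f '' (P ∩ F ⁻¹' {w₀}) := by
    ext ζ
    constructor
    · rintro ⟨hζ, h0⟩
      exact ⟨g ζ, ⟨hgm hζ, (hB0 ζ hζ).1 h0⟩, hfg ζ hζ⟩
    · rintro ⟨z, ⟨hz, hzw⟩, rfl⟩
      refine ⟨hfm hz, (hB0 _ (hfm hz)).2 ?_⟩
      rw [hgf z hz]
      exact hzw
  obtain ⟨hfin, hcard⟩ := hfib w₀ (hOP hw₀)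
  have hBfin : (ball 0 1 ∩ B ⁻¹' {0}).Finite := hzeros ▸ hfin.image f
  have hBcard : (ball 0 1 ∩ B ⁻¹' {0}).ncard ≤ N := by
    rw [hzeros]
    exact (ncard_image_le hfin).trans hcard
  have hsimple : ∀ a ∈ ball (0 : ℂ) 1, B a = 0 → deriv B a ≠ 0 := by
    intro a ha h0
    have h1 := (hg.differentiableAt (isOpen_ball.mem_nhds ha)).hasDerivAt
    have h2 := (hFd.differentiableAt (hPo.mem_nhds (hgm ha))).hasDerivAt
    have h3 := (hf'.differentiableAt (hP'o.mem_nhds (hF.1 (hgm ha)))).hasDerivAt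
    have h4 : HasDerivAt B (deriv f' (F (g a)) * (deriv F (g a) * deriv g a)) a :=
      h3.comp a (h2.comp a h1)
    rw [h4.deriv]
    refine mul_ne_zero ?_ (mul_ne_zero (hreg _ (hgm ha) ((hB0 a ha).1 h0)) ?_)
    · exact deriv_ne_zero_of_leftInverse hP'o isOpen_ball hf' hg' hfm' hgf' (hF.1 (hgm ha))
    · exact deriv_ne_zero_of_leftInverse isOpen_ball hPo hg hf hgm hfg ha
  intro h hh hpos z hz w hw
  set H : ℂ → ℂ := h ∘ g with hHdef
  have hHd : DifferentiableOn ℂ H (ball 0 1) := hh.comp hg hgm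
  have hHpos : ∀ ζ ∈ ball (0 : ℂ) 1, 0 < (H ζ).re := fun ζ hζ => hpos _ (hgm hζ)
  -- Every `y` in `S` is within pseudohyperbolic distance `q` of one of at most `N` zeros of `B`, so
  -- the real part of `h` at `y` is within a factor `e^L` of one of `N` numbers. The zeros may lie
  -- outside `S`; connectedness of `S` joins the estimates.
  have hmain := le_exp_mul_of_finset_cover hSc (u := fun y => (h y).re)
    (Complex.continuous_re.comp_continuousOn (hh.continuousOn.mono hSP))
    (fun y hy => hpos y (hSP hy)) hL0 (s := hBfin.toFinset) (v := fun a => (H a).re)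
    (fun a ha => hHpos a ((hBfin.mem_toFinset.1 ha).1)) (fun y hy => by
      have hyb := hfm (hSP hy)
      have h1 : ‖B (f y)‖ ≤ q₀ := by
        simp only [hB, Function.comp_apply, hgf y (hSP hy)]
        exact hH.norm_le hA hf' hfm' hw₀ (hSO hy) hOP hf'0
      obtain ⟨a, ha, hay⟩ := hBP.exists_norm_discAut_lt hBd hBfin hBcard hsimple hq0 hq1.le hyb
        (h1.trans_lt hqN)
      refine ⟨a, hBfin.mem_toFinset.2 ha, ?_, ?_⟩
      · rw [hLexp]
        have := harnack_discAut hHd hHpos hq1 ha.1 hyb hay.le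
        simpa only [hHdef, Function.comp_apply, hgf y (hSP hy)] using this
      · rw [hLexp]
        rw [norm_discAut_comm] at hay
        have := harnack_discAut hHd hHpos hq1 hyb ha.1 hay.le
        simpa only [hHdef, Function.comp_apply, hgf y (hSP hy)] using this) hz hw
  refine hmain.trans (mul_le_mul_of_nonneg_right (Real.exp_le_exp.2 ?_) (hpos w (hSP hw)).le)
  rw [← ncard_eq_toFinset_card _ hBfin]
  have : ((ball 0 1 ∩ B ⁻¹' {0}).ncard : ℝ) ≤ N := by exact_mod_cast hBcard
  exact mul_le_mul_of_nonneg_right this (by positivity)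

/-! ### Harnack's inequality from an annulus of definite modulus. -/

/-- The exponential maps a vertical strip onto the annulus. -/
theorem isPreconnected_annulus {p q : ℝ} (hp : 0 < p) :
    IsPreconnected {ζ : ℂ | p < ‖ζ‖ ∧ ‖ζ‖ < q} := by
  rcases le_or_gt q p with hqp | hpq
  · convert isPreconnected_empty
    ext ζ
    simp only [mem_ofPred_eq, mem_empty_iff_false, iff_false]
    rintro ⟨h1, h2⟩
    linarith
  have h : {ζ : ℂ | p < ‖ζ‖ ∧ ‖ζ‖ < q} =
      Complex.exp '' (Complex.reLm ⁻¹' Ioo (Real.log p) (Real.log q)) := by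
    ext ζ
    constructor
    · rintro ⟨h1, h2⟩
      have h0 : ζ ≠ 0 := norm_pos_iff.1 (hp.trans h1)
      refine ⟨Complex.log ζ, ⟨?_, ?_⟩, Complex.exp_log h0⟩
      · rw [Complex.reLm_coe, Complex.log_re]
        exact Real.log_lt_log hp h1
      · rw [Complex.reLm_coe, Complex.log_re]
        exact Real.log_lt_log (hp.trans h1) h2
    · rintro ⟨s, ⟨h1, h2⟩, rfl⟩
      refine ⟨?_, ?_⟩
      · rw [Complex.norm_exp]
        exact (Real.log_lt_iff_lt_exp hp).1 h1
      · rw [Complex.norm_exp]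
        exact (Real.lt_log_iff_exp_lt (hp.trans hpq)).1 h2
  rw [h]
  exact ((convex_Ioo _ _).linear_preimage Complex.reLm).isPreconnected.image _
    Complex.continuous_exp.continuousOn

/-- Filling in a compact set surrounded by an annulus. -/
theorem closure_frontier_fill {W K L X₁ X₂ Γ E₂ C₁ C₂ : Set ℂ} (hL : IsCompact L) (hLW : L ⊆ W)
    (hKL : K ⊆ interior L) (hX₁ : IsOpen X₁) (hX₂ : IsOpen X₂) (hΓ : IsCompact Γ)
    (hW : W \ K = X₁ ∪ Γ ∪ X₂) (h12 : Disjoint X₁ X₂)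
    (hC₁ : IsCompact C₁) (hC₁W : C₁ ⊆ W) (hX₁L : X₁ ⊆ L ∪ C₁) (hC₂ : IsCompact C₂)
    (hC₂X : C₂ ⊆ X₂ ∪ Γ) (hE₂ : Disjoint E₂ L) (hX₂E : X₂ ⊆ E₂ ∪ C₂) :
    IsOpen (K ∪ X₁) ∧ Bornology.IsBounded (K ∪ X₁) ∧ closure (K ∪ X₁) ⊆ W ∧
      frontier (K ∪ X₁) ⊆ Γ := by
  have hA : ∀ z, z ∈ W ∧ z ∉ K ↔ z ∈ X₁ ∨ z ∈ Γ ∨ z ∈ X₂ := fun z => by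
    have : z ∈ W \ K ↔ z ∈ X₁ ∪ Γ ∪ X₂ := by rw [hW]
    simpa [or_assoc] using this
  rw [disjoint_left] at h12 hE₂
  -- Near `K` this is the interior of `L` minus the compact set `Γ ∪ C₂`: what remains there also
  -- misses `X₂`, so it lies in `K ∪ X₁`.
  have ho : IsOpen (K ∪ X₁) := by
    have : K ∪ X₁ = (interior L \ (Γ ∪ C₂)) ∪ X₁ := by
      ext z
      constructor
      · rintro (hz | hz)
        · refine Or.inl ⟨hKL hz, ?_⟩
          rintro (h | h)
          · exact ((hA z).2 (Or.inr (Or.inl h))).2 hz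
          · rcases hC₂X h with h | h
            · exact ((hA z).2 (Or.inr (Or.inr h))).2 hz
            · exact ((hA z).2 (Or.inr (Or.inl h))).2 hz
        · exact Or.inr hz
      · rintro (⟨hz, hn⟩ | hz)
        · by_contra hc
          simp only [mem_union, not_or] at hc hn
          have hzL := interior_subset hz
          rcases (hA z).1 ⟨hLW hzL, hc.1⟩ with h | h | h
          · exact hc.2 h
          · exact hn.1 h
          · rcases hX₂E h with h | h
            · exact hE₂ h hzL
            · exact hn.2 h
        · exact Or.inr hz
    rw [this]
    exact (isOpen_interior.sdiff (hΓ.union hC₂).isClosed).union hX₁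
  have hsub : K ∪ X₁ ⊆ L ∪ C₁ :=
    union_subset ((hKL.trans interior_subset).trans subset_union_left) hX₁L
  have hcl : closure (K ∪ X₁) ⊆ L ∪ C₁ := closure_minimal hsub (hL.union hC₁).isClosed
  have hclW : closure (K ∪ X₁) ⊆ W := hcl.trans (union_subset hLW hC₁W)
  have hdis : closure (K ∪ X₁) ⊆ X₂ᶜ := by
    refine closure_minimal ?_ hX₂.isClosed_compl
    rintro z (hz | hz) h
    · exact ((hA z).2 (Or.inr (Or.inr h))).2 hz
    · exact h12 hz h
  refine ⟨ho, (hL.union hC₁).isBounded.subset hsub, hclW, ?_⟩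
  rw [frontier, ho.interior_eq]
  rintro z ⟨hz, hn⟩
  simp only [mem_union, not_or] at hn
  rcases (hA z).1 ⟨hclW hz, hn.1⟩ with h | h | h
  · exact (hn.2 h).elim
  · exact h
  · exact (hdis hz h).elim

theorem IsPreconnected.subset_interior_or_disjoint {E L : Set ℂ} (hE : IsPreconnected E)
    (hL : IsClosed L) (h : Disjoint E (frontier L)) : E ⊆ interior L ∨ Disjoint E L := by
  by_cases hn : (E ∩ L).Nonempty
  · left
    have hcl : ∀ z ∈ E, z ∈ L → z ∈ interior L := by
      intro z hz hzL
      by_contra hni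
      exact disjoint_left.1 h hz (hL.frontier_eq ▸ ⟨hzL, hni⟩)
    obtain ⟨z, hz, hzL⟩ := hn
    intro w hw
    by_contra hwn
    obtain ⟨y, hy, hy1, hy2⟩ := hE (interior L) Lᶜ isOpen_interior hL.isOpen_compl
      (fun y hy => (em (y ∈ L)).imp (hcl y hy) id) ⟨z, hz, hcl z hz hzL⟩
      ⟨w, hw, fun h => hwn (hcl w hw h)⟩
    exact hy2 (interior_subset hy1)
  · right
    exact disjoint_iff_inter_eq_empty.2 (not_nonempty_iff_eq_empty.1 hn)

/-- The middle circle of a conformal annulus `W \ K` bounds an open neighbourhood of `K`. -/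
theorem exists_fill {W K : Set ℂ} (hW : IsOpen W) (hK : IsCompact K) (hKn : K.Nonempty)
    (hKW : K ⊆ W) {R : ℝ} (hR : 1 < R) {φ : ℂ → ℂ} (hφ : DifferentiableOn ℂ φ (roundAnnulus R))
    (hbij : BijOn φ (roundAnnulus R) (W \ K)) :
    ∃ C, IsOpen C ∧ Bornology.IsBounded C ∧ K ⊆ C ∧ closure C ⊆ W ∧
      frontier C ⊆ φ '' sphere 0 (√R) := by
  set ρ := √R with hρ
  have hρ1 : 1 < ρ := by rw [hρ, Real.lt_sqrt zero_le_one]; simpa using hR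
  have hρR : ρ < R := by
    have : ρ * ρ = R := Real.mul_self_sqrt (by linarith)
    nlinarith
  have hAo : IsOpen (roundAnnulus R) :=
    (isOpen_lt continuous_const continuous_norm).inter (isOpen_lt continuous_norm continuous_const)
  have hopen : ∀ s ⊆ roundAnnulus R, IsOpen s → IsOpen (φ '' s) := by
    rcases (hφ.analyticOnNhd hAo).is_constant_or_isOpen (isPreconnected_annulus one_pos) with
      ⟨w, hw⟩ | h
    · exfalso
      have h1 : (ρ : ℂ) ∈ roundAnnulus R := by
        simp only [roundAnnulus, mem_ofPred_eq, norm_real, Real.norm_eq_abs,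
          abs_of_pos (one_pos.trans hρ1)]
        exact ⟨hρ1, hρR⟩
      have h2 : (-ρ : ℂ) ∈ roundAnnulus R := by
        simp only [roundAnnulus, mem_ofPred_eq, norm_neg, norm_real, Real.norm_eq_abs,
          abs_of_pos (one_pos.trans hρ1)]
        exact ⟨hρ1, hρR⟩
      have := hbij.injOn h1 h2 ((hw _ h1).trans (hw _ h2).symm)
      have h3 := congrArg re this
      simp at h3
      linarith
    · exact h
  have hin : ∀ {ζ}, ζ ∈ roundAnnulus R ↔ 1 < ‖ζ‖ ∧ ‖ζ‖ < R := Iff.rfl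
  set X : ℝ → ℝ → Set ℂ := fun p q => φ '' {ζ | p < ‖ζ‖ ∧ ‖ζ‖ < q} with hX
  set Y : ℝ → ℝ → Set ℂ := fun p q => φ '' {ζ | p ≤ ‖ζ‖ ∧ ‖ζ‖ ≤ q} with hY
  have hXo : ∀ p q, 1 ≤ p → q ≤ R → IsOpen (X p q) := fun p q hp hq =>
    hopen _ (fun ζ hζ => ⟨hp.trans_lt hζ.1, hζ.2.trans_le hq⟩)
      ((isOpen_lt continuous_const continuous_norm).inter
        (isOpen_lt continuous_norm continuous_const))
  have hXc : ∀ p q, 1 ≤ p → q ≤ R → IsPreconnected (X p q) := fun p q hp hq =>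
    (isPreconnected_annulus (by linarith)).image _
      (hφ.continuousOn.mono fun ζ hζ => ⟨hp.trans_lt hζ.1, hζ.2.trans_le hq⟩)
  have hYk : ∀ p q, 1 < p → q < R → IsCompact (Y p q) := fun p q hp hq => by
    refine IsCompact.image_of_continuousOn ?_
      (hφ.continuousOn.mono fun ζ hζ => ⟨hp.trans_le hζ.1, hζ.2.trans_lt hq⟩)
    refine (isCompact_closedBall (0 : ℂ) q).of_isClosed_subset
      ((isClosed_le continuous_const continuous_norm).inter
        (isClosed_le continuous_norm continuous_const)) fun ζ hζ => ?_
    exact mem_closedBall_zero_iff.2 hζ.2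
  have hXA : ∀ p q, 1 ≤ p → q ≤ R → X p q ⊆ W \ K := by
    rintro p q hp hq _ ⟨ζ, hζ, rfl⟩
    exact hbij.mapsTo ⟨hp.trans_lt hζ.1, hζ.2.trans_le hq⟩
  have hYA : ∀ p q, 1 < p → q < R → Y p q ⊆ W \ K := by
    rintro p q hp hq _ ⟨ζ, hζ, rfl⟩
    exact hbij.mapsTo ⟨hp.trans_le hζ.1, hζ.2.trans_lt hq⟩
  -- The frontier of a compact neighbourhood `L` of `K` is compact in the annulus, hence inside a
  -- smaller one; the two end annuli then miss it.
  obtain ⟨L, hL, hKL, hLW⟩ := exists_compact_between hK hW hKW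
  have hfr : IsCompact (frontier L) := hL.of_isClosed_subset isClosed_frontier
    hL.isClosed.frontier_subset
  have hfrA : frontier L ⊆ W \ K := fun z hz =>
    ⟨hLW (hL.isClosed.frontier_subset hz), fun h => hz.2 (hKL h)⟩
  obtain ⟨ε, hε0, hε1, hε2, hεL⟩ : ∃ ε > 0, 1 + ε < ρ ∧ ρ < R - ε ∧
      frontier L ⊆ X (1 + ε) (R - ε) := by
    obtain ⟨⟨ε, hε⟩, hε'⟩ := hfr.elim_directed_cover
      (fun ε : {ε : ℝ // 0 < ε} => X (1 + ε) (R - ε))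
      (fun ε => hXo _ _ (by linarith [ε.2]) (by linarith [ε.2])) (fun z hz => by
        obtain ⟨ζ, hζ, rfl⟩ := hbij.surjOn (hfrA hz)
        rw [hin] at hζ
        refine mem_iUnion.2 ⟨⟨min (‖ζ‖ - 1) (R - ‖ζ‖) / 2,
          half_pos (lt_min (by linarith) (by linarith))⟩, ζ, ⟨?_, ?_⟩, rfl⟩
        · have := min_le_left (‖ζ‖ - 1) (R - ‖ζ‖)
          simp only
          linarith
        · have := min_le_right (‖ζ‖ - 1) (R - ‖ζ‖)
          simp only
          linarith) (by
        rintro ⟨ε, hε⟩ ⟨ε', hε'⟩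
        refine ⟨⟨min ε ε', lt_min hε hε'⟩, ?_, ?_⟩
        · refine image_mono fun ζ hζ => ⟨?_, ?_⟩
          · exact (add_le_add_right (min_le_left ε ε') 1).trans_lt hζ.1
          · exact hζ.2.trans_le (sub_le_sub_left (min_le_left ε ε') R)
        · refine image_mono fun ζ hζ => ⟨?_, ?_⟩
          · exact (add_le_add_right (min_le_right ε ε') 1).trans_lt hζ.1
          · exact hζ.2.trans_le (sub_le_sub_left (min_le_right ε ε') R))
    set ε₁ := min ε (min (ρ - 1) (R - ρ) / 2) with hε₁
    have h1 : ε₁ ≤ ε := min_le_left _ _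
    have h2 : ε₁ ≤ min (ρ - 1) (R - ρ) / 2 := min_le_right _ _
    have h3 : min (ρ - 1) (R - ρ) ≤ ρ - 1 := min_le_left _ _
    have h4 : min (ρ - 1) (R - ρ) ≤ R - ρ := min_le_right _ _
    refine ⟨ε₁, lt_min hε (half_pos (lt_min (by linarith) (by linarith))), by linarith,
      by linarith, hε'.trans (image_mono fun ζ hζ => ⟨?_, ?_⟩)⟩
    · exact (add_le_add_right h1 1).trans_lt hζ.1
    · exact hζ.2.trans_le (sub_le_sub_left h1 R)
  have hdisj : ∀ s t : Set ℂ, s ⊆ roundAnnulus R → t ⊆ roundAnnulus R → (∀ ζ ∈ s, ζ ∉ t) →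
      Disjoint (φ '' s) (φ '' t) := by
    rintro s t hs ht hst
    rw [disjoint_left]
    rintro _ ⟨ζ, hζ, rfl⟩ ⟨ξ, hξ, h⟩
    exact hst ζ hζ (hbij.injOn (ht hξ) (hs hζ) h ▸ hξ)
  set a := 1 + ε with ha
  set b := R - ε with hb
  have hE₁ := (hXc 1 a le_rfl (by linarith)).subset_interior_or_disjoint hL.isClosed
    ((hdisj _ {ζ | a < ‖ζ‖ ∧ ‖ζ‖ < b} (fun ζ hζ => ⟨hζ.1, by linarith [hζ.2]⟩)
      (fun ζ hζ => ⟨by linarith [hζ.1], by linarith [hζ.2]⟩)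
      (fun ζ hζ hζ' => by linarith [hζ.2, hζ'.1])).mono_right hεL)
  have hE₂ := (hXc b R (by linarith) le_rfl).subset_interior_or_disjoint hL.isClosed
    ((hdisj _ {ζ | a < ‖ζ‖ ∧ ‖ζ‖ < b} (fun ζ hζ => ⟨by linarith [hζ.1], hζ.2⟩)
      (fun ζ hζ => ⟨by linarith [hζ.1], by linarith [hζ.2]⟩)
      (fun ζ hζ hζ' => by linarith [hζ.1, hζ'.2])).mono_right hεL)
  have hΓ : φ '' sphere 0 ρ = Y ρ ρ := by
    refine congrArg (φ '' ·) ?_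
    ext ζ
    simp only [mem_sphere_zero_iff_norm, mem_ofPred_eq]
    exact ⟨fun h => ⟨h.ge, h.le⟩, fun h => le_antisymm h.2 h.1⟩
  have hcover : ∀ z ∈ W, z ∉ K → z ∈ X 1 a ∨ z ∈ Y a b ∨ z ∈ X b R := by
    intro z hz hzK
    obtain ⟨ζ, hζ, rfl⟩ := hbij.surjOn ⟨hz, hzK⟩
    rw [hin] at hζ
    rcases lt_or_ge ‖ζ‖ a with h | h
    · exact Or.inl ⟨ζ, ⟨hζ.1, h⟩, rfl⟩
    rcases lt_or_ge b ‖ζ‖ with h' | h'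
    · exact Or.inr (Or.inr ⟨ζ, ⟨h', hζ.2⟩, rfl⟩)
    · exact Or.inr (Or.inl ⟨ζ, ⟨h, h'⟩, rfl⟩)
  have hYab := hYk a b (by linarith) (by linarith)
  have hd12 : Disjoint (X 1 ρ) (X ρ R) := hdisj _ _ (fun ζ hζ => ⟨hζ.1, by linarith [hζ.2]⟩)
    (fun ζ hζ => ⟨by linarith [hζ.1], hζ.2⟩) (fun ζ hζ hζ' => by linarith [hζ.2, hζ'.1])
  have hsplit : W \ K = X 1 ρ ∪ Y ρ ρ ∪ X ρ R := by
    refine Subset.antisymm ?_ (union_subset (union_subset (hXA _ _ le_rfl hρR.le)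
      (hYA _ _ hρ1 hρR)) (hXA _ _ hρ1.le le_rfl))
    intro z hz
    obtain ⟨ζ, hζ, rfl⟩ := hbij.surjOn hz
    rcases lt_trichotomy ‖ζ‖ ρ with h | h | h
    · exact Or.inl (Or.inl ⟨ζ, ⟨hζ.1, h⟩, rfl⟩)
    · exact Or.inl (Or.inr ⟨ζ, ⟨h.ge, h.le⟩, rfl⟩)
    · exact Or.inr ⟨ζ, ⟨h, hζ.2⟩, rfl⟩
  have hX1 : X 1 ρ ⊆ X 1 a ∪ Y a ρ := by
    rintro _ ⟨ζ, hζ, rfl⟩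
    rcases lt_or_ge ‖ζ‖ a with h | h
    · exact Or.inl ⟨ζ, ⟨hζ.1, h⟩, rfl⟩
    · exact Or.inr ⟨ζ, ⟨h, hζ.2.le⟩, rfl⟩
  have hX2 : X ρ R ⊆ X b R ∪ Y ρ b := by
    rintro _ ⟨ζ, hζ, rfl⟩
    rcases lt_or_ge b ‖ζ‖ with h | h
    · exact Or.inl ⟨ζ, ⟨h, hζ.2⟩, rfl⟩
    · exact Or.inr ⟨ζ, ⟨hζ.1.le, h⟩, rfl⟩
  have hYa : Y a ρ ⊆ X 1 ρ ∪ Y ρ ρ := by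
    rintro _ ⟨ζ, hζ, rfl⟩
    rcases hζ.2.lt_or_eq with h | h
    · exact Or.inl ⟨ζ, ⟨by linarith [hζ.1], h⟩, rfl⟩
    · exact Or.inr ⟨ζ, ⟨h.ge, h.le⟩, rfl⟩
  have hYb : Y ρ b ⊆ X ρ R ∪ Y ρ ρ := by
    rintro _ ⟨ζ, hζ, rfl⟩
    rcases hζ.1.lt_or_eq with h | h
    · exact Or.inl ⟨ζ, ⟨h, by linarith [hζ.2]⟩, rfl⟩
    · exact Or.inr ⟨ζ, ⟨h.le, h.ge⟩, rfl⟩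
  have hYaW := (hYA a ρ (by linarith) hρR).trans sdiff_subset
  have hYbW := (hYA ρ b hρ1 (by linarith)).trans sdiff_subset
  rw [hΓ]
  -- Nothing says which end of the annulus faces `K`. Both ends inside `L` would make `W` compact,
  -- both outside would make `K` open; the mixed cases are symmetric.
  rcases hE₁ with h1 | h1 <;> rcases hE₂ with h2 | h2
  · exfalso
    have : W = L ∪ Y a b := by
      refine Subset.antisymm (fun z hz => ?_) (union_subset hLW
        ((hYA _ _ (by linarith) (by linarith)).trans sdiff_subset))
      by_cases hzK : z ∈ K
      · exact Or.inl (interior_subset (hKL hzK))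
      rcases hcover z hz hzK with h | h | h
      · exact Or.inl (interior_subset (h1 h))
      · exact Or.inr h
      · exact Or.inl (interior_subset (h2 h))
    have hWk : IsCompact W := this ▸ hL.union hYab
    exact (hKn.mono hKW).ne_empty (hWk.eq_empty_of_isOpen_complex hW)
  · refine ⟨K ∪ X 1 ρ, ?_⟩
    obtain ⟨k1, k2, k3, k4⟩ := closure_frontier_fill hL hLW hKL (hXo 1 ρ le_rfl hρR.le)
      (hXo ρ R hρ1.le le_rfl) (hYk ρ ρ hρ1 hρR) hsplit hd12
      (hYk a ρ (by linarith) hρR) hYaW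
      (hX1.trans (union_subset_union_left _ (h1.trans interior_subset)))
      (hYk ρ b hρ1 (by linarith)) hYb h2 hX2
    exact ⟨k1, k2, subset_union_left, k3, k4⟩
  · refine ⟨K ∪ X ρ R, ?_⟩
    obtain ⟨k1, k2, k3, k4⟩ := closure_frontier_fill hL hLW hKL (hXo ρ R hρ1.le le_rfl)
      (hXo 1 ρ le_rfl hρR.le) (hYk ρ ρ hρ1 hρR)
      (by rw [hsplit, union_right_comm, union_comm (X 1 ρ), union_right_comm]) hd12.symm
      (hYk ρ b hρ1 (by linarith)) hYbW
      (hX2.trans (union_subset_union_left _ (h2.trans interior_subset)))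
      (hYk a ρ (by linarith) hρR) hYa h1 hX1
    exact ⟨k1, k2, subset_union_left, k3, k4⟩
  · exfalso
    have : K = interior L \ Y a b := by
      refine Subset.antisymm (fun z hz => ⟨hKL hz, fun h =>
        (hYA _ _ (by linarith) (by linarith) h).2 hz⟩) ?_
      rintro z ⟨hz, hn⟩
      by_contra hzK
      have hzL := interior_subset hz
      rcases hcover z (hLW hzL) hzK with h | h | h
      · exact disjoint_left.1 h1 h hzL
      · exact hn h
      · exact disjoint_left.1 h2 h hzL
    have hKo : IsOpen K := this ▸ isOpen_interior.sdiff hYab.isClosed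
    exact hKn.ne_empty (hK.eq_empty_of_isOpen_complex hKo)

/-- The estimate at half the radius, rescaled: `3 = (1 + 1/2) / (1 - 1/2)`. -/
theorem harnack_ball {h : ℂ → ℂ} {c : ℂ} {r : ℝ} (hr : 0 < r)
    (hh : DifferentiableOn ℂ h (ball c r)) (hpos : ∀ z ∈ ball c r, 0 < (h z).re) {z : ℂ}
    (hz : dist z c ≤ r / 2) : (h z).re ≤ 3 * (h c).re := by
  have hm : MapsTo (fun ζ : ℂ => c + r * ζ) (ball 0 1) (ball c r) := by
    intro ζ hζ
    rw [mem_ball_zero_iff] at hζ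
    rw [mem_ball, dist_eq_norm, add_sub_cancel_left, norm_mul, norm_real, Real.norm_eq_abs,
      abs_of_pos hr]
    nlinarith
  have hrc : (r : ℂ) ≠ 0 := ofReal_ne_zero.2 hr.ne'
  have h1 := harnack_center (h := fun ζ => h (c + r * ζ)) (hh.comp (by fun_prop) hm)
    (fun ζ hζ => hpos _ (hm hζ)) (q := 1 / 2) (by norm_num) (z := (z - c) / r) (by
      rw [norm_div, norm_real, Real.norm_eq_abs, abs_of_pos hr, ← dist_eq_norm, div_le_iff₀ hr]
      linarith)
  rw [mul_div_cancel₀ _ hrc, add_sub_cancel, mul_zero, add_zero] at h1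
  norm_num at h1
  exact h1

/-- Harnack's inequality along a vertical line in the middle of a strip. -/
theorem harnack_vertical {H : ℂ → ℂ} {σ : ℝ} (hσ : 0 < σ)
    (hH : DifferentiableOn ℂ H (re ⁻¹' Ioo 0 (2 * σ)))
    (hpos : ∀ s ∈ re ⁻¹' Ioo 0 (2 * σ), 0 < (H s).re) (n : ℕ) :
    ∀ t t' : ℝ, |t - t'| ≤ n * (σ / 2) →
      (H (σ + t * I)).re ≤ 3 ^ n * (H (σ + t' * I)).re := by
  induction n with
  | zero =>
    intro t t' h
    simp only [Nat.cast_zero, zero_mul] at h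
    rw [sub_eq_zero.1 (abs_eq_zero.1 (le_antisymm h (abs_nonneg _)))]
    simp
  | succ n ih =>
    intro t t' h
    -- Cuts off the last of `n + 1` equal parts of the way from `t'` to `t`.
    set u := t' + (t - t') * (n / (n + 1)) with hu
    have hn : (0 : ℝ) < n + 1 := by positivity
    push_cast at h
    have hut' : |u - t'| ≤ n * (σ / 2) := by
      rw [hu, add_sub_cancel_left, abs_mul, abs_of_nonneg (by positivity : (0 : ℝ) ≤ n / (n + 1)),
        mul_div_assoc', div_le_iff₀ hn]
      nlinarith [(Nat.cast_nonneg n : (0 : ℝ) ≤ n)]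
    have htu : |t - u| ≤ σ / 2 := by
      have : t - u = (t - t') * (1 / (n + 1)) := by rw [hu]; field_simp; ring
      rw [this, abs_mul, abs_of_pos (by positivity : (0 : ℝ) < 1 / (n + 1)), mul_one_div,
        div_le_iff₀ hn]
      linarith
    have hb : ball ((σ : ℂ) + u * I) σ ⊆ re ⁻¹' Ioo 0 (2 * σ) := by
      intro s hs
      rw [mem_ball, dist_eq_norm] at hs
      have h1 := (abs_re_le_norm (s - (σ + u * I))).trans_lt hs
      simp only [sub_re, add_re, ofReal_re, mul_re, I_re, mul_zero, ofReal_im, I_im, mul_one,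
        sub_self, add_zero] at h1
      rw [abs_lt] at h1
      exact ⟨by linarith [h1.1], by linarith [h1.2]⟩
    have h3 := harnack_ball hσ (hH.mono hb) (fun s hs => hpos s (hb hs)) (z := σ + t * I) (by
      rw [dist_eq_norm, add_sub_add_left_eq_sub, ← sub_mul, norm_mul, norm_I, mul_one,
        ← ofReal_sub, norm_real]
      exact htu)
    calc (H (σ + t * I)).re ≤ 3 * (H (σ + u * I)).re := h3
      _ ≤ 3 * (3 ^ n * (H (σ + t' * I)).re) := by linarith [ih u t' hut']
      _ = 3 ^ (n + 1) * (H (σ + t' * I)).re := by ring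

/-- A set surrounded by an annulus of definite modulus satisfies Harnack's inequality with a
constant depending on the modulus only. -/
theorem HasModulus.exists_harnackOn {δ : ℝ} (hδ : 0 < δ) : ∃ A : ℝ, 1 ≤ A ∧
    ∀ (W U : Set ℂ) (m : ℝ), IsOpen W → U.Nonempty → IsCompact (closure U) → closure U ⊆ W →
      δ ≤ m → HasModulus (W \ closure U) m → HarnackOn W U A := by
  -- `n` steps of length `σ / 2 ≥ πδ / 2` cover a full turn `2π`.
  obtain ⟨n, hn⟩ := exists_nat_ge (4 / δ)
  refine ⟨3 ^ n, one_le_pow₀ (by norm_num), ?_⟩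
  rintro W U m hW hUn hUk hUW hm ⟨R, hR, hmR, φ, hφ, hbij⟩ h hh hpos
  have hA0 : (0 : ℝ) < 3 ^ n := by positivity
  obtain ⟨C, hCo, hCb, hUC, hCW, hfr⟩ := exists_fill hW hUk hUn.closure hUW hR hφ hbij
  set σ := Real.log R / 2 with hσ
  have hσδ : Real.pi * δ ≤ σ := by
    rw [hmR, le_div_iff₀ (by positivity)] at hm
    linarith
  have hσ0 : 0 < σ := (mul_pos Real.pi_pos hδ).trans_le hσδ
  have hR0 : 0 < R := one_pos.trans hR
  have hexp : MapsTo Complex.exp (re ⁻¹' Ioo 0 (2 * σ)) (roundAnnulus R) := by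
    rintro s ⟨h1, h2⟩
    have h3 : 2 * σ = Real.log R := by rw [hσ]; ring
    rw [h3] at h2
    refine ⟨?_, ?_⟩
    · rw [Complex.norm_exp]
      exact Real.one_lt_exp_iff.2 h1
    · rw [Complex.norm_exp]
      exact (Real.lt_log_iff_exp_lt hR0).1 h2
  have hmW : MapsTo φ (roundAnnulus R) W := fun ζ hζ => (hbij.mapsTo hζ).1
  -- The exponential unrolls the annulus to a strip of width `2σ`, with the circle of radius `√R` as
  -- its middle line.
  have hline := harnack_vertical (H := fun s => h (φ (Complex.exp s))) hσ0
    (hh.comp (hφ.comp Complex.differentiable_exp.differentiableOn hexp) (hmW.comp hexp))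
    (fun s hs => hpos _ (hmW (hexp hs))) n
  have hsph : ∀ ζ ∈ sphere (0 : ℂ) (√R), ζ = Complex.exp (σ + (arg ζ : ℂ) * I) := by
    intro ζ hζ
    rw [mem_sphere_zero_iff_norm] at hζ
    have h0 : ζ ≠ 0 := norm_pos_iff.1 (hζ ▸ Real.sqrt_pos.2 hR0)
    have : (σ : ℂ) + (arg ζ : ℂ) * I = Complex.log ζ := by
      rw [Complex.log, hζ, Real.log_sqrt hR0.le]
    rw [this, Complex.exp_log h0]
  have hΓ : ∀ p ∈ φ '' sphere 0 (√R), ∀ q ∈ φ '' sphere 0 (√R),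
      (h p).re ≤ 3 ^ n * (h q).re := by
    rintro _ ⟨ζ, hζ, rfl⟩ _ ⟨ξ, hξ, rfl⟩
    rw [hsph ζ hζ, hsph ξ hξ]
    refine hline _ _ ?_
    have h1 : |arg ζ - arg ξ| ≤ 2 * Real.pi := by
      rw [abs_le]
      constructor <;> linarith [arg_le_pi ζ, neg_pi_lt_arg ζ, arg_le_pi ξ, neg_pi_lt_arg ξ]
    refine h1.trans ?_
    rw [div_le_iff₀ hδ] at hn
    have : (n : ℝ) * (Real.pi * δ) ≤ n * σ := mul_le_mul_of_nonneg_left hσδ (Nat.cast_nonneg n)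
    nlinarith [Real.pi_pos]
  have hd : DiffContOnCl ℂ h C := (hh.mono hCW).diffContOnCl
  -- Maximum principle for `exp h` on the filled set. Fed into the one for `exp (-h)` below, it
  -- compares two points of `U` at the cost of a single factor `3 ^ n`.
  have hmax : ∀ q ∈ φ '' sphere 0 (√R), ∀ z ∈ C, (h z).re ≤ 3 ^ n * (h q).re := by
    intro q hq z hz
    have := Complex.norm_le_of_forall_mem_frontier_norm_le hCb
      (Complex.differentiable_exp.comp_diffContOnCl hd)
      (C := Real.exp (3 ^ n * (h q).re)) (fun p hp => by
        rw [Function.comp_apply, Complex.norm_exp]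
        exact Real.exp_le_exp.2 (hΓ p (hfr hp) q hq)) (subset_closure hz)
    rw [Function.comp_apply, Complex.norm_exp] at this
    exact Real.exp_le_exp.1 this
  intro z hz w hw
  have hzC := hUC (subset_closure hz)
  have hwC := hUC (subset_closure hw)
  have := Complex.norm_le_of_forall_mem_frontier_norm_le hCb
    (Complex.differentiable_exp.comp_diffContOnCl hd.neg)
    (C := Real.exp (-((h z).re / 3 ^ n))) (fun p hp => by
      rw [Function.comp_apply, Complex.norm_exp]
      refine Real.exp_le_exp.2 ?_
      rw [Pi.neg_apply, neg_re, neg_le_neg_iff, div_le_iff₀ hA0, mul_comm]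
      exact hmax p (hfr hp) z hzC) (subset_closure hwC)
  rw [Function.comp_apply, Complex.norm_exp, Pi.neg_apply, neg_re] at this
  have := Real.exp_le_exp.1 this
  rwa [neg_le_neg_iff, div_le_iff₀ hA0, mul_comm] at this

/-! ### Puzzle pieces and the degree of iterates on them. -/

/-- The points of `V` whose first `m` iterates stay in `U`. -/
def orbitDomain (F : ℂ → ℂ) (U V : Set ℂ) (m : ℕ) : Set ℂ :=
  {z ∈ V | ∀ i < m, F^[i] z ∈ U}

/-- The puzzle piece of depth `m` containing `z`. -/
def piece (F : ℂ → ℂ) (U V : Set ℂ) (m : ℕ) (z : ℂ) : Set ℂ :=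
  connectedComponentIn (orbitDomain F U V m) z

theorem IsProperMap.properOn {F : ℂ → ℂ} {D : Set ℂ}
    (h : IsProperMap ((mapsTo_image F D).restrict F D (F '' D))) : ProperOn F D (F '' D) := by
  refine ⟨mapsTo_image F D, fun K hK hKc => ?_⟩
  have hK' : IsCompact ((↑) ⁻¹' K : Set (F '' D)) := by
    rw [Subtype.isCompact_iff, Subtype.image_preimage_coe, inter_eq_right.2 hK]
    exact hKc
  have h1 := (h.isCompact_preimage hK').image continuous_subtype_val
  convert h1 using 1
  ext z
  constructor
  · rintro ⟨hz, hzK⟩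
    exact ⟨⟨z, hz⟩, hzK, rfl⟩
  · rintro ⟨y, hy, rfl⟩
    exact ⟨y.2, hy⟩

section

variable {F : ℂ → ℂ} {U V : Set ℂ}

theorem orbitDomain_zero : orbitDomain F U V 0 = V := by
  ext z
  simp [orbitDomain]

theorem orbitDomain_anti {m n : ℕ} (h : m ≤ n) : orbitDomain F U V n ⊆ orbitDomain F U V m :=
  fun _ hz => ⟨hz.1, fun i hi => hz.2 i (hi.trans_le h)⟩

theorem piece_anti {m n : ℕ} (h : m ≤ n) (z : ℂ) : piece F U V n z ⊆ piece F U V m z :=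
  connectedComponentIn_mono z (orbitDomain_anti h)

theorem piece_subset (m : ℕ) (z : ℂ) : piece F U V m z ⊆ orbitDomain F U V m :=
  connectedComponentIn_subset _ _

theorem mem_piece {m : ℕ} {z : ℂ} (hz : z ∈ orbitDomain F U V m) : z ∈ piece F U V m z :=
  mem_connectedComponentIn hz

theorem piece_eq {m : ℕ} {z w : ℂ} (h : w ∈ piece F U V m z) : piece F U V m z = piece F U V m w :=
  connectedComponentIn_eq h

theorem piece_zero (z : ℂ) : piece F U V 0 z = connectedComponentIn V z := by
  rw [piece, orbitDomain_zero]

theorem isConnected_piece {m : ℕ} {z : ℂ} (hz : z ∈ orbitDomain F U V m) :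
    IsConnected (piece F U V m z) :=
  isConnected_connectedComponentIn_iff.2 hz

namespace IsComplexBoxMapping

variable (hF : IsComplexBoxMapping F U V)
include hF

theorem orbitDomain_succ (m : ℕ) :
    orbitDomain F U V (m + 1) = U ∩ F ⁻¹' orbitDomain F U V m := by
  ext z
  constructor
  · intro h
    have hz : z ∈ U := h.2 0 (Nat.succ_pos m)
    exact ⟨hz, hF.mapsTo hz, fun i hi => h.2 (i + 1) (Nat.succ_lt_succ hi)⟩
  · rintro ⟨hz, h1, h2⟩
    refine ⟨hF.dom_subset hz, fun i hi => ?_⟩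
    rcases i with _ | i
    · exact hz
    · exact h2 i (Nat.lt_of_succ_lt_succ hi)

theorem orbitDomain_one : orbitDomain F U V 1 = U := by
  rw [hF.orbitDomain_succ, orbitDomain_zero, inter_eq_left]
  exact hF.mapsTo

theorem piece_one (z : ℂ) : piece F U V 1 z = connectedComponentIn U z := by
  rw [piece, hF.orbitDomain_one]

theorem isOpen_orbitDomain (m : ℕ) : IsOpen (orbitDomain F U V m) := by
  induction m with
  | zero => rw [orbitDomain_zero]; exact hF.isOpen_range
  | succ m ih =>
    rw [hF.orbitDomain_succ]
    exact hF.holomorphic.continuousOn.isOpen_inter_preimage hF.isOpen_dom ih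

theorem isOpen_piece (m : ℕ) (z : ℂ) : IsOpen (piece F U V m z) :=
  (hF.isOpen_orbitDomain m).connectedComponentIn

theorem iterate_mem_orbitDomain {m j : ℕ} {z : ℂ} (hz : z ∈ orbitDomain F U V (m + j)) :
    F^[j] z ∈ orbitDomain F U V m := by
  induction j generalizing z with
  | zero => exact hz
  | succ j ih =>
    rw [← add_assoc, hF.orbitDomain_succ] at hz
    exact ih hz.2

theorem image_component_eq {z : ℂ} (hz : z ∈ U) :
    F '' connectedComponentIn U z = connectedComponentIn V (F z) := by
  obtain ⟨y, hy, h⟩ := hF.image_component _ ⟨z, hz, rfl⟩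
  rw [h]
  exact connectedComponentIn_eq (h ▸ mem_image_of_mem F (mem_connectedComponentIn hz))

theorem properOn_component {z : ℂ} (hz : z ∈ U) :
    ProperOn F (connectedComponentIn U z) (connectedComponentIn V (F z)) := by
  rw [← hF.image_component_eq hz]
  exact (hF.proper_component _ ⟨z, hz, rfl⟩).properOn

theorem isJordanDisk_range {z : ℂ} (hz : z ∈ V) : IsJordanDisk (connectedComponentIn V z) :=
  hF.jordan_range _ ⟨z, hz, rfl⟩

theorem dom_component_cases {z : ℂ} (hz : z ∈ U) :
    connectedComponentIn U z = connectedComponentIn V z ∨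
      (IsJordanDisk (connectedComponentIn U z) ∧
        closure (connectedComponentIn U z) ⊆ connectedComponentIn V z) := by
  have hzV := mem_connectedComponentIn (hF.dom_subset hz)
  rcases hF.component_range _ ⟨z, hF.dom_subset hz, rfl⟩ with ⟨y, hy, h⟩ | ⟨h, -⟩
  · left
    rw [h] at hzV ⊢
    exact (connectedComponentIn_eq hzV).symm
  · exact Or.inr (h _ ⟨z, hz, rfl⟩ (connectedComponentIn_mono z hF.dom_subset))

theorem isJordanDisk_dom {z : ℂ} (hz : z ∈ U) : IsJordanDisk (connectedComponentIn U z) := by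
  rcases hF.dom_component_cases hz with h | h
  · rw [h]
    exact hF.isJordanDisk_range (hF.dom_subset hz)
  · exact h.1

/-- A connected set of points surviving `m + 1` steps lies in one component of `U` and over one
piece of depth `m`. In this recursive form properness and absence of holes are pulled back. -/
theorem piece_succ {m : ℕ} {z : ℂ} (hz : z ∈ orbitDomain F U V (m + 1)) :
    piece F U V (m + 1) z =
      connectedComponentIn (connectedComponentIn U z ∩ F ⁻¹' piece F U V m (F z)) z := by
  have hsub := piece_subset (F := F) (U := U) (V := V) (m + 1) z
  rw [hF.orbitDomain_succ] at hsub
  have hzU : z ∈ U := by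
    rw [hF.orbitDomain_succ] at hz
    exact hz.1
  have hpre : IsPreconnected (piece F U V (m + 1) z) := isPreconnected_connectedComponentIn
  apply Subset.antisymm
  · refine hpre.subset_connectedComponentIn (mem_piece hz) (subset_inter ?_ ?_)
    · exact hpre.subset_connectedComponentIn (mem_piece hz) (hsub.trans inter_subset_left)
    · rw [← image_subset_iff]
      refine IsPreconnected.subset_connectedComponentIn
        (hpre.image F (hF.holomorphic.continuousOn.mono (hsub.trans inter_subset_left)))
        (mem_image_of_mem F (mem_piece hz)) ?_
      rw [image_subset_iff]
      exact hsub.trans inter_subset_right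
  · refine connectedComponentIn_mono z ?_
    rw [hF.orbitDomain_succ]
    exact inter_subset_inter (connectedComponentIn_subset _ _) (preimage_mono (piece_subset _ _))

theorem properOn_piece_succ {m : ℕ} {z : ℂ} (hz : z ∈ orbitDomain F U V (m + 1)) :
    ProperOn F (piece F U V (m + 1) z) (piece F U V m (F z)) := by
  rw [hF.piece_succ hz]
  rw [hF.orbitDomain_succ] at hz
  refine (hF.properOn_component hz.1).restrict_component ?_ z
  rw [← piece_zero (F := F) (U := U)]
  exact piece_anti (Nat.zero_le m) _

/-- Components of `V` are simply connected, and each further depth takes a component of a preimage.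
-/
theorem chainFull_piece {m : ℕ} {z : ℂ} (hz : z ∈ orbitDomain F U V m) :
    ChainFull (piece F U V m z) := by
  induction m generalizing z with
  | zero =>
    rw [orbitDomain_zero] at hz
    rw [piece_zero]
    have h := hF.isJordanDisk_range hz
    exact chainFull_of_simplyConnectedSpace h.1 h.2.1
  | succ m ih =>
    rw [hF.piece_succ hz]
    rw [hF.orbitDomain_succ] at hz
    have h := hF.isJordanDisk_dom hz.1
    exact ChainFull.connectedComponentIn_preimage h.1
      (chainFull_of_simplyConnectedSpace h.1 h.2.1)
      (hF.holomorphic.mono (connectedComponentIn_subset _ _)) (hF.isOpen_piece _ _) (ih hz.2) z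

theorem isBounded_range : Bornology.IsBounded V := by
  have h : V ⊆ ⋃₀ {W | IsComponentOf W V} := fun z hz =>
    ⟨_, ⟨z, hz, rfl⟩, mem_connectedComponentIn hz⟩
  exact ((Bornology.isBounded_sUnion hF.finite_range).2
    fun W hW => (hF.jordan_range W hW).2.2.1).subset h

theorem isBounded_piece (m : ℕ) (z : ℂ) : Bornology.IsBounded (piece F U V m z) :=
  hF.isBounded_range.subset fun _ hw => (piece_subset m z hw).1

theorem properOn_iterate_piece {m j : ℕ} {z : ℂ} (hz : z ∈ orbitDomain F U V (m + j)) :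
    ProperOn F^[j] (piece F U V (m + j) z) (piece F U V m (F^[j] z)) := by
  induction j generalizing z with
  | zero => exact properOn_id _
  | succ j ih =>
    rw [← add_assoc] at hz ⊢
    have h := hF.properOn_piece_succ hz
    rw [hF.orbitDomain_succ] at hz
    exact (ih hz.2).comp h

theorem differentiableOn_iterate (m : ℕ) : DifferentiableOn ℂ F^[m] (orbitDomain F U V m) := by
  induction m with
  | zero => exact differentiableOn_id
  | succ m ih =>
    rw [hF.orbitDomain_succ]
    exact ih.comp (hF.holomorphic.mono inter_subset_left) (fun z hz => hz.2)

theorem deriv_iterate_ne_zero {m : ℕ} {z : ℂ} (hz : z ∈ orbitDomain F U V m)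
    (h : ∀ i < m, F^[i] z ∉ critSet F U) : deriv F^[m] z ≠ 0 := by
  induction m generalizing z with
  | zero => simp
  | succ m ih =>
    have hz' := hz
    rw [hF.orbitDomain_succ] at hz'
    have h1 := ((hF.differentiableOn_iterate m).differentiableAt
      ((hF.isOpen_orbitDomain m).mem_nhds hz'.2)).hasDerivAt
    have h2 := (hF.holomorphic.differentiableAt (hF.isOpen_dom.mem_nhds hz'.1)).hasDerivAt
    rw [Function.iterate_succ, (h1.comp z h2).deriv]
    refine mul_ne_zero (ih hz'.2 fun i hi => ?_) fun h0 => h 0 (Nat.succ_pos m) ⟨hz'.1, h0⟩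
    have := h (i + 1) (Nat.succ_lt_succ hi)
    rwa [Function.iterate_succ_apply] at this

/-- The fibres of `F` on the components of `U` containing critical points are uniformly bounded. -/
theorem exists_ncard_fiber_le : ∃ d : ℕ, 1 ≤ d ∧ ∀ z ∈ U,
    (connectedComponentIn U z ∩ critSet F U).Nonempty → ∀ w,
      (connectedComponentIn U z ∩ F ⁻¹' {w}).Finite ∧
        (connectedComponentIn U z ∩ F ⁻¹' {w}).ncard ≤ d := by
  have hone : ∀ z ∈ U, ∃ d : ℕ, ∀ w,
      (connectedComponentIn U z ∩ F ⁻¹' {w}).Finite ∧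
        (connectedComponentIn U z ∩ F ⁻¹' {w}).ncard ≤ d := by
    intro z hz
    have hD := hF.isJordanDisk_dom hz
    have hV := hF.isJordanDisk_range (hF.mapsTo hz)
    have hFp := hF.properOn_component hz
    obtain ⟨f, g, hf, hg, hfm, hgm, hgf, hfg, -⟩ := exists_riemann_map hD.1
      (isConnected_connectedComponentIn_iff.2 hz) hD.2.2.1
      (chainFull_of_simplyConnectedSpace hD.1 hD.2.1) (mem_connectedComponentIn hz)
    obtain ⟨f', g', hf', hg', hfm', hgm', hgf', hfg', -⟩ := exists_riemann_map hV.1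
      (isConnected_connectedComponentIn_iff.2 (hF.mapsTo hz)) hV.2.2.1
      (chainFull_of_simplyConnectedSpace hV.1 hV.2.1) (mem_connectedComponentIn (hF.mapsTo hz))
    obtain ⟨N, hN⟩ := ((properOn_of_inverse hfm' hgm' hg'.continuousOn hgf' hfg').comp
      (hFp.comp (properOn_of_inverse hgm hfm hf.continuousOn hfg hgf))).exists_ncard_fiber_le
      (hf'.comp ((hF.holomorphic.mono (connectedComponentIn_subset _ _)).comp hg hgm)
        (hFp.1.comp hgm))
    refine ⟨N, fun w => ?_⟩
    by_cases hw : w ∈ connectedComponentIn V (F z)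
    · have hsub : connectedComponentIn U z ∩ F ⁻¹' {w} ⊆
          g '' (ball 0 1 ∩ (f' ∘ F ∘ g) ⁻¹' {f' w}) := by
        rintro y ⟨hy, hyw⟩
        refine ⟨f y, ⟨hfm hy, ?_⟩, hgf y hy⟩
        simp only [mem_preimage, Function.comp_apply, hgf y hy, mem_singleton_iff]
        rw [hyw]
      obtain ⟨h1, h2⟩ := hN (f' w) (hfm' hw)
      exact ⟨(h1.image g).subset hsub,
        (ncard_le_ncard hsub (h1.image g)).trans ((ncard_image_le h1).trans h2)⟩
    · have : connectedComponentIn U z ∩ F ⁻¹' {w} = ∅ := by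
        rw [eq_empty_iff_forall_notMem]
        rintro y ⟨hy, hyw⟩
        exact hw (hyw ▸ hFp.1 hy)
      rw [this]
      simp
  choose! d hd using hone
  -- A component meeting the critical set is the component of one of finitely many critical points.
  -- The `+ 1` makes powers of the bound monotone in the exponent.
  refine ⟨hF.finite_crit.toFinset.sup d + 1, Nat.le_add_left _ _, ?_⟩
  rintro z hz ⟨c, hcz, hc⟩ w
  rw [connectedComponentIn_eq hcz]
  obtain ⟨h1, h2⟩ := hd c hc.1 w
  refine ⟨h1, h2.trans (Nat.le_succ_of_le ?_)⟩
  exact Finset.le_sup (f := d) (hF.finite_crit.mem_toFinset.2 hc)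

/-- A proper map without critical points to a simply connected piece has an inverse. -/
theorem injOn_piece_succ {m : ℕ} {z : ℂ} (hz : z ∈ orbitDomain F U V (m + 1))
    (h : ¬ (piece F U V (m + 1) z ∩ critSet F U).Nonempty) :
    InjOn F (piece F U V (m + 1) z) := by
  have hz' := hz
  rw [hF.orbitDomain_succ] at hz'
  have hsub : piece F U V (m + 1) z ⊆ U := by
    refine (piece_subset _ _).trans ?_
    rw [hF.orbitDomain_succ]
    exact inter_subset_left
  obtain ⟨G, -, -, -, hG⟩ := (hF.properOn_piece_succ hz).exists_inverse (hF.isOpen_piece _ _)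
    (isConnected_piece hz) (hF.holomorphic.mono hsub)
    (fun y hy h0 => h ⟨y, hy, hsub hy, h0⟩) (hF.isOpen_piece _ _)
    (simplyConnectedSpace_of_chainFull (hF.isOpen_piece _ _) (isConnected_piece hz'.2)
      (hF.isBounded_piece _ _) (hF.chainFull_piece hz'.2))
  intro a ha b hb hab
  rw [← hG a ha, ← hG b hb, hab]

-- Degrees multiply along the orbit: a step costs a factor `d` if its piece meets the critical set,
-- and is injective otherwise. The exponent counts these encounters.
open Classical in
theorem ncard_fiber_iterate_le {d : ℕ} (hd : ∀ z ∈ U,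
    (connectedComponentIn U z ∩ critSet F U).Nonempty → ∀ w,
      (connectedComponentIn U z ∩ F ⁻¹' {w}).Finite ∧
        (connectedComponentIn U z ∩ F ⁻¹' {w}).ncard ≤ d) {j : ℕ} {z : ℂ}
    (hz : z ∈ orbitDomain F U V j) (w : ℂ) :
    (piece F U V j z ∩ F^[j] ⁻¹' {w}).Finite ∧ (piece F U V j z ∩ F^[j] ⁻¹' {w}).ncard ≤
      d ^ ∑ i ∈ Finset.range j,
        if (piece F U V (j - i) (F^[i] z) ∩ critSet F U).Nonempty then 1 else 0 := by
  induction j generalizing z with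
  | zero =>
    have : piece F U V 0 z ∩ F^[0] ⁻¹' {w} ⊆ {w} := fun y hy => hy.2
    refine ⟨(finite_singleton w).subset this, ?_⟩
    simpa using ncard_le_ncard this
  | succ j ih =>
    have hz' := hz
    rw [hF.orbitDomain_succ] at hz'
    obtain ⟨h1, h2⟩ := ih hz'.2
    rw [Finset.sum_range_succ', pow_add]
    simp only [Nat.add_sub_add_right, Function.iterate_succ_apply, Nat.sub_zero,
      Function.iterate_zero, id]
    set T := piece F U V j (F z) ∩ F^[j] ⁻¹' {w} with hT
    have hfib : piece F U V (j + 1) z ∩ F^[j + 1] ⁻¹' {w} =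
        ⋃ y ∈ h1.toFinset, (piece F U V (j + 1) z ∩ F ⁻¹' {y}) := by
      ext y
      simp only [mem_inter_iff, mem_preimage, mem_iUnion, Finite.mem_toFinset, mem_singleton_iff,
        exists_prop, Function.iterate_succ_apply]
      constructor
      · rintro ⟨h3, h4⟩
        exact ⟨F y, ⟨(hF.properOn_piece_succ hz).1 h3, h4⟩, h3, rfl⟩
      · rintro ⟨_, ⟨h3, h4⟩, h5, rfl⟩
        exact ⟨h5, h4⟩
    have hsub : piece F U V (j + 1) z ⊆ connectedComponentIn U z := by
      rw [hF.piece_succ hz]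
      exact (connectedComponentIn_subset _ _).trans inter_subset_left
    set e : ℕ := if (piece F U V (j + 1) z ∩ critSet F U).Nonempty then 1 else 0 with he
    have hstep : ∀ y, (piece F U V (j + 1) z ∩ F ⁻¹' {y}).Finite ∧
        (piece F U V (j + 1) z ∩ F ⁻¹' {y}).ncard ≤ d ^ e := by
      intro y
      by_cases hc : (piece F U V (j + 1) z ∩ critSet F U).Nonempty
      · obtain ⟨h3, h4⟩ := hd z hz'.1 (hc.mono (inter_subset_inter_left _ hsub)) y
        rw [he, if_pos hc, pow_one]
        have := inter_subset_inter_left (F ⁻¹' {y}) hsub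
        exact ⟨h3.subset this, (ncard_le_ncard this h3).trans h4⟩
      · rw [he, if_neg hc, pow_zero]
        have hss : (piece F U V (j + 1) z ∩ F ⁻¹' {y}).Subsingleton := fun a ha b hb =>
          hF.injOn_piece_succ hz hc ha.1 hb.1 (ha.2.trans hb.2.symm)
        exact ⟨hss.finite, haveI := hss.finite.to_subtype; ncard_le_one_iff_subsingleton.2 hss⟩
    rw [hfib]
    refine ⟨h1.toFinset.finite_toSet.biUnion fun y _ => (hstep y).1, ?_⟩
    refine (Finset.set_ncard_biUnion_le _ _).trans ?_
    refine (Finset.sum_le_card_nsmul _ _ _ fun y _ => (hstep y).2).trans ?_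
    rw [smul_eq_mul, ← ncard_eq_toFinset_card T h1]
    exact Nat.mul_le_mul_right _ h2

end IsComplexBoxMapping

end

/-! ### Orbits avoiding `V^ν`: bounded degree, and frequent passage through nontrivial annuli. -/

section

variable {F : ℂ → ℂ} {U V : Set ℂ}

theorem connectedComponentIn_subset_criticalPart {S : Set ℂ} {x : ℂ} (hx : x ∈ criticalPart F U S) :
    connectedComponentIn S x ⊆ criticalPart F U S := fun y hy =>
  ⟨connectedComponentIn_subset S x hy, by rw [← connectedComponentIn_eq hy]; exact hx.2⟩

theorem IsOpen.criticalPart {S : Set ℂ} (hS : IsOpen S) : IsOpen (criticalPart F U S) := by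
  rw [isOpen_iff_mem_nhds]
  intro x hx
  exact Filter.mem_of_superset (hS.connectedComponentIn.mem_nhds (mem_connectedComponentIn hx.1))
    (connectedComponentIn_subset_criticalPart hx)

theorem mem_criticalReturn_succ {i : ℕ} {c : ℂ} (hc : c ∈ critSet F U)
    (h : c ∈ returnDomain F U (criticalReturn F U V i)) : c ∈ criticalReturn F U V (i + 1) :=
  ⟨h, c, mem_connectedComponentIn h, hc⟩

theorem mem_orbitDomain_of_mem_piece {m : ℕ} {z w : ℂ} (h : w ∈ piece F U V m z) :
    z ∈ orbitDomain F U V m :=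
  connectedComponentIn_nonempty_iff.1 ⟨w, h⟩

theorem criticalReturn_subset (i : ℕ) : criticalReturn F U V i ⊆ V := by
  induction i with
  | zero => exact Subset.rfl
  | succ i ih => exact fun x hx => ih hx.1.1

namespace IsComplexBoxMapping

variable (hF : IsComplexBoxMapping F U V)
include hF

theorem orbit_mem {x : ℂ} {n : ℕ} (hx : x ∈ V) (h : ∀ j < n, F^[j] x ∈ U) : F^[n] x ∈ V := by
  rcases n with _ | n
  · exact hx
  · rw [Function.iterate_succ_apply']
    exact hF.mapsTo (h n (Nat.lt_succ_self n))

theorem isOpen_criticalReturn (i : ℕ) : IsOpen (criticalReturn F U V i) := by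
  induction i with
  | zero => exact hF.isOpen_range
  | succ i ih =>
    refine IsOpen.criticalPart ?_
    have : returnDomain F U (criticalReturn F U V i) = criticalReturn F U V i ∩
        ⋃ n ≥ 1, orbitDomain F U V n ∩ F^[n] ⁻¹' criticalReturn F U V i := by
      ext x
      simp only [returnDomain, mem_ofPred_eq, mem_inter_iff, mem_iUnion, exists_prop, mem_preimage,
        orbitDomain]
      refine and_congr_right fun hx => exists_congr fun n => and_congr_right fun _ => ?_
      exact ⟨fun h => ⟨⟨criticalReturn_subset i hx, h.1⟩, h.2⟩, fun h => ⟨h.1.2, h.2⟩⟩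
    rw [this]
    exact ih.inter (isOpen_biUnion fun n _ =>
      (hF.differentiableOn_iterate n).continuousOn.isOpen_inter_preimage (hF.isOpen_orbitDomain n)
        ih)

/-- Every critical return domain is a union of puzzle pieces. -/
theorem exists_piece_subset_criticalReturn (i : ℕ) {y : ℂ} (hy : y ∈ criticalReturn F U V i) :
    ∃ m, y ∈ orbitDomain F U V m ∧ piece F U V m y ⊆ criticalReturn F U V i := by
  induction i generalizing y with
  | zero =>
    refine ⟨0, by rwa [orbitDomain_zero], ?_⟩
    rw [piece_zero]
    exact connectedComponentIn_subset V y
  | succ i ih =>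
    obtain ⟨hyi, n, hn, hyU, hyn⟩ := hy.1
    obtain ⟨m₀, hm₀, hm₀V⟩ := ih hyi
    obtain ⟨m₁, hm₁, hm₁V⟩ := ih hyn
    have hyd : y ∈ orbitDomain F U V (m₁ + n) := by
      refine ⟨criticalReturn_subset i hyi, fun l hl => ?_⟩
      rcases lt_or_ge l n with h | h
      · exact hyU l h
      · have := hm₁.2 (l - n) (by omega)
        rwa [← Function.iterate_add_apply, Nat.sub_add_cancel h] at this
    have hym : y ∈ orbitDomain F U V (max m₀ (m₁ + n)) := by
      rcases max_choice m₀ (m₁ + n) with h | h <;> rw [h] <;> assumption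
    refine ⟨_, hym, ?_⟩
    have h0 := (piece_anti (F := F) (U := U) (V := V) (le_max_left m₀ (m₁ + n)) y).trans hm₀V
    have h1 := piece_anti (F := F) (U := U) (V := V) (le_max_right m₀ (m₁ + n)) y
    -- Depth `m₁ + n` makes the whole piece return at the same time `n`, into a piece inside `V^i`;
    -- depth `m₀` keeps it in `V^i` at the start.
    have hsub : piece F U V (max m₀ (m₁ + n)) y ⊆ returnDomain F U (criticalReturn F U V i) := by
      intro z hz
      have hz1 := h1 hz
      exact ⟨h0 hz, n, hn, fun j hj => (piece_subset _ _ hz1).2 j (by omega),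
        hm₁V ((hF.properOn_iterate_piece hyd).1 hz1)⟩
    exact (isPreconnected_connectedComponentIn.subset_connectedComponentIn (mem_piece hym)
      hsub).trans (connectedComponentIn_subset_criticalPart hy)

open Classical in
/-- The pullbacks along an orbit avoiding `Vᵛ` meet each critical point boundedly often. -/
theorem exists_card_encounters_le (ν : ℕ) {c : ℂ} (hc : c ∈ critSet F U) : ∃ M : ℕ,
    ∀ (j : ℕ) (x : ℂ), (∀ i < j, F^[i] x ∈ U \ criticalReturn F U V ν) →
      ∑ i ∈ Finset.range j, (if c ∈ piece F U V (j - i) (F^[i] x) then 1 else 0) ≤ M := by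
  -- Two encounters with `c`, both at depth at least `m`, are impossible.
  obtain ⟨m, hm⟩ : ∃ m : ℕ, ∀ (j : ℕ) (x : ℂ),
      (∀ i < j, F^[i] x ∈ U \ criticalReturn F U V ν) → ∀ i i', i < i' → i' < j → m ≤ j - i' →
      c ∈ piece F U V (j - i) (F^[i] x) → c ∈ piece F U V (j - i') (F^[i'] x) → False := by
    by_cases hcν : c ∈ criticalReturn F U V ν
    -- For `c` in `V^ν`, one deep encounter already puts the orbit point into `V^ν`.
    · obtain ⟨m, -, hmV⟩ := hF.exists_piece_subset_criticalReturn ν hcν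
      refine ⟨m, fun j x hx i i' hii hi'j hmj hi hi' => (hx i' hi'j).2 ?_⟩
      refine hmV (piece_anti hmj c ?_)
      rw [← piece_eq hi']
      exact mem_piece (mem_orbitDomain_of_mem_piece hi')
    -- Otherwise `c` drops out at some level `s`. Two deep encounters would make the orbit of `c`
    -- return to `V^s`, and so put `c` into the next level.
    · obtain ⟨s, hs, hs'⟩ : ∃ s, c ∈ criticalReturn F U V s ∧ c ∉ criticalReturn F U V (s + 1) := by
        by_contra! hcon
        refine hcν ?_
        clear hcν
        induction ν with
        | zero => exact hF.dom_subset hc.1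
        | succ ν ih => exact hcon ν ih
      obtain ⟨m, -, hmV⟩ := hF.exists_piece_subset_criticalReturn s hs
      refine ⟨m, fun j x hx i i' hii hi'j hmj hi hi' => hs' (mem_criticalReturn_succ hc ?_)⟩
      have hcd := piece_subset _ _ hi
      refine ⟨hs, i' - i, by omega, fun l hl => hcd.2 l (by omega), ?_⟩
      have he : j - i = (j - i') + (i' - i) := by omega
      rw [he] at hi
      have h1 := (hF.properOn_iterate_piece (mem_orbitDomain_of_mem_piece hi)).1 hi
      rw [← Function.iterate_add_apply, Nat.sub_add_cancel hii.le, piece_eq hi'] at h1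
      exact hmV (piece_anti hmj c h1)
  -- At most `m` indices have depth below `m`; beyond that there is at most one encounter.
  refine ⟨m + 1, fun j x hx => ?_⟩
  rw [← Finset.sum_filter, Finset.sum_const, smul_eq_mul, mul_one]
  have hsub : (Finset.range j).filter (fun i => c ∈ piece F U V (j - i) (F^[i] x)) ⊆
      (Finset.range m).image (fun t => j - t) ∪
        (Finset.range j).filter (fun i => c ∈ piece F U V (j - i) (F^[i] x) ∧ m ≤ j - i) := by
    intro i hi
    rw [Finset.mem_filter, Finset.mem_range] at hi
    rw [Finset.mem_union]
    rcases lt_or_ge (j - i) m with h | h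
    · exact Or.inl (Finset.mem_image.2 ⟨j - i, Finset.mem_range.2 h, by omega⟩)
    · exact Or.inr (Finset.mem_filter.2 ⟨Finset.mem_range.2 hi.1, hi.2, h⟩)
  refine (Finset.card_le_card hsub).trans ((Finset.card_union_le _ _).trans (add_le_add ?_ ?_))
  · exact Finset.card_image_le.trans (Finset.card_range m).le
  · rw [Finset.card_le_one]
    intro a ha b hb
    rw [Finset.mem_filter, Finset.mem_range] at ha hb
    by_contra hne
    rcases lt_or_gt_of_ne hne with h | h
    · exact hm j x hx a b h hb.1 hb.2.2 ha.2.1 hb.2.1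
    · exact hm j x hx b a h ha.1 ha.2.2 hb.2.1 ha.2.1

/-- The encounter bounds, summed over the finitely many critical points, bound the exponent in
`ncard_fiber_iterate_le`. -/
theorem exists_ncard_fiber_iterate_le (ν : ℕ) : ∃ N : ℕ, ∀ (j : ℕ) (x : ℂ), x ∈ V →
    (∀ i < j, F^[i] x ∈ U \ criticalReturn F U V ν) → ∀ w,
      (piece F U V j x ∩ F^[j] ⁻¹' {w}).Finite ∧ (piece F U V j x ∩ F^[j] ⁻¹' {w}).ncard ≤ N := by
  classical
  obtain ⟨d, hd1, hd⟩ := hF.exists_ncard_fiber_le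
  have hM : ∀ c ∈ critSet F U, ∃ M : ℕ,
    ∀ (j : ℕ) (x : ℂ), (∀ i < j, F^[i] x ∈ U \ criticalReturn F U V ν) →
      ∑ i ∈ Finset.range j, (if c ∈ piece F U V (j - i) (F^[i] x) then 1 else 0) ≤ M :=
    fun c hc => hF.exists_card_encounters_le ν hc
  choose! M hM using hM
  refine ⟨d ^ ∑ c ∈ hF.finite_crit.toFinset, M c, fun j x hxV hx w => ?_⟩
  obtain ⟨h1, h2⟩ := hF.ncard_fiber_iterate_le hd (j := j) (z := x) ⟨hxV, fun i hi => (hx i hi).1⟩ w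
  refine ⟨h1, h2.trans (Nat.pow_le_pow_right hd1 ?_)⟩
  calc _ ≤ ∑ i ∈ Finset.range j, ∑ c ∈ hF.finite_crit.toFinset,
        (if c ∈ piece F U V (j - i) (F^[i] x) then 1 else 0) := by
        refine Finset.sum_le_sum fun i _ => ?_
        split_ifs with h
        · obtain ⟨c, hc, hcc⟩ := h
          have := Finset.single_le_sum
            (f := fun c => if c ∈ piece F U V (j - i) (F^[i] x) then 1 else 0)
            (fun _ _ => Nat.zero_le _) (hF.finite_crit.mem_toFinset.2 hcc)
          simpa only [if_pos hc] using this
        · exact Nat.zero_le _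
    _ = ∑ c ∈ hF.finite_crit.toFinset, ∑ i ∈ Finset.range j,
        (if c ∈ piece F U V (j - i) (F^[i] x) then 1 else 0) := Finset.sum_comm
    _ ≤ _ := Finset.sum_le_sum fun c hc => hM c (hF.finite_crit.mem_toFinset.1 hc) j x hx

/-- Periodic components of `U` that are components of `V` lie in all critical return domains. -/
theorem subset_criticalReturn_of_periodic {E : ℕ → Set ℂ} {p : ℕ} (hp : 0 < p)
    (hE : ∀ n, F '' E n = E (n + 1)) (hEU : ∀ n, E n ⊆ U) (hEp : ∀ n, E (n + p) = E n) {l : ℕ}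
    (hEc : IsPreconnected (E l)) (hcrit : (E l ∩ critSet F U).Nonempty) (i : ℕ) :
    E l ⊆ criticalReturn F U V i := by
  obtain ⟨c, hcE, hc⟩ := hcrit
  have hit : ∀ q, MapsTo F^[q] (E l) (E (l + q)) := by
    intro q
    induction q with
    | zero => exact mapsTo_id _
    | succ q ih =>
      intro z hz
      rw [Function.iterate_succ_apply', ← add_assoc, ← hE]
      exact mem_image_of_mem F (ih hz)
  induction i with
  | zero => exact (hEU l).trans hF.dom_subset
  | succ i ih =>
    have hsub : E l ⊆ returnDomain F U (criticalReturn F U V i) := fun z hz =>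
      ⟨ih hz, p, hp, fun q _ => hEU _ (hit q hz), ih (hEp l ▸ hit p hz)⟩
    intro z hz
    exact ⟨hsub hz, c, hEc.subset_connectedComponentIn hz hsub hcE, hc⟩

/-- Along an orbit avoiding `Vᵛ`, the components of `U` differ from those of `V` in bounded time. -/
theorem exists_component_ne (hperm : NoNoncriticalPermutation F U) (ν : ℕ) : ∃ b : ℕ, 0 < b ∧
    ∀ x : ℂ, (∀ i < b, F^[i] x ∈ U \ criticalReturn F U V ν) → ∃ i < b,
      connectedComponentIn U (F^[i] x) ≠ connectedComponentIn V (F^[i] x) := by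
  refine ⟨hF.finite_range.toFinset.card + 1, Nat.succ_pos _, fun x hx => ?_⟩
  by_contra! hcon
  set b := hF.finite_range.toFinset.card + 1 with hb
  -- `b` exceeds the number of components of `V`, so two of the times share a component.
  obtain ⟨j, hj, j', hj', hne, heq⟩ := Finset.exists_ne_map_eq_of_card_lt_of_maps_to
    (s := Finset.range b) (t := hF.finite_range.toFinset) (by simp [hb])
    (f := fun i => connectedComponentIn V (F^[i] x)) (fun i hi => by
      rw [Finset.mem_coe, hF.finite_range.mem_toFinset]
      exact ⟨_, hF.dom_subset (hx i (by simpa using hi)).1, rfl⟩)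
  rw [Finset.mem_range] at hj hj'
  wlog hlt : j < j' generalizing j j'
  · exact this j' hj' j hj hne.symm heq.symm (by omega)
  set p := j' - j with hp
  have hp0 : 0 < p := by omega
  -- The visited components, continued with period `p`; `F` permutes them because time `j'` is back
  -- in the component of time `j`.
  set E : ℕ → Set ℂ := fun n => connectedComponentIn V (F^[j + n % p] x) with hEdef
  have hmod : ∀ n, n % p < p := fun n => Nat.mod_lt n hp0
  have hEU' : ∀ n, connectedComponentIn U (F^[j + n % p] x) = E n := fun n =>
    hcon _ (by have := hmod n; omega)
  have hEU : ∀ n, E n ⊆ U := fun n => hEU' n ▸ connectedComponentIn_subset _ _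
  have hE : ∀ n, F '' E n = E (n + 1) := by
    intro n
    have h1 := hmod n
    rw [← hEU' n, hF.image_component_eq (hx _ (by omega)).1, ← Function.iterate_succ_apply' F]
    simp only [hEdef]
    rcases Nat.lt_or_ge (n % p + 1) p with h | h
    · rw [Nat.add_mod, Nat.mod_eq_of_lt (a := 1) (by omega), Nat.mod_eq_of_lt h]
      rfl
    · have h2 : (n + 1) % p = 0 := by
        have : n % p + 1 = p := by omega
        rw [← Nat.mod_add_mod, this, Nat.mod_self]
      have h3 : (j + n % p).succ = j' := by omega
      rw [h2, h3, add_zero, heq]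
  have hEp : ∀ n, E (n + p) = E n := fun n => by simp [hEdef]
  have hmem : F^[j] x ∈ U := (hx j hj).1
  have hit : ∀ n, F^[n] '' connectedComponentIn U (F^[j] x) = E n := by
    intro n
    induction n with
    | zero =>
      rw [← hEU' 0]
      simp
    | succ n ih => rw [Function.iterate_succ', image_comp, ih, hE]
  obtain ⟨n, hn⟩ := hperm _ ⟨_, hmem, rfl⟩
  rw [hit n] at hn
  -- The cycle never leaves `U`, so it carries a critical point; then that component lies in `V^ν`
  -- and contains a point of the orbit.
  rcases hn with ⟨z, hz, hzU⟩ | hn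
  · exact hzU (hEU n hz)
  · have h1 := hF.subset_criticalReturn_of_periodic hp0 hE hEU hEp
      isPreconnected_connectedComponentIn hn ν
    have h2 := hx (j + n % p) (by have := hmod n; omega)
    exact h2.2 (h1 (mem_connectedComponentIn (hF.dom_subset h2.1)))

end IsComplexBoxMapping

end

/-! ### Exponential shrinking of puzzle pieces. -/

/-- Harnack's inequality contracts oscillation. -/
theorem HarnackOn.re_sub_le {P S : Set ℂ} {A θ c : ℝ} (hA : 1 ≤ A) (hS : HarnackOn P S A)
    (hSP : S ⊆ P) (hθ : (A - 1) / (A + 1) ≤ θ) {h : ℂ → ℂ} (hh : DifferentiableOn ℂ h P)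
    (hc : ∀ z ∈ P, ∀ w ∈ P, (h z).re - (h w).re ≤ c) :
    ∀ z ∈ S, ∀ w ∈ S, (h z).re - (h w).re ≤ θ * c := by
  intro z hz w hw
  obtain ⟨M, hM, hm⟩ : ∃ M : ℝ, (∀ y ∈ P, (h y).re ≤ M) ∧ ∀ y ∈ P, M - c ≤ (h y).re := by
    have hne : ((fun y => (h y).re) '' P).Nonempty := ⟨_, mem_image_of_mem _ (hSP hz)⟩
    have hub : ∀ y ∈ P, ∀ t ∈ (fun y => (h y).re) '' P, t ≤ (h y).re + c := by
      rintro y hy _ ⟨y', hy', rfl⟩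
      linarith [hc y' hy' y hy]
    refine ⟨sSup ((fun y => (h y).re) '' P), fun y hy => ?_, fun y hy => ?_⟩
    · exact le_csSup ⟨_, hub _ (hSP hz)⟩ (mem_image_of_mem _ hy)
    · linarith [csSup_le hne (hub y hy)]
  have hc0 : 0 ≤ c := by simpa using hc z (hSP hz) z (hSP hz)
  -- Add Harnack's inequalities for `h - (M - c - ε)` and `M + ε - h`; the `ε` makes both strictly
  -- positive.
  have key : ∀ ε > 0, ((h z).re - (h w).re) * (A + 1) ≤ (A - 1) * (c + 2 * ε) := by
    intro ε hε
    have h1 := hS (fun y => h y - ((M - c - ε : ℝ) : ℂ)) (hh.sub_const _) (fun y hy => by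
      rw [sub_re, ofReal_re]
      linarith [hm y hy]) z hz w hw
    have h2 := hS (fun y => ((M + ε : ℝ) : ℂ) - h y) (hh.const_sub _) (fun y hy => by
      rw [sub_re, ofReal_re]
      linarith [hM y hy]) w hw z hz
    simp only [sub_re, ofReal_re] at h1 h2
    nlinarith
  have key' : ((h z).re - (h w).re) * (A + 1) ≤ (A - 1) * c := by
    refine le_of_forall_pos_le_add fun ε hε => ?_
    have h1 := key (ε / (2 * A)) (by positivity)
    have h2 : 2 * (ε / (2 * A)) = ε / A := by field_simp
    have h3 : (A - 1) * (ε / A) ≤ ε := by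
      rw [mul_div_assoc', div_le_iff₀ (by linarith)]
      nlinarith
    rw [h2] at h1
    nlinarith
  calc (h z).re - (h w).re ≤ (A - 1) / (A + 1) * c := by
        rw [div_mul_eq_mul_div, le_div_iff₀ (by linarith)]
        exact key'
    _ ≤ θ * c := mul_le_mul_of_nonneg_right hθ hc0

/-- Each block of `b` indices contains one Harnack pair, worth a factor `θ`; the remaining
inclusions only use monotonicity. -/
theorem re_sub_le_pow {P : ℕ → Set ℂ} (hP : Antitone P) {A θ c : ℝ} (hA : 1 ≤ A)
    (hθ : (A - 1) / (A + 1) ≤ θ) {b : ℕ} {h : ℂ → ℂ} (hh : DifferentiableOn ℂ h (P 0))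
    (hc : ∀ z ∈ P 0, ∀ w ∈ P 0, (h z).re - (h w).re ≤ c) {q : ℕ}
    (hgood : ∀ n < q, ∃ i, b * n ≤ i ∧ i < b * (n + 1) ∧ HarnackOn (P i) (P (i + 1)) A) :
    ∀ z ∈ P (b * q), ∀ w ∈ P (b * q), (h z).re - (h w).re ≤ θ ^ q * c := by
  induction q with
  | zero => simpa using hc
  | succ q ih =>
    have ih' := ih fun n hn => hgood n (hn.trans q.lt_succ_self)
    obtain ⟨i, hi1, hi2, hi⟩ := hgood q q.lt_succ_self
    have := hi.re_sub_le hA (hP i.le_succ) hθ (hh.mono (hP i.zero_le))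
      fun z hz w hw => ih' z (hP hi1 hz) w (hP hi1 hw)
    intro z hz w hw
    rw [pow_succ', mul_assoc]
    exact this z (hP hi2 hz) w (hP hi2 hw)

section

variable {F : ℂ → ℂ} {U V : Set ℂ}

namespace IsComplexBoxMapping

variable (hF : IsComplexBoxMapping F U V)
include hF

theorem exists_harnackOn_component {δ : ℝ} (hδ : 0 < δ) (hmod : WellInsideOrEqual U V δ) :
    ∃ A : ℝ, 1 ≤ A ∧ ∀ x ∈ U, connectedComponentIn U x ≠ connectedComponentIn V x →
      HarnackOn (connectedComponentIn V x) (connectedComponentIn U x) A := by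
  obtain ⟨A, hA, h⟩ := HasModulus.exists_harnackOn hδ
  refine ⟨A, hA, fun x hx hne => ?_⟩
  obtain ⟨m, hm, hmm⟩ := (hmod x hx).resolve_left hne
  obtain ⟨hJ, hcl⟩ := (hF.dom_component_cases hx).resolve_left hne
  exact h _ _ m hF.isOpen_range.connectedComponentIn ⟨x, mem_connectedComponentIn hx⟩
    (isCompact_of_isClosed_isBounded isClosed_closure hJ.2.2.1.closure) hcl hm hmm

/-- Puzzle pieces along orbits avoiding `Vᵛ` shrink exponentially. -/
theorem exists_dist_le (hmod : ∃ δ > 0, WellInsideOrEqual U V δ)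
    (hperm : NoNoncriticalPermutation F U) (ν : ℕ) :
    ∃ b : ℕ, 0 < b ∧ ∃ θ : ℝ, 0 < θ ∧ θ < 1 ∧ ∃ R > 0, ∀ (k : ℕ) (x : ℂ), x ∈ V →
      (∀ i < k, F^[i] x ∈ U \ criticalReturn F U V ν) →
      ∀ z ∈ piece F U V k x, ∀ w ∈ piece F U V k x, dist z w ≤ R * θ ^ (k / b) := by
  obtain ⟨δ, hδ, hmod⟩ := hmod
  obtain ⟨A₀, hA₀, hH₀⟩ := hF.exists_harnackOn_component hδ hmod
  obtain ⟨N, hN⟩ := hF.exists_ncard_fiber_iterate_le ν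
  obtain ⟨A, hA, hH⟩ := HarnackOn.exists_transfer A₀ hA₀ N
  obtain ⟨b, hb, hne⟩ := hF.exists_component_ne hperm ν
  obtain ⟨R, hR0, hR⟩ := hF.isBounded_range.exists_pos_norm_le
  have hθ1 : (A - 1) / (A + 1) < 1 := by rw [div_lt_one (by linarith)]; linarith
  -- The `1 / 2` keeps `θ` positive when `A = 1`; `4 * R` is an oscillation `2 * R` for each of the
  -- real and imaginary parts.
  refine ⟨b, hb, max ((A - 1) / (A + 1)) (1 / 2), by positivity, max_lt hθ1 (by norm_num), 4 * R,
    by positivity, fun k x hxV hx z hz w hw => ?_⟩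
  set θ := max ((A - 1) / (A + 1)) (1 / 2)
  -- At a time `j` of the block where the two components differ, `F^[j]` maps the piece of depth `j`
  -- properly, with fibres of at most `N` points, to the component of `V`, and the piece of depth `j
  -- + 1` into that of `U`.
  have hgood : ∀ n < k / b, ∃ i, b * n ≤ i ∧ i < b * (n + 1) ∧
      HarnackOn (piece F U V i x) (piece F U V (i + 1) x) A := by
    intro n hn
    have hnk : b * (n + 1) ≤ k := (Nat.mul_le_mul_left b hn).trans (Nat.mul_div_le k b)
    have hlt : ∀ i < b, b * n + i < b * (n + 1) := fun i hi => by rw [mul_add_one]; omega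
    obtain ⟨i, hi, hi'⟩ := hne (F^[b * n] x) fun i hi => by
      rw [← Function.iterate_add_apply, add_comm]
      exact hx _ ((hlt i hi).trans_le hnk)
    rw [← Function.iterate_add_apply, add_comm i] at hi'
    refine ⟨b * n + i, Nat.le_add_right _ _, hlt i hi, ?_⟩
    have hjk := (hlt i hi).trans_le hnk
    generalize b * n + i = j at hi' hjk
    have hxj := (hx j hjk).1
    have hd1 : x ∈ orbitDomain F U V (j + 1) := ⟨hxV, fun l hl => (hx l (by omega)).1⟩
    have hd : x ∈ orbitDomain F U V j := orbitDomain_anti j.le_succ hd1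
    have hp := hF.properOn_iterate_piece (m := 0) (j := j) (z := x) (by rwa [zero_add])
    rw [zero_add, piece_zero] at hp
    have hp1 := hF.properOn_iterate_piece (m := 1) (j := j) (z := x) (by rwa [add_comm])
    rw [add_comm, hF.piece_one] at hp1
    have hJ := hF.isJordanDisk_range (hF.dom_subset hxj)
    exact hH F^[j] _ (connectedComponentIn V (F^[j] x)) (connectedComponentIn U (F^[j] x)) _
      (hF.isOpen_piece _ _) (isConnected_piece hd) (hF.isBounded_piece _ _) (hF.chainFull_piece hd)
      hJ.1 (isConnected_connectedComponentIn_iff.2 (hF.dom_subset hxj)) hJ.2.2.1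
      (chainFull_of_simplyConnectedSpace hJ.1 hJ.2.1)
      ((hF.differentiableOn_iterate j).mono (piece_subset _ _)) hp
      (fun w _ => hN j x hxV (fun l hl => hx l (hl.trans hjk)) w)
      hF.isOpen_dom.connectedComponentIn ⟨_, mem_connectedComponentIn hxj⟩
      (connectedComponentIn_mono _ hF.dom_subset) (hH₀ _ hxj hi')
      isPreconnected_connectedComponentIn (piece_anti j.le_succ x) hp1.1
  have hanti : Antitone fun i => piece F U V i x := fun m n h => piece_anti h x
  have hV : ∀ y ∈ piece F U V 0 x, ‖y‖ ≤ R := fun y hy => hR y (piece_subset 0 x hy).1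
  have hzk := hanti (Nat.mul_div_le k b) hz
  have hwk := hanti (Nat.mul_div_le k b) hw
  have hre := re_sub_le_pow hanti hA (le_max_left _ (1 / 2)) (h := fun y => y) (c := 2 * R)
    differentiableOn_id (fun y hy y' hy' => by
      have h1 := (abs_le.1 ((abs_re_le_norm y).trans (hV y hy))).2
      have h2 := (abs_le.1 ((abs_re_le_norm y').trans (hV y' hy'))).1
      linarith) hgood
  -- The imaginary part is the real part of `-i y`.
  have him := re_sub_le_pow hanti hA (le_max_left _ (1 / 2)) (h := fun y => -I * y) (c := 2 * R)
    (differentiableOn_id.const_mul _) (fun y hy y' hy' => by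
      have h1 := (abs_le.1 ((abs_im_le_norm y).trans (hV y hy))).2
      have h2 := (abs_le.1 ((abs_im_le_norm y').trans (hV y' hy'))).1
      simp only [neg_mul, neg_re, I_mul_re, neg_neg]
      linarith) hgood
  simp only [neg_mul, neg_re, I_mul_re, neg_neg] at him
  have h1 : |(z - w).re| ≤ θ ^ (k / b) * (2 * R) := by
    rw [sub_re, abs_le]
    constructor <;> linarith [hre z hzk w hwk, hre w hwk z hzk]
  have h2 : |(z - w).im| ≤ θ ^ (k / b) * (2 * R) := by
    rw [sub_im, abs_le]
    constructor <;> linarith [him z hzk w hwk, him w hwk z hzk]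
  rw [dist_eq_norm]
  linarith [norm_le_abs_re_add_abs_im (z - w)]

end IsComplexBoxMapping

end

/-! ### Univalent pullbacks and the derivative. -/

/-- A preconnected set containing the centre of a ball and missing its boundary sphere lies in the
ball. -/
theorem IsPreconnected.subset_ball_of_disjoint_sphere {S : Set ℂ} (hS : IsPreconnected S) {c : ℂ}
    {r : ℝ} (hr : 0 < r) (hc : c ∈ S) (h : ∀ z ∈ S, dist z c ≠ r) : S ⊆ ball c r := by
  intro w hw
  by_contra hwn
  obtain ⟨y, -, hy1, hy2⟩ := hS (ball c r) (closedBall c r)ᶜ isOpen_ball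
    isClosed_closedBall.isOpen_compl (fun y hy => by
      rcases lt_or_gt_of_ne (h y hy) with h' | h'
      · exact Or.inl h'
      · exact Or.inr (by simpa using h')) ⟨c, hc, mem_ball_self hr⟩
    ⟨w, hw, fun h' => hwn ((mem_closedBall.1 h').lt_of_ne (h w hw))⟩
  exact hy2 (ball_subset_closedBall hy1)

/-- Small connected sets through `c` in the preimage of a nonconstant holomorphic map. -/
theorem exists_subset_ball_of_image_subset {f : ℂ → ℂ} {P : Set ℂ} (hP : IsOpen P)
    (hPc : IsPreconnected P) (hf : DifferentiableOn ℂ f P) (h0 : ¬ EqOn (deriv f) 0 P) {c : ℂ}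
    (hc : c ∈ P) {r : ℝ} (hr : 0 < r) : ∃ ε > 0, ∀ S : Set ℂ, IsPreconnected S → c ∈ S →
      (∀ z ∈ S, dist (f z) (f c) < ε) → S ⊆ ball c r := by
  have hfa := hf.analyticOnNhd hP
  have hne : ∀ᶠ z in nhdsWithin c {c}ᶜ, f z - f c ≠ 0 := by
    refine ((hfa c hc).sub analyticAt_const).eventually_eq_zero_or_eventually_ne_zero.resolve_left
      fun h => h0 ?_
    have heq := hfa.eqOn_of_preconnected_of_eventuallyEq (analyticOnNhd_const (v := f c)) hPc hc
      (h.mono fun z hz => sub_eq_zero.1 hz)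
    intro z hz
    rw [(heq.eventuallyEq_of_mem (hP.mem_nhds hz)).deriv_eq, deriv_const]
    rfl
  rw [eventually_nhdsWithin_iff, Metric.eventually_nhds_iff] at hne
  obtain ⟨ρ, hρ, hne⟩ := hne
  obtain ⟨ρ', hρ', hρP⟩ := Metric.isOpen_iff.1 hP c hc
  -- A circle inside the `r`-ball and `P` on which `f - f c` has no zero. Its minimal modulus there
  -- is the `ε`: a connected set through `c` on which `f` is `ε`-close to `f c` cannot cross the
  -- circle.
  set s := min r (min ρ ρ') / 2 with hs
  have hm : 0 < min r (min ρ ρ') := lt_min hr (lt_min hρ hρ')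
  have hs0 : 0 < s := half_pos hm
  have hsm : s < min r (min ρ ρ') := half_lt_self hm
  have hsr : s < r := hsm.trans_le (min_le_left _ _)
  have hsρ : s < ρ := hsm.trans_le ((min_le_right _ _).trans (min_le_left _ _))
  have hsρ' : s < ρ' := hsm.trans_le ((min_le_right _ _).trans (min_le_right _ _))
  have hsP : sphere c s ⊆ P := fun z hz => hρP (by rw [mem_ball, mem_sphere.1 hz]; exact hsρ')
  obtain ⟨w, hw, hwmin⟩ := (isCompact_sphere c s).exists_isMinOn
    ⟨c + s, by simp [abs_of_pos hs0]⟩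
    (f := fun z => dist (f z) (f c)) ((continuous_id.dist continuous_const).comp_continuousOn (hf.continuousOn.mono hsP))
  refine ⟨dist (f w) (f c), ?_, fun S hS hcS hSε => ?_⟩
  · rw [gt_iff_lt, dist_pos]
    rw [mem_sphere] at hw
    refine sub_ne_zero.1 (hne (by rwa [hw]) fun h => ?_)
    rw [mem_singleton_iff.1 h, dist_self] at hw
    exact hs0.ne hw
  · exact (hS.subset_ball_of_disjoint_sphere hs0 hcS fun z hz hzs =>
      absurd (hSε z hz) (not_lt.2 (hwmin hzs))).trans (ball_subset_ball hsr.le)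

section

variable {F : ℂ → ℂ} {U V : Set ℂ}

/-- A ball missing the frontier of `V` is connected, so it cannot leave `V`. -/
theorem ball_subset_connectedComponentIn {x : ℂ} {κ : ℝ} (hκ : 0 < κ) (hV : IsOpen V)
    (hx : x ∈ V) (h : κ ≤ infDist x (frontier V)) : ball x κ ⊆ connectedComponentIn V x := by
  have hpre : IsPreconnected (ball x κ) := (convex_ball x κ).isPreconnected
  have hfr : ∀ y ∈ ball x κ, y ∉ frontier V := fun y hy hyf =>
    absurd (mem_ball'.1 hy) (not_lt.2 (h.trans (infDist_le_dist_of_mem hyf)))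
  refine hpre.subset_connectedComponentIn (mem_ball_self hκ) fun w hw => ?_
  by_contra hwn
  obtain ⟨y, -, hy1, hy2⟩ := hpre V (closure V)ᶜ hV isClosed_closure.isOpen_compl
    (fun y hy => by
      by_contra! hcon
      simp only [mem_union, mem_compl_iff, not_or, not_not] at hcon
      exact hfr y hy ⟨hcon.2, by rw [hV.interior_eq]; exact hcon.1⟩)
    ⟨x, mem_ball_self hκ, hx⟩
    ⟨w, hw, fun h' => hfr w hw ⟨h', by rwa [hV.interior_eq]⟩⟩
  exact hy2 (subset_closure hy1)

namespace IsComplexBoxMapping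

variable (hF : IsComplexBoxMapping F U V)
include hF

/-- Proper iterates are not constant, so each critical point and exponent has its own `ε`; there are
finitely many pairs. This covers shallow pullbacks, for which exponential shrinking gives too
little. -/
theorem exists_forall_subset_ball {r : ℝ} (hr : 0 < r) (M : ℕ) : ∃ ε > 0, ∀ c ∈ critSet F U,
    ∀ j < M, ∀ S : Set ℂ, IsPreconnected S → c ∈ S → S ⊆ orbitDomain F U V j →
      (∀ z ∈ S, dist (F^[j] z) (F^[j] c) < ε) → S ⊆ ball c r := by
  have hone : ∀ p : ℂ × ℕ, ∃ ε > 0, ∀ S : Set ℂ, IsPreconnected S → p.1 ∈ S →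
      S ⊆ orbitDomain F U V p.2 → (∀ z ∈ S, dist (F^[p.2] z) (F^[p.2] p.1) < ε) →
      S ⊆ ball p.1 r := by
    rintro ⟨c, j⟩
    by_cases hc : c ∈ orbitDomain F U V j
    · have hp := hF.properOn_iterate_piece (m := 0) (j := j) (z := c) (by rwa [zero_add])
      rw [zero_add] at hp
      have hd := (hF.differentiableOn_iterate j).mono (piece_subset j c)
      obtain ⟨ε, hε, h⟩ := exists_subset_ball_of_image_subset (hF.isOpen_piece j c)
        isPreconnected_connectedComponentIn hd
        (hp.deriv_not_eqOn_zero (hF.isOpen_piece j c) (isConnected_piece hc) hd) (mem_piece hc) hr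
      exact ⟨ε, hε, fun S hS hcS _ hSε => h S hS hcS hSε⟩
    · exact ⟨1, one_pos, fun S _ hcS hSd => absurd (hSd hcS) hc⟩
  choose ε hε h using hone
  have hfin : (critSet F U ×ˢ Iio M).Finite := hF.finite_crit.prod (finite_Iio M)
  rcases (critSet F U ×ˢ Iio M).eq_empty_or_nonempty with he | hne
  · refine ⟨1, one_pos, fun c hc j hj => ?_⟩
    exact absurd (show (c, j) ∈ critSet F U ×ˢ Iio M from ⟨hc, hj⟩) (he ▸ notMem_empty _)
  · obtain ⟨p, -, hp⟩ := hfin.exists_minimalFor ε _ hne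
    refine ⟨ε p, hε p, fun c hc j hj S hS hcS hSd hSε => h (c, j) S hS hcS hSd fun z hz => ?_⟩
    exact (hSε z hz).trans_le ((le_total (ε p) (ε (c, j))).elim id
      fun h' => hp (j := (c, j)) ⟨hc, hj⟩ h')

/-- Pullbacks of small balls along orbits staying away from the critical points are univalent, so
that the derivative is controlled by the size of the pullback. -/
theorem inv_norm_deriv_iterate_le {k : ℕ} {x : ℂ} (hx : x ∈ orbitDomain F U V k) {κ ρ : ℝ}
    (hκ : 0 < κ) (hball : ball (F^[k] x) κ ⊆ connectedComponentIn V (F^[k] x))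
    (hρ : ∀ z ∈ piece F U V k x, dist z x ≤ ρ)
    (hcrit : ∀ S ⊆ piece F U V k x, IsPreconnected S → x ∈ S →
      MapsTo F^[k] S (ball (F^[k] x) κ) → ∀ z ∈ S, ∀ i < k, F^[i] z ∉ critSet F U) :
    0 < ‖deriv F^[k] x‖ ∧ ‖deriv F^[k] x‖⁻¹ ≤ ρ / κ := by
  have hp := hF.properOn_iterate_piece (m := 0) (j := k) (z := x) (by rwa [zero_add])
  rw [zero_add, piece_zero] at hp
  have hd := (hF.differentiableOn_iterate k).mono (piece_subset k x)
  -- The pullback of the ball along the orbit of `x`. By `hcrit` it carries no critical point of the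
  -- iterate, which therefore has an inverse branch on the ball.
  set W := connectedComponentIn (piece F U V k x ∩ F^[k] ⁻¹' ball (F^[k] x) κ) x with hW
  have hWp : ProperOn F^[k] W (ball (F^[k] x) κ) := hp.restrict_component hball x
  have hxW : x ∈ W := mem_connectedComponentIn ⟨mem_piece hx, mem_ball_self hκ⟩
  have hWs : W ⊆ piece F U V k x := (connectedComponentIn_subset _ _).trans inter_subset_left
  have hWo : IsOpen W :=
    (hd.continuousOn.isOpen_inter_preimage (hF.isOpen_piece k x) isOpen_ball).connectedComponentIn
  have hWc : IsConnected W := ⟨⟨x, hxW⟩, isPreconnected_connectedComponentIn⟩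
  have hne : ∀ z ∈ W, deriv F^[k] z ≠ 0 := fun z hz =>
    hF.deriv_iterate_ne_zero (piece_subset k x (hWs hz))
      (hcrit W hWs hWc.isPreconnected hxW hWp.1 z hz)
  have hsc : SimplyConnectedSpace (ball (F^[k] x) κ) := by
    have : ContractibleSpace (ball (F^[k] x) κ) :=
      (convex_ball _ κ).contractibleSpace (nonempty_ball.2 hκ)
    infer_instance
  obtain ⟨G, hGc, hGm, hFG, hGF⟩ := hWp.exists_inverse hWo hWc (hd.mono hWs) hne isOpen_ball hsc
  have hGd : ∀ y ∈ ball (F^[k] x) κ, HasDerivAt G (deriv F^[k] (G y))⁻¹ y := fun y hy =>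
    HasDerivAt.of_local_left_inverse (hGc.continuousAt (isOpen_ball.mem_nhds hy))
      ((hd.mono hWs).differentiableAt (hWo.mem_nhds (hGm hy))).hasDerivAt (hne _ (hGm hy))
      (Filter.eventually_of_mem (isOpen_ball.mem_nhds hy) hFG)
  have hGx : G (F^[k] x) = x := hGF x hxW
  -- Schwarz's estimate for the inverse branch, from radius `κ` into radius `ρ`.
  have h1 := Complex.norm_deriv_le_div_of_mapsTo_ball
    (fun y hy => (hGd y hy).differentiableAt.differentiableWithinAt)
    (R₂ := ρ) (fun y hy => by rw [hGx]; exact hρ _ (hWs (hGm hy))) hκ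
  rw [(hGd _ (mem_ball_self hκ)).deriv, hGx, norm_inv] at h1
  exact ⟨norm_pos_iff.2 (hne x hxW), h1⟩

end IsComplexBoxMapping

end

/-! ### The expansion estimate. -/

theorem exists_pos_ball_subset {S O : Set ℂ} (hS : S.Finite) (hO : IsOpen O) (hSO : S ⊆ O) :
    ∃ r > 0, ∀ c ∈ S, ball c r ⊆ O := by
  obtain ⟨r, hr, h⟩ := hS.isCompact.exists_thickening_subset_open hO hSO
  exact ⟨r, hr, fun c hc => (ball_subset_thickening hc r).trans h⟩

theorem theorem13p1 (F : ℂ → ℂ) (U V : Set ℂ) (hF : IsComplexBoxMapping F U V)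
    (hmod : ∃ δ > 0, WellInsideOrEqual U V δ) (hperm : NoNoncriticalPermutation F U)
    (ν : ℕ) (hν : 1 ≤ ν) (κ : ℝ) (hκ : 0 < κ)
    (B : Set ℂ) (hB : IsOpen B) (hcrit : critSet F U ⊆ criticalReturn F U V ν ∪ B) :
    ∃ lam > (1 : ℝ), ∃ C > (0 : ℝ), ∀ (k : ℕ) (x : ℂ),
      (∀ j < k, F^[j] x ∈ U \ (criticalReturn F U V ν ∪ B)) →
      κ ≤ Metric.infDist (F^[k] x) (frontier V) →
      C * lam ^ k ≤ ‖deriv (F^[k]) x‖ := by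
  obtain ⟨b, hb, θ, hθ0, hθ1, R, hR, hdist⟩ := hF.exists_dist_le hmod hperm ν
  obtain ⟨r, hr, hrO⟩ := exists_pos_ball_subset hF.finite_crit
    ((hF.isOpen_criticalReturn ν).union hB) hcrit
  -- Pieces of depth at least `b * q` have diameter below `r`; smaller depths are left to `ε`.
  obtain ⟨q, hq⟩ := exists_pow_lt_of_lt_one (div_pos hr hR) hθ1
  rw [lt_div_iff₀' hR] at hq
  obtain ⟨ε, hε, hεr⟩ := hF.exists_forall_subset_ball hr (b * q)
  -- Two points of a `κ'`-ball are less than `ε` apart.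
  set κ' := min κ (ε / 2) with hκ'
  have hκ'0 : 0 < κ' := lt_min hκ (half_pos hε)
  have hκ'κ : κ' ≤ κ := min_le_left _ _
  have hκ'ε : κ' ≤ ε / 2 := min_le_right _ _
  set lam := (θ⁻¹) ^ ((b : ℝ)⁻¹) with hlam
  have hθi : 1 < θ⁻¹ := (one_lt_inv₀ hθ0).2 hθ1
  have hlam1 : 1 < lam := Real.one_lt_rpow hθi (by positivity)
  have hlamb : lam ^ b = θ⁻¹ := Real.rpow_inv_natCast_pow (by positivity) hb.ne'
  have hlamk : ∀ k : ℕ, lam ^ k * θ ^ (k / b) ≤ θ⁻¹ := by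
    intro k
    have h1 : lam ^ k = (θ⁻¹) ^ (k / b) * lam ^ (k % b) := by
      rw [← hlamb, ← pow_mul, ← pow_add, Nat.div_add_mod]
    have h2 : lam ^ (k % b) ≤ θ⁻¹ := by
      rw [← hlamb]
      exact pow_le_pow_right₀ hlam1.le (Nat.mod_lt k hb).le
    calc lam ^ k * θ ^ (k / b) = (θ⁻¹ * θ) ^ (k / b) * lam ^ (k % b) := by
          rw [h1, mul_pow]; ring
      _ ≤ θ⁻¹ := by rwa [inv_mul_cancel₀ hθ0.ne', one_pow, one_mul]
  -- The 1 settles `k = 0`, where the derivative is 1; the factor `θ` absorbs the rounding in `k /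
  -- b`.
  refine ⟨lam, hlam1, min 1 (κ' * θ / R), lt_min one_pos (by positivity), fun k x hx hxκ => ?_⟩
  rcases Nat.eq_zero_or_pos k with rfl | hk
  · simp
  have hxU : x ∈ U := (hx 0 hk).1
  have hxV : x ∈ V := hF.dom_subset hxU
  have hx' : ∀ i < k, F^[i] x ∈ U \ criticalReturn F U V ν := fun i hi =>
    ⟨(hx i hi).1, fun h => (hx i hi).2 (Or.inl h)⟩
  have hxd : x ∈ orbitDomain F U V k := ⟨hxV, fun i hi => (hx i hi).1⟩
  have hxk : F^[k] x ∈ V := hF.orbit_mem hxV hxd.2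
  have hball := (ball_subset_ball hκ'κ).trans
    (ball_subset_connectedComponentIn hκ hF.isOpen_range hxk hxκ)
  obtain ⟨hpos, hinv⟩ := hF.inv_norm_deriv_iterate_le hxd hκ'0 hball (ρ := R * θ ^ (k / b))
    (fun z hz => hdist k x hxV hx' z hz x (mem_piece hxd)) (by
      intro S hSk hS hxS hSb z hz i hik hc
      have hki : (k - i) + i = k := Nat.sub_add_cancel hik.le
      have hxd' : x ∈ orbitDomain F U V (k - i + i) := by rwa [hki]
      have hmaps := (hF.properOn_iterate_piece hxd').1
      rw [hki] at hmaps
      have hSi : F^[i] '' S ⊆ piece F U V (k - i) (F^[i] x) := (hmaps.mono_left hSk).image_subset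
      have hcS : F^[i] z ∈ F^[i] '' S := mem_image_of_mem _ hz
      have hxS' : F^[i] x ∈ F^[i] '' S := mem_image_of_mem _ hxS
      have hxid := hF.iterate_mem_orbitDomain hxd'
      -- It remains to contradict this: `F^[i] '' S` is connected, contains both the critical point
      -- `F^[i] z` and `F^[i] x`, and is small.
      have hnot : F^[i] x ∉ ball (F^[i] z) r := fun h => (hx i hik).2 (hrO _ hc h)
      rcases le_or_gt (b * q) (k - i) with hM | hM
      · refine hnot (mem_ball.2 ((hdist (k - i) (F^[i] x) hxid.1 (fun l hl => ?_) _
          (mem_piece hxid) _ (hSi hcS)).trans_lt ?_))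
        · rw [← Function.iterate_add_apply]
          exact hx' _ (by omega)
        · refine (mul_le_mul_of_nonneg_left (pow_le_pow_of_le_one hθ0.le hθ1.le ?_) hR.le).trans_lt
            hq
          rwa [Nat.le_div_iff_mul_le hb, mul_comm]
      · refine hnot (hεr _ hc _ hM (F^[i] '' S) (hS.image _ ?_) hcS
          (hSi.trans (piece_subset _ _)) ?_ hxS')
        · exact (hF.differentiableOn_iterate i).continuousOn.mono
            ((hSk.trans (piece_subset _ _)).trans (orbitDomain_anti hik.le))
        · rintro _ ⟨y, hy, rfl⟩
          rw [← Function.iterate_add_apply, ← Function.iterate_add_apply, hki]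
          have h1 := mem_ball.1 (hSb hy)
          have h2 := mem_ball'.1 (hSb hz)
          linarith [dist_triangle (F^[k] y) (F^[k] x) (F^[k] z)])
  have hθk : 0 < θ ^ (k / b) := pow_pos hθ0 _
  have hD : κ' ≤ R * θ ^ (k / b) * ‖deriv F^[k] x‖ := by
    rw [le_div_iff₀ hκ'0, inv_mul_le_iff₀ hpos] at hinv
    linarith
  have h1 : min 1 (κ' * θ / R) * lam ^ k ≤ κ' * θ / R * lam ^ k :=
    mul_le_mul_of_nonneg_right (min_le_right _ _) (by positivity)
  refine h1.trans (le_of_mul_le_mul_left ?_ (mul_pos hR hθk))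
  calc R * θ ^ (k / b) * (κ' * θ / R * lam ^ k)
      = κ' * θ * (lam ^ k * θ ^ (k / b)) := by field_simp
    _ ≤ κ' * θ * θ⁻¹ := mul_le_mul_of_nonneg_left (hlamk k) (by positivity)
    _ = κ' := by field_simp
    _ ≤ _ := hD
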